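/- Let $n\ge 2$, let $q\in\mathbb C\setminus\{0\}$ be not a root of unity ($q=1$ is allowed), and let $p\in\mathbb C\setminus\{0\}$ be arbitrary. **Operators.** For $N\ge 0$ let $K_{i,j}$ be the permutation of the variables $z_i,z_j$ in $\mathbb C[z_1^{\pm1},\dots,z_N^{\pm1}]$ and put $$g_{i,j}=\frac{q^{-1}z_i-qz_j}{z_i-z_j}(K_{i,j}-1)+q,\qquad \xi_{i,j}=K_{i,j}g_{i,j},$$ $$Y_i^{(N)}=\xi_{i,i+1}^{-1}\cdots\xi_{i,N}^{-1}\,p^{D_i}\,\xi_{1,i}\cdots\xi_{i-1,i},\qquad y_i=q^{1-N}Y_i^{(N)},$$ where $p^{D_i}f(z_1,\dots,z_i,\dots,z_N)=f(z_1,\dots,pz_i,\dots,z_N)$. Let $V=\mathbb C^n$ have basis $v_1,\dots,v_n$, let $E^{a,b}v_c=\delta_{b,c}v_a$, and put $$S=-q^{-1}\sum_{a}E^{a,a}\otimes E^{a,a}+(q-q^{-1})\sum_{a<b}E^{a,a}\otimes E^{b,b}-\sum_{a\ne b}E^{a,b}\otimes E^{b,a}.$$ A subscript $i$ on $E^{a,b}$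 means action in the $i$-th factor of $V^{\otimes N}$, and $S_{i,i+1}$ is $S$ in the factors $i,i+1$. The $q$-wedge product is $$\wedge^NV(z)=\bigl(\mathbb C[z_1^{\pm1},\dots,z_N^{\pm1}]\otimes V^{\otimes N}\bigr)/\Omega,\qquad \Omega=\sum_{i=1}^{N-1}\mathrm{Ker}(g_{i,i+1}+S_{i,i+1}^{-1}).$$ On $\mathbb C[z_1^{\pm1},\dots,z_N^{\pm1}]\otimes V^{\otimes N}$ the level-0 action $U_0^{(N)}$ of $U_q'(\widehat{\mathfrak{sl}}_n)$ is given on generators, for $\epsilon=0,\dots,n-1$, by $$K_\epsilon=K_1^\epsilon\cdots K_N^\epsilon,\qquad K_i^\epsilon=q^{E_i^{\epsilon,\epsilon}-E_i^{\epsilon+1,\epsilon+1}},$$ $$E_\epsilon=\sum_{i}y_i^{-\delta_{0,\epsilon}}E_i^{\epsilon,\epsilon+1}K_{i+1}^\epsilon\cdots K_N^\epsilon,\qquad F_\epsilon=\sum_i y_i^{\delta_{0,\epsilon}}(K_1^\epsilon)^{-1}\cdots(K_{i-1}^\epsilon)^{-1}E_i^{\epsilon+1,\epsilon},$$ with the indices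 $\epsilon,\epsilon+1$ of $E^{a,b}$ read modulo $n$ in $\{1,\dots,n\}$. The Hamiltonians are $h_l^{(N)}=\sum_{i=1}^N y_i^l$, $l\in\mathbb Z\setminus\{0\}$. **Spaces and truncation maps.** A normally ordered wedge $w(\mathbf m,\mathbf e)$ is the class of $z_1^{m_1}\cdots z_N^{m_N}\otimes v_{\epsilon_1}\otimes\cdots\otimes v_{\epsilon_N}$, where $\mathbf m=(m_1\le\dots\le m_N)\in\mathbb Z^N$ contains no value more than $n$ times, and $\epsilon_i>\epsilon_{i+1}$ whenever $m_i=m_{i+1}$. Fix $M\in\mathbb Z$ and $0\le s\le n-1$ with $M\equiv s \pmod n$, and let $\mathbf m^0=(m^0_1,m^0_2,\dots)$ consist of $s$ entries $(s-M)/n$, followed, for $t=1,2,\dots$, by $n$ entries $(s-M)/n+t$. For $N=s+nr$, $r\ge0$, let $V_M^N\subset\wedge^NV(z)$ be the span of the $w(\mathbf m,\mathbf e)$ with $m_N\le m_N^0$ (of all of them if $N=0$). Let $g_l^{(N)}=h_l^{(N)}-h_l^{(N)}(\mathbf m^0)$ with $h_l^{(N)}(\mathbf m^0)=\sum_{j=1}^Np^{lm_j^0}q^{2l(1-j)}$.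 **Proposition.** The operators $U_0^{(N)}$ and $h_l^{(N)}$ preserve $\Omega$, and so act on $\wedge^NV(z)$, for all $N\ge0$. Let $r\ge 0$. There is exactly one linear map $\rho^M_{r+1,r}:V_M^{s+nr+n}\to V_M^{s+nr}$ that sends each normally ordered wedge $w(\mathbf m,\mathbf e)\in V_M^{s+nr+n}$ (that is, with $m_{s+nr+n}\le m^0_{s+nr+n}$) to $$w\bigl((m_1,\dots,m_{s+nr}),(\epsilon_1,\dots,\epsilon_{s+nr})\bigr)\quad\text{if } m_i=m_i^0\text{ for all } s+nr<i\le s+nr+n,$$ and to $0$ otherwise. The actions $U_0^{(N)}$ and the operators $g_l^{(N)}$ preserve $V_M^N$ for $N=s+nr+n$ and $N=s+nr$, and $$\text{(i)}\quad \rho^M_{r+1,r}\,U_0^{(s+nr+n)}(x)=U_0^{(s+nr)}(x)\,\rho^M_{r+1,r}$$ for every noncommutative polynomial $x$ in the generators $E_\epsilon,F_\epsilon,K_\epsilon^{\pm1}$; $$\text{(ii)}\quad \rho^M_{r+1,r}\,g_l^{(s+nr+n)}=g_l^{(s+nr)}\,\rho^M_{r+1,r}\qquad\text{for all } l\in\mathbb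 Z\setminus\{0\}.$$ -/

import Mathlib

open scoped TensorProduct

noncomputable section

namespace QWedge

/-! ### Laurent polynomials and the operators acting on them -/

/-- Laurent polynomials `ℂ[z₁^{±1}, …, z_N^{±1}]`; variables are numbered from `0`. -/
abbrev Laurent (N : ℕ) : Type := AddMonoidAlgebra ℂ (Fin N → ℤ)

/-- The monomial `z₁^{m₁} ⋯ z_N^{m_N}`. -/
def mono {N : ℕ} (m : Fin N → ℤ) : Laurent N := AddMonoidAlgebra.single m 1

/-- The variable `z_i`. -/
def zvar {N : ℕ} (i : Fin N) : Laurent N := mono (Pi.single i 1)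

/-- The permutation `K_{i,j}` of the variables `z_i` and `z_j`. -/
def permVar {N : ℕ} (i j : Fin N) : Laurent N ≃ₐ[ℂ] Laurent N :=
  AddMonoidAlgebra.domCongr ℂ ℂ
    (LinearEquiv.funCongrLeft ℤ ℤ (Equiv.swap i j)).toAddEquiv

/-- `(K_{i,j} - 1) z^m / (z_i - z_j)`, as an explicit Laurent polynomial. -/
def divDiffMono {N : ℕ} (i j : Fin N) (m : Fin N → ℤ) : Laurent N :=
  (∑ k ∈ Finset.range (m j - m i).toNat,
      mono (Function.update (Function.update m i (m i + k)) j (m j - 1 - k))) -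
    ∑ k ∈ Finset.range (m i - m j).toNat,
      mono (Function.update (Function.update m i (m j + k)) j (m i - 1 - k))

/-- The linear operator `f ↦ (K_{i,j} f - f) / (z_i - z_j)`. -/
def divDiff {N : ℕ} (i j : Fin N) : Module.End ℂ (Laurent N) :=
  Finsupp.linearCombination ℂ (divDiffMono i j) ∘ₗ
    (AddMonoidAlgebra.coeffLinearEquiv ℂ).toLinearMap

/-- The operator `g_{i,j} = ((q⁻¹ z_i - q z_j) / (z_i - z_j)) (K_{i,j} - 1) + q`. -/
def gOp (q : ℂˣ) {N : ℕ} (i j : Fin N) : Module.End ℂ (Laurent N) :=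
  LinearMap.mulLeft ℂ ((q : ℂ)⁻¹ • zvar i - (q : ℂ) • zvar j) ∘ₗ divDiff i j +
    (q : ℂ) • LinearMap.id

theorem permVar_mono {N : ℕ} (i j : Fin N) (m : Fin N → ℤ) :
    permVar i j (mono m) = mono (m ∘ Equiv.swap i j) := by
  simp only [permVar, mono, AddMonoidAlgebra.domCongr_single]
  rfl

theorem mono_mul {N : ℕ} (a b : Fin N → ℤ) : mono a * mono b = mono (a + b) := by
  simp [mono, AddMonoidAlgebra.single_mul_single]

theorem divDiff_mono {N : ℕ} (i j : Fin N) (m : Fin N → ℤ) :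
    divDiff i j (mono m) = divDiffMono i j m := by
  simp [divDiff, mono]

theorem sum_telescope {N : ℕ} {i j : Fin N} (hij : i ≠ j) (m : Fin N → ℤ) (a b : ℤ) (d : ℕ)
    (hd : b = a + d) :
    (zvar i - zvar j) * ∑ k ∈ Finset.range d,
        mono (Function.update (Function.update m i (a + k)) j (b - 1 - k)) =
      mono (Function.update (Function.update m i b) j a) -
        mono (Function.update (Function.update m i a) j b) := by
  have key : ∀ k : ℕ, (zvar i - zvar j) *
      mono (Function.update (Function.update m i (a + k)) j (b - 1 - k)) =
      mono (Function.update (Function.update m i (a + (k + 1 : ℕ))) j (b - (k + 1 : ℕ))) -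
      mono (Function.update (Function.update m i (a + k)) j (b - k)) := by
    intro k
    rw [sub_mul, zvar, zvar, mono_mul, mono_mul]
    congr 2
    · funext x
      by_cases hx : x = j
      · subst hx; simp [hij.symm]; ring
      · by_cases hx' : x = i
        · subst hx'; simp [hij]; ring
        · simp [hx, hx']
    · funext x
      by_cases hx : x = j
      · subst hx; simp; ring
      · by_cases hx' : x = i
        · subst hx'; simp [hij]
        · simp [hx, hx']
  rw [Finset.mul_sum, Finset.sum_congr rfl (fun k _ => key k),
    Finset.sum_range_sub (fun k : ℕ =>
      mono (Function.update (Function.update m i (a + k)) j (b - k)))]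
  subst hd
  simp

theorem sub_mul_divDiffMono {N : ℕ} {i j : Fin N} (hij : i ≠ j) (m : Fin N → ℤ) :
    (zvar i - zvar j) * divDiffMono i j m = permVar i j (mono m) - mono m := by
  have hs : m ∘ Equiv.swap i j = Function.update (Function.update m i (m j)) j (m i) := by
    funext x
    by_cases hx : x = j
    · subst hx; simp
    · by_cases hx' : x = i
      · subst hx'; simp [hij]
      · simp [hx, hx', Equiv.swap_apply_of_ne_of_ne hx' hx]
  have hm : m = Function.update (Function.update m i (m i)) j (m j) := by simp
  rw [permVar_mono, hs, divDiffMono, mul_sub]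
  rcases le_total (m i) (m j) with h | h
  · rw [sum_telescope hij m (m i) (m j) _ (by omega), Int.toNat_of_nonpos (by omega), ← hm]
    simp
  · rw [sum_telescope hij m (m j) (m i) _ (by omega),
      Int.toNat_of_nonpos (show m j - m i ≤ 0 by omega), ← hm]
    simp

theorem end_ext {N : ℕ} {A B : Module.End ℂ (Laurent N)} (h : ∀ m, A (mono m) = B (mono m)) :
    A = B := by
  apply AddMonoidAlgebra.lhom_ext'
  intro m
  apply LinearMap.ext_ring
  simpa [mono] using h m

/-- `divDiff i j f` is the quotient `(K_{i,j} f - f) / (z_i - z_j)`. -/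
theorem sub_mul_divDiff {N : ℕ} {i j : Fin N} (hij : i ≠ j) (f : Laurent N) :
    (zvar i - zvar j) * divDiff i j f = permVar i j f - f := by
  have : LinearMap.mulLeft ℂ (zvar i - zvar j) ∘ₗ divDiff i j =
      (permVar i j).toLinearMap - LinearMap.id := by
    apply end_ext
    intro m
    simp [divDiff_mono, sub_mul_divDiffMono hij]
  simpa using LinearMap.congr_fun this f

theorem divDiff_self {N : ℕ} (i : Fin N) : divDiff i i = 0 := by
  apply end_ext
  intro m
  simp [divDiff_mono, divDiffMono]

theorem permVar_permVar {N : ℕ} (i j : Fin N) (f : Laurent N) :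
    permVar i j (permVar i j f) = f := by
  have : (permVar i j).toLinearMap ∘ₗ (permVar i j).toLinearMap = LinearMap.id := by
    apply end_ext
    intro m
    simp only [LinearMap.comp_apply, AlgEquiv.toLinearMap_apply, permVar_mono, LinearMap.id_apply]
    congr 1
    funext x
    simp
  simpa using LinearMap.congr_fun this f

theorem permVar_zvar {N : ℕ} (i j : Fin N) : permVar i j (zvar i) = zvar j := by
  rw [zvar, permVar_mono, zvar]
  congr 1
  funext x
  simp only [Function.comp_apply, Pi.single_apply]
  congr 1
  rw [Equiv.swap_apply_eq_iff, Equiv.swap_apply_left]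

theorem permVar_zvar' {N : ℕ} (i j : Fin N) : permVar i j (zvar j) = zvar i := by
  conv_lhs => rw [← permVar_zvar i j]
  exact permVar_permVar i j _

theorem zvar_sub_ne_zero {N : ℕ} {i j : Fin N} (hij : i ≠ j) :
    (zvar i - zvar j : Laurent N) ≠ 0 := by
  intro h
  have h1 : (mono (Pi.single i 1) : Laurent N) = mono (Pi.single j 1) := sub_eq_zero.mp h
  have h2 : (Pi.single i 1 : Fin N → ℤ) = Pi.single j 1 := by
    by_contra hne
    have := congrArg (fun f : Laurent N => f.coeff (Pi.single i 1)) h1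
    simp [mono, AddMonoidAlgebra.coeff_single, Ne.symm hne] at this
  have := congrFun h2 i
  simp [hij] at this

/-- The quadratic relation `g_{i,j}² = (q - q⁻¹) g_{i,j} + 1`. -/
theorem gOp_quadratic (q : ℂˣ) {N : ℕ} (i j : Fin N) :
    gOp q i j * gOp q i j = ((q : ℂ) - (q : ℂ)⁻¹) • gOp q i j + 1 := by
  have hq : (q : ℂ) ≠ 0 := q.ne_zero
  have hqq : (algebraMap ℂ (Laurent N) q) * (algebraMap ℂ (Laurent N) (q : ℂ)⁻¹) = 1 := by
    rw [← map_mul, mul_inv_cancel₀ hq, map_one]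
  by_cases hij : i = j
  · subst hij
    ext1 m
    ext1
    simp only [gOp, divDiff_self, LinearMap.comp_zero, zero_add, LinearMap.comp_apply,
      Module.End.mul_apply, LinearMap.smul_apply, LinearMap.id_apply, LinearMap.add_apply,
      Module.End.one_apply, smul_smul]
    rw [sub_mul, inv_mul_cancel₀ hq, sub_smul, one_smul, sub_add_cancel]
  · apply LinearMap.ext
    intro f
    set D := divDiff (N := N) i j
    have hz := zvar_sub_ne_zero (N := N) hij
    have hc : ∀ f : Laurent N, (zvar i - zvar j) * D f = permVar i j f - f :=
      sub_mul_divDiff hij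
    set Q := algebraMap ℂ (Laurent N) q
    set Q' := algebraMap ℂ (Laurent N) (q : ℂ)⁻¹
    have hg : ∀ f, gOp q i j f = (Q' * zvar i - Q * zvar j) * D f + Q * f := by
      intro f
      simp only [gOp, LinearMap.add_apply, LinearMap.comp_apply, LinearMap.mulLeft_apply,
        LinearMap.smul_apply, LinearMap.id_apply, D, Q, Q']
      simp only [Algebra.smul_def]
    have hKD : permVar i j (D f) = D f := by
      apply mul_left_cancel₀ hz
      have h1 := congrArg (permVar i j) (hc f)
      rw [map_mul, map_sub, map_sub, permVar_zvar, permVar_zvar', permVar_permVar] at h1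
      linear_combination -h1 - hc f
    have hKf : permVar i j f = (zvar i - zvar j) * D f + f := by rw [hc f]; ring
    have hDg : D (gOp q i j f) = Q' * (- D f) := by
      apply mul_left_cancel₀ hz
      rw [hc, hg, map_add, map_mul, map_sub, map_mul, map_mul, map_mul, permVar_zvar,
        permVar_zvar', hKD, hKf]
      have e1 : permVar i j Q = Q := AlgEquiv.commutes _ _
      have e2 : permVar i j Q' = Q' := AlgEquiv.commutes _ _
      rw [e1, e2]
      ring
    rw [Module.End.mul_apply, hg (gOp q i j f), hDg, hg, LinearMap.add_apply,
      LinearMap.smul_apply, hg, Algebra.smul_def, map_sub, Module.End.one_apply]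
    linear_combination f * hqq

/-- `g_{i,j}` as an invertible operator; its inverse is `g_{i,j} - (q - q⁻¹)`. -/
def gUnit (q : ℂˣ) {N : ℕ} (i j : Fin N) : (Module.End ℂ (Laurent N))ˣ where
  val := gOp q i j
  inv := gOp q i j - ((q : ℂ) - (q : ℂ)⁻¹) • 1
  val_inv := by rw [mul_sub, gOp_quadratic]; simp
  inv_val := by rw [sub_mul, gOp_quadratic]; simp

/-- `K_{i,j}` as an invertible operator. -/
def permUnit {N : ℕ} (i j : Fin N) : (Module.End ℂ (Laurent N))ˣ where
  val := (permVar i j).toLinearMap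
  inv := (permVar i j).toLinearMap
  val_inv := LinearMap.ext (permVar_permVar i j)
  inv_val := LinearMap.ext (permVar_permVar i j)

/-- `ξ_{i,j} = K_{i,j} g_{i,j}`. -/
def xiUnit (q : ℂˣ) {N : ℕ} (i j : Fin N) : (Module.End ℂ (Laurent N))ˣ :=
  permUnit i j * gUnit q i j

/-- The shift `z^m ↦ p^{m_i} z^m`, that is `f(…, z_i, …) ↦ f(…, p z_i, …)`. -/
def shiftOp (p : ℂˣ) {N : ℕ} (i : Fin N) : Module.End ℂ (Laurent N) :=
  Finsupp.linearCombination ℂ (fun m : Fin N → ℤ => ((p ^ m i : ℂˣ) : ℂ) • mono m) ∘ₗ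
    (AddMonoidAlgebra.coeffLinearEquiv ℂ).toLinearMap

theorem shiftOp_mono (p : ℂˣ) {N : ℕ} (i : Fin N) (m : Fin N → ℤ) :
    shiftOp p i (mono m) = ((p ^ m i : ℂˣ) : ℂ) • mono m := by
  simp [shiftOp, mono]

/-- The shift `p^{D_i}` as an invertible operator. -/
def shiftUnit (p : ℂˣ) {N : ℕ} (i : Fin N) : (Module.End ℂ (Laurent N))ˣ where
  val := shiftOp p i
  inv := shiftOp p⁻¹ i
  val_inv := by
    apply end_ext
    intro m
    rw [Module.End.mul_apply, shiftOp_mono, map_smul, shiftOp_mono, smul_smul, ← Units.val_mul,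
      inv_zpow, inv_mul_cancel]
    simp
  inv_val := by
    apply end_ext
    intro m
    rw [Module.End.mul_apply, shiftOp_mono, map_smul, shiftOp_mono, smul_smul, ← Units.val_mul,
      inv_zpow, mul_inv_cancel]
    simp

/-- The Cherednik-Dunkl operator
`Y_i = ξ_{i,i+1}⁻¹ ⋯ ξ_{i,N}⁻¹ p^{D_i} ξ_{1,i} ⋯ ξ_{i-1,i}`. -/
def YUnit (q p : ℂˣ) {N : ℕ} (i : Fin N) : (Module.End ℂ (Laurent N))ˣ :=
  (((List.finRange N).filter (fun j => i < j)).map (fun j => (xiUnit q i j)⁻¹)).prod *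
    shiftUnit p i *
    (((List.finRange N).filter (fun j => j < i)).map (fun j => xiUnit q j i)).prod

/-- The affine Hecke generator `y_i = q^{1-N} Y_i`. -/
def yUnit (q p : ℂˣ) {N : ℕ} (i : Fin N) : (Module.End ℂ (Laurent N))ˣ :=
  (q ^ (1 - (N : ℤ))) • YUnit q p i

/-! ### The tensor power of `V = ℂⁿ` -/

/-- `⊗^N ℂⁿ`. The basis vector `v_ε` of `ℂⁿ`, `1 ≤ ε ≤ n`, is `Pi.single (ε - 1) 1`. -/
abbrev Spin (n N : ℕ) : Type := PiTensorProduct ℂ (fun _ : Fin N => Fin n → ℂ)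

/-- `v_{ε₁} ⊗ ⋯ ⊗ v_{ε_N}`. -/
def vec {n N : ℕ} (e : Fin N → Fin n) : Spin n N :=
  PiTensorProduct.tprod ℂ (fun i => (Pi.single (e i) 1 : Fin n → ℂ))

/-- The elementary operator `E^{a,b}` of `ℂⁿ`: `v_b ↦ v_a`, all other `v_c ↦ 0`. -/
def unitMat {n : ℕ} (a b : Fin n) : Module.End ℂ (Fin n → ℂ) :=
  Matrix.toLin' (Matrix.single a b 1)

/-- The operator `A` acting in the `i`-th factor. -/
def siteOp {n N : ℕ} (i : Fin N) (A : Module.End ℂ (Fin n → ℂ)) : Module.End ℂ (Spin n N) :=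
  PiTensorProduct.map (fun j => if j = i then A else LinearMap.id)

/-- The operator `S` acting in the `i`-th and `j`-th factors. -/
def SOp (q : ℂˣ) (n : ℕ) {N : ℕ} (i j : Fin N) : Module.End ℂ (Spin n N) :=
  (-(q : ℂ)⁻¹) • (∑ a : Fin n, siteOp i (unitMat a a) * siteOp j (unitMat a a)) +
    ((q : ℂ) - (q : ℂ)⁻¹) •
      (∑ a : Fin n, ∑ b : Fin n,
        if a < b then siteOp i (unitMat a a) * siteOp j (unitMat b b) else 0) -
    ∑ a : Fin n, ∑ b : Fin n,
      if a ≠ b then siteOp i (unitMat a b) * siteOp j (unitMat b a) else 0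

theorem siteOp_vec {n N : ℕ} (i : Fin N) (a b : Fin n) (e : Fin N → Fin n) :
    siteOp i (unitMat a b) (vec e) = if e i = b then vec (Function.update e i a) else 0 := by
  have hE : ∀ c : Fin n, unitMat a b (Pi.single c 1) = if c = b then Pi.single a 1 else 0 := by
    intro c
    rw [unitMat, Matrix.toLin'_apply, Matrix.mulVec_single_one]
    by_cases h : c = b
    · subst h
      ext x
      simp [Matrix.single_apply, Pi.single_apply, eq_comm]
    · ext x
      simp [h, Ne.symm h]
  rw [siteOp, vec, PiTensorProduct.map_tprod]
  split_ifs with h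
  · rw [vec]
    congr 1
    funext x
    by_cases hx : x = i
    · subst hx; simp [hE, h]
    · simp [hx]
  · apply (PiTensorProduct.tprod ℂ).map_coord_zero i
    simp [hE, h]

theorem spin_ext {n N : ℕ} {A B : Module.End ℂ (Spin n N)} (h : ∀ e, A (vec e) = B (vec e)) :
    A = B := by
  apply (Basis.piTensorProduct (fun _ : Fin N => Pi.basisFun ℂ (Fin n))).ext
  intro e
  simpa [vec, Pi.basisFun_apply] using h e

theorem SOp_vec (q : ℂˣ) {n N : ℕ} {i j : Fin N} (hij : i ≠ j) (e : Fin N → Fin n) :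
    SOp q n i j (vec e) =
      if e i = e j then (-(q : ℂ)⁻¹) • vec e
      else (if e i < e j then ((q : ℂ) - (q : ℂ)⁻¹) • vec e else 0) -
        vec (e ∘ Equiv.swap i j) := by
  have hs : e ∘ Equiv.swap i j = Function.update (Function.update e j (e i)) i (e j) := by
    funext x
    by_cases hx : x = i
    · subst hx; simp
    · by_cases hx' : x = j
      · subst hx'; simp [hij.symm]
      · simp [hx, hx', Equiv.swap_apply_of_ne_of_ne hx hx']
  have hprod : ∀ a b c d : Fin n, (siteOp i (unitMat a b) * siteOp j (unitMat c d)) (vec e) =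
      if e i = b ∧ e j = d then vec (Function.update (Function.update e j c) i a) else 0 := by
    intro a b c d
    rw [Module.End.mul_apply, siteOp_vec]
    by_cases h : e j = d
    · rw [if_pos h, siteOp_vec]; simp [h, hij]
    · simp [h]
  have t1 : ∑ a : Fin n, (siteOp i (unitMat a a) * siteOp j (unitMat a a)) (vec e) =
      if e i = e j then vec e else 0 := by
    simp only [hprod]
    rw [Finset.sum_eq_single (e i)]
    · by_cases h : e i = e j
      · rw [if_pos ⟨rfl, h.symm⟩, if_pos h]; congr 1
        have h1 : Function.update e j (e i) = e := by rw [h]; simp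
        rw [h1]; simp
      · simp [h, Ne.symm h]
    · intro b _ hb; simp [Ne.symm hb]
    · simp
  have t2 : ∑ a : Fin n, ∑ b : Fin n,
      (if a < b then siteOp i (unitMat a a) * siteOp j (unitMat b b) else 0) (vec e) =
      if e i < e j then vec e else 0 := by
    rw [Finset.sum_eq_single (e i), Finset.sum_eq_single (e j)]
    · split_ifs
      · rw [hprod]; simp
      · simp
    · intro b _ hb; split_ifs
      · rw [hprod]; simp [Ne.symm hb]
      · simp
    · simp
    · intro b _ hb
      apply Finset.sum_eq_zero
      intro c _
      split_ifs
      · rw [hprod]; simp [Ne.symm hb]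
      · simp
    · simp
  have t3 : ∑ a : Fin n, ∑ b : Fin n,
      (if a ≠ b then siteOp i (unitMat a b) * siteOp j (unitMat b a) else 0) (vec e) =
      if e i = e j then 0 else vec (e ∘ Equiv.swap i j) := by
    rw [Finset.sum_eq_single (e j), Finset.sum_eq_single (e i)]
    · by_cases h : e i = e j
      · simp [h]
      · rw [if_pos (Ne.symm h), hprod, if_neg h, hs]; simp
    · intro b _ hb; split_ifs
      · rw [hprod]; simp [Ne.symm hb]
      · simp
    · simp
    · intro b _ hb
      apply Finset.sum_eq_zero
      intro c _
      split_ifs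
      · rw [hprod]; simp [Ne.symm hb]
      · simp
    · simp
  simp only [SOp, LinearMap.sub_apply, LinearMap.add_apply, LinearMap.smul_apply,
    LinearMap.sum_apply, t1, t2, t3]
  by_cases h : e i = e j
  · simp only [h, if_true, lt_irrefl, if_false, smul_zero, add_zero, sub_zero]
  · simp [h]

/-- The quadratic relation `S² = (q - q⁻¹) S + 1`. -/
theorem SOp_quadratic (q : ℂˣ) (n : ℕ) {N : ℕ} {i j : Fin N} (hij : i ≠ j) :
    SOp q n i j * SOp q n i j = ((q : ℂ) - (q : ℂ)⁻¹) • SOp q n i j + 1 := by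
  have hq : (q : ℂ) ≠ 0 := q.ne_zero
  apply spin_ext
  intro e
  have hss : (e ∘ Equiv.swap i j) ∘ Equiv.swap i j = e := by funext x; simp
  rw [Module.End.mul_apply, LinearMap.add_apply, LinearMap.smul_apply, Module.End.one_apply,
    SOp_vec q hij e]
  rcases lt_trichotomy (e i) (e j) with h | h | h
  · rw [if_neg h.ne, if_pos h, map_sub, map_smul, SOp_vec q hij e, SOp_vec q hij (e ∘ _), hss]
    simp only [Function.comp_apply, Equiv.swap_apply_left, Equiv.swap_apply_right, if_neg h.ne,
      if_neg h.ne', if_pos h, if_neg h.le.not_gt]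
    abel
  · rw [if_pos h, map_smul, SOp_vec q hij e, if_pos h, smul_smul, smul_smul]
    nth_rewrite 3 [← one_smul ℂ (vec e)]
    rw [← add_smul]
    congr 1
    field_simp
    ring
  · rw [if_neg h.ne', if_neg h.le.not_gt, zero_sub, map_neg, SOp_vec q hij (e ∘ _), hss]
    simp [h.ne, h, add_comm, sub_eq_add_neg]

/-- `S_{i,j}`, `i ≠ j`, as an invertible operator; its inverse is `S_{i,j} + (q⁻¹ - q)`. -/
def SUnit (q : ℂˣ) (n : ℕ) {N : ℕ} {i j : Fin N} (hij : i ≠ j) : (Module.End ℂ (Spin n N))ˣ where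
  val := SOp q n i j
  inv := SOp q n i j + ((q : ℂ)⁻¹ - (q : ℂ)) • 1
  val_inv := by
    rw [mul_add, SOp_quadratic q n hij, mul_smul_comm, mul_one, add_right_comm, ← add_smul]
    simp
  inv_val := by
    rw [add_mul, SOp_quadratic q n hij, smul_mul_assoc, one_mul, add_right_comm, ← add_smul]
    simp

/-! ### The `q`-wedge product -/

/-- `⊗^N V(z) = ℂ[z₁^{±1}, …, z_N^{±1}] ⊗ (⊗^N ℂⁿ)`. -/
abbrev Tens (n N : ℕ) : Type := Laurent N ⊗[ℂ] Spin n N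

/-- `Ω = ∑_i Ker (g_{i,i+1} + S_{i,i+1}⁻¹)`. -/
def Omega (n : ℕ) (q : ℂˣ) (N : ℕ) : Submodule ℂ (Tens n N) :=
  ⨆ (i : Fin N) (j : Fin N) (h : (i : ℕ) + 1 = j),
    LinearMap.ker
      ((gOp q i j).rTensor (Spin n N) +
        ((SUnit q n (i := i) (j := j) (by rintro rfl; omega))⁻¹.val).lTensor (Laurent N))

/-- The `q`-wedge product `⋀^N V(z) = ⊗^N V(z) / Ω`. -/
abbrev Wedge (n : ℕ) (q : ℂˣ) (N : ℕ) : Type := Tens n N ⧸ Omega n q N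

/-- The wedge `w(m, e) = z^{m₁} v_{ε₁} ∧ ⋯ ∧ z^{m_N} v_{ε_N}`. -/
def wedge (n : ℕ) (q : ℂˣ) {N : ℕ} (m : Fin N → ℤ) (e : Fin N → Fin n) : Wedge n q N :=
  (Omega n q N).mkQ (mono m ⊗ₜ[ℂ] vec e)

/-- The labels of the normally ordered wedges: `m` is non-decreasing, contains no value more than
`n` times, and `ε_i > ε_{i+1}` whenever `m_i = m_{i+1}`. -/
def NormallyOrdered {n N : ℕ} (m : Fin N → ℤ) (e : Fin N → Fin n) : Prop :=
  Monotone m ∧ (∀ c : ℤ, (Finset.univ.filter (fun i => m i = c)).card ≤ n) ∧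
    ∀ i j : Fin N, (i : ℕ) + 1 = j → m i = m j → e j < e i

/-! ### The level-zero action and the Hamiltonians -/

/-- Generators `E_ε, F_ε, K_ε, K_ε⁻¹`, `0 ≤ ε ≤ n - 1`, of the quantum affine algebra. -/
inductive Gen (n : ℕ) : Type
  | E (c : Fin n)
  | F (c : Fin n)
  | K (c : Fin n)
  | Kinv (c : Fin n)

/-- Position of `v_ε` in the basis `v₁, …, v_n`, with `ε` read modulo `n`: it is `ε - 1` for
`1 ≤ ε ≤ n - 1`, and `n - 1` for `ε = 0`. The position of `v_{ε+1}` is then `ε` itself. -/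
def pos {n : ℕ} (c : Fin n) : Fin n := (finRotate n).symm c

/-- The operator `q^{t (E^{ε,ε} - E^{ε+1,ε+1})}` of `ℂⁿ`. -/
def Kmat (q : ℂˣ) {n : ℕ} (c : Fin n) (t : ℤ) : Module.End ℂ (Fin n → ℂ) :=
  Matrix.toLin' (Matrix.diagonal (fun a : Fin n =>
    ((q ^ (t * ((if a = pos c then 1 else 0) - (if a = c then 1 else 0))) : ℂˣ) : ℂ)))

/-- The action of a generator on `⊗^N V(z)`:
`K_ε = K₁^ε ⋯ K_N^ε`, `E_ε = ∑_i y_i^{-δ_{0,ε}} E_i^{ε,ε+1} K_{i+1}^ε ⋯ K_N^ε`,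
`F_ε = ∑_i y_i^{δ_{0,ε}} (K_1^ε)⁻¹ ⋯ (K_{i-1}^ε)⁻¹ E_i^{ε+1,ε}`. -/
def genOp (n : ℕ) (q p : ℂˣ) (N : ℕ) : Gen n → Module.End ℂ (Tens n N)
  | .E c => ∑ i : Fin N, TensorProduct.map
      ((yUnit q p i ^ (if (c : ℕ) = 0 then (-1 : ℤ) else 0) : (Module.End ℂ (Laurent N))ˣ) :
        Module.End ℂ (Laurent N))
      (siteOp i (unitMat (pos c) c) *
        PiTensorProduct.map (fun j => if i < j then Kmat q c 1 else LinearMap.id))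
  | .F c => ∑ i : Fin N, TensorProduct.map
      ((yUnit q p i ^ (if (c : ℕ) = 0 then (1 : ℤ) else 0) : (Module.End ℂ (Laurent N))ˣ) :
        Module.End ℂ (Laurent N))
      (PiTensorProduct.map (fun j => if j < i then Kmat q c (-1) else LinearMap.id) *
        siteOp i (unitMat c (pos c)))
  | .K c => (PiTensorProduct.map (fun _ => Kmat q c 1)).lTensor (Laurent N)
  | .Kinv c => (PiTensorProduct.map (fun _ => Kmat q c (-1))).lTensor (Laurent N)

/-- The level-zero action `U_0^{(N)}` on `⊗^N V(z)` of all noncommutative polynomials in the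
generators. -/
def U0 (n : ℕ) (q p : ℂˣ) (N : ℕ) : FreeAlgebra ℂ (Gen n) →ₐ[ℂ] Module.End ℂ (Tens n N) :=
  FreeAlgebra.lift ℂ (genOp n q p N)

/-- The Hamiltonian `h_l^{(N)} = ∑_i (q^{1-N} Y_i^{(N)})^l` on `⊗^N V(z)`. -/
def hOp (n : ℕ) (q p : ℂˣ) (N : ℕ) (l : ℤ) : Module.End ℂ (Tens n N) :=
  (∑ i : Fin N,
    ((yUnit q p i ^ l : (Module.End ℂ (Laurent N))ˣ) : Module.End ℂ (Laurent N))).rTensor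
      (Spin n N)

/-- `A` preserves `Ω`, so that it is well defined on the wedge product. -/
def Descends {n : ℕ} (q : ℂˣ) {N : ℕ} (A : Module.End ℂ (Tens n N)) : Prop :=
  Omega n q N ≤ (Omega n q N).comap A

open Classical in
/-- The operator induced on the wedge product by an operator `A` which preserves `Ω`. -/
def onWedge {n : ℕ} (q : ℂˣ) {N : ℕ} (A : Module.End ℂ (Tens n N)) :
    Module.End ℂ (Wedge n q N) :=
  if h : Descends q A then (Omega n q N).mapQ (Omega n q N) A h else 0

/-! ### Vacuum sequences, the spaces `V_M^N` and the truncation maps -/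

/-- The entry of index `j` (counted from `0`) of the vacuum sequence
`(m⁰, …, m⁰, m⁰+1, …, m⁰+1, m⁰+2, …)`, with `s` entries `m⁰ = (s - M)/n` followed by blocks of
length `n`. -/
def vac (n : ℕ) (M : ℤ) (s : ℕ) (j : ℕ) : ℤ :=
  ((s : ℤ) - M) / (n : ℤ) + if j < s then 0 else (((j - s) / n + 1 : ℕ) : ℤ)

/-- The labels of the normally ordered wedges that span `V_M^N`: `m_N ≤ m⁰_N`. -/
def Admissible {n N : ℕ} (M : ℤ) (s : ℕ) (m : Fin N → ℤ) (e : Fin N → Fin n) : Prop :=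
  NormallyOrdered m e ∧ ∀ i : Fin N, (i : ℕ) + 1 = N → m i ≤ vac n M s i

/-- The subspace `V_M^N` of `⋀^N V(z)`. -/
def VM (n : ℕ) (q : ℂˣ) (M : ℤ) (s N : ℕ) : Submodule ℂ (Wedge n q N) :=
  Submodule.span ℂ {w | ∃ m e, Admissible M s m e ∧ w = wedge n q m e}

/-- The truncation map `ρ : V_M^{N+n} → V_M^N`: if the last `n` entries of `m` all agree
with those of the vacuum sequence, they are dropped; all other normally ordered wedges go to `0`. -/
def IsTruncation {n : ℕ} {q : ℂˣ} {M : ℤ} {s N : ℕ}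
    (ρ : VM n q M s (N + n) →ₗ[ℂ] VM n q M s N) : Prop :=
  ∀ (m : Fin (N + n) → ℤ) (e : Fin (N + n) → Fin n) (h : Admissible M s m e),
    ((∀ i : Fin n, m (Fin.natAdd N i) = vac n M s (N + i)) →
      (ρ ⟨wedge n q m e, Submodule.subset_span ⟨m, e, h, rfl⟩⟩ : Wedge n q N) =
        wedge n q (fun i => m (Fin.castAdd n i)) (fun i => e (Fin.castAdd n i))) ∧
    ((¬ ∀ i : Fin n, m (Fin.natAdd N i) = vac n M s (N + i)) →
      ρ ⟨wedge n q m e, Submodule.subset_span ⟨m, e, h, rfl⟩⟩ = 0)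

/-- `h_l^{(N)}(m⁰) = ∑_{j=1}^N p^{l m⁰_j} q^{2l(1-j)}`. -/
def hVac (n : ℕ) (q p : ℂˣ) (M : ℤ) (s N : ℕ) (l : ℤ) : ℂ :=
  ∑ j : Fin N, ((p ^ (l * vac n M s j) * q ^ (2 * l * (1 - ((j : ℤ) + 1))) : ℂˣ) : ℂ)

/-- `g_l^{(N)} = h_l^{(N)} - h_l^{(N)}(m⁰)` on the wedge product. -/
def gHam (n : ℕ) (q p : ℂˣ) (M : ℤ) (s N : ℕ) (l : ℤ) : Module.End ℂ (Wedge n q N) :=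
  onWedge q (hOp n q p N l) - hVac n q p M s N l • 1

/-- The operators `A` and `B` preserve `V_M^{N+n}` and `V_M^N`, and `ρ A = B ρ`. -/
def Intertwines {n : ℕ} {q : ℂˣ} {M : ℤ} {s N : ℕ}
    (ρ : VM n q M s (N + n) →ₗ[ℂ] VM n q M s N)
    (A : Module.End ℂ (Wedge n q (N + n))) (B : Module.End ℂ (Wedge n q N)) : Prop :=
  ∃ (hA : ∀ v ∈ VM n q M s (N + n), A v ∈ VM n q M s (N + n))
    (hB : ∀ v ∈ VM n q M s N, B v ∈ VM n q M s N),
    ρ ∘ₗ A.restrict hA = B.restrict hB ∘ₗ ρ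

end QWedge

end

/-! Write `g_i`, `S_i` for `g_{i,i+1}`, `S_{i,i+1}`. Three facts carry the proof.

Descent. `g_i` and `S_i` commute and satisfy the same relation `X² = (q - q⁻¹) X + 1`. Since `q +
q⁻¹ ≠ 0`, the kernel of `g_i + S_i⁻¹` is the range of `g_i - S_i` (`ker_eq_range`), so the wedge
product is the quotient in which `g_i f ⊗ v = f ⊗ S_i v` (`cls_gOp`). Together with the `g_i`, the
`y_i` satisfy the affine Hecke relations (`gUnit_YUnit_gUnit`, `YUnit_comm`, `gUnit_comm_YUnit`).
Hence power sums of the `y_i` commute with every `g_i` (`commute_zpow_add_zpow`). For `ε ≠ 0` the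
spin operators `E_ε`, `F_ε` commute with every `S_i`; for `ε = 0` neighbouring summands obey an
exchange relation with `S_i` that is compensated by `g_i y_i g_i = y_{i+1}` (`descends_sum`).

Basis. The relation rewrites a monomial with a descent through the swapped monomial and monomials
whose two exponents have moved towards each other; the latter have a smaller sum of squares. So
normally ordered wedges span, and straightening never leaves a class of exponents closed under
swapping and squeezing (`cls_mem_wedgeSpan`). They are independent because the antisymmetrizer, the
sum of `T_w ⊗ T_w` over the symmetric group, kills `Ω` (`antisym_mul_sub`) and is unitriangular on
sorted vectors (`antisym_sub_mem`). Linear maps may therefore be prescribed on normally ordered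
wedges.

Tail. Let `ν` be the vacuum exponent of the last `n` sites. Then `V_M^N` is spanned by the normally
ordered wedges with all exponents below `ν`, and `V_M^{N+n}` by those with all exponents at most
`ν`. A normally ordered wedge of the second kind either ends in the complete tail `z^ν v_n ∧ ⋯ ∧ z^ν
v_1` or has fewer than `n` exponents `ν`. The latter class (`Few`) is closed under swapping and
squeezing, so its span is stable under all the operators, and truncation kills it. Modulo this span,
on a wedge with a complete tail, `y_i` with `i ≤ N` acts as the `N`-variable `y_i`, and the `y` of a
tail site acts by a scalar (`yUnit_cast_mem`, `yUnit_nat_mem`). `E` and `F` at a tail site repeat a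
basis vector and give zero; the `K` factors over the whole tail multiply to one. So each operator
acts as its `N`-variable version plus a scalar: zero for `U_0`, and for `h_l` the difference of the
two vacuum eigenvalues, which passing to `g_l` removes (`tailAlgebra`, `tailAlgebra_intertwines`).
-/

noncomputable section

namespace QWedge

/-! ### Relations between the operators on Laurent polynomials -/

/-- The scalar `x` as a constant Laurent polynomial. -/
abbrev con (N : ℕ) (x : ℂ) : Laurent N := algebraMap ℂ (Laurent N) x

theorem con_mul_inv (q : ℂˣ) (N : ℕ) : con N (q : ℂ) * con N (q : ℂ)⁻¹ = 1 := by
  rw [← map_mul, mul_inv_cancel₀ q.ne_zero, map_one]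

/-- Clears the denominator of `g`. The Laurent ring is a domain, so identities between the `g`'s may
be checked after multiplication by differences of variables. -/
theorem sub_mul_gOp (q : ℂˣ) {N : ℕ} {i j : Fin N} (hij : i ≠ j) (f : Laurent N) :
    (zvar i - zvar j) * gOp q i j f =
      (con N (q : ℂ)⁻¹ * zvar i - con N q * zvar j) * permVar i j f +
        (con N q - con N (q : ℂ)⁻¹) * zvar i * f := by
  simp only [gOp, LinearMap.add_apply, LinearMap.comp_apply, LinearMap.mulLeft_apply,
    LinearMap.smul_apply, LinearMap.id_apply]
  simp only [Algebra.smul_def]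
  linear_combination (con N (q : ℂ)⁻¹ * zvar i - con N q * zvar j) * sub_mul_divDiff hij f

theorem gOp_self (q : ℂˣ) {N : ℕ} (i : Fin N) : gOp q i i = (q : ℂ) • LinearMap.id := by
  simp [gOp, divDiff_self]

/-- The coefficient of `g` is homogeneous of degree zero, so a common scaling `c` of the two
variables cancels. Permutations of variables and shifts are both covered. -/
theorem map_gOp (q : ℂˣ) {N : ℕ} (φ : Laurent N →ₐ[ℂ] Laurent N) {i j i' j' : Fin N}
    (hij : i ≠ j) (hij' : i' ≠ j') (c : ℂˣ) (hi : φ (zvar i) = con N c * zvar i')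
    (hj : φ (zvar j) = con N c * zvar j')
    (hK : ∀ f, φ (permVar i j f) = permVar i' j' (φ f)) (f : Laurent N) :
    φ (gOp q i j f) = gOp q i' j' (φ f) := by
  apply mul_left_cancel₀ (zvar_sub_ne_zero hij')
  have hc : con N c ≠ 0 := by
    intro h
    have := con_mul_inv c N
    rw [h, zero_mul] at this
    exact zero_ne_one this
  apply mul_left_cancel₀ hc
  rw [sub_mul_gOp q hij', ← hK]
  have h := congrArg φ (sub_mul_gOp q hij f)
  simp only [map_mul, map_sub, map_add, hi, hj, AlgHom.commutes] at h
  linear_combination h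

theorem permVar_comm (N : ℕ) (a b c d : Fin N) (f : Laurent N) :
    permVar a b (permVar c d f) =
      permVar (Equiv.swap a b c) (Equiv.swap a b d) (permVar a b f) := by
  have : (permVar a b).toLinearMap ∘ₗ (permVar c d).toLinearMap =
      (permVar (Equiv.swap a b c) (Equiv.swap a b d)).toLinearMap ∘ₗ
        (permVar a b).toLinearMap := by
    apply end_ext
    intro m
    simp only [LinearMap.comp_apply, AlgEquiv.toLinearMap_apply, permVar_mono]
    congr 1
    funext x
    simp only [Function.comp_apply]
    congr 1
    have h := congrFun (congrArg DFunLike.coe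
      (Equiv.mul_swap_eq_swap_mul (Equiv.swap a b) c d)) (Equiv.swap a b x)
    simp only [Equiv.Perm.mul_apply, Equiv.swap_apply_self] at h
    have h2 := congrArg (Equiv.swap a b) h
    rw [Equiv.swap_apply_self] at h2
    exact h2
  simpa using LinearMap.congr_fun this f

theorem permVar_zvar_apply {N : ℕ} (a b i : Fin N) :
    permVar a b (zvar i) = zvar (Equiv.swap a b i) := by
  rw [zvar, permVar_mono, zvar]
  congr 1
  funext x
  simp only [Function.comp_apply, Pi.single_apply]
  congr 1
  rw [Equiv.swap_apply_eq_iff]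

theorem permVar_gOp (q : ℂˣ) {N : ℕ} (a b i j : Fin N) (f : Laurent N) :
    permVar a b (gOp q i j f) =
      gOp q (Equiv.swap a b i) (Equiv.swap a b j) (permVar a b f) := by
  by_cases hij : i = j
  · subst hij
    simp [gOp_self]
  · exact map_gOp q (permVar a b).toAlgHom hij (by simpa using hij) 1
      (by simp [permVar_zvar_apply]) (by simp [permVar_zvar_apply])
      (fun f => permVar_comm N a b i j f) f

theorem gOp_comm (q : ℂˣ) {N : ℕ} {i j k l : Fin N} (hik : i ≠ k) (hil : i ≠ l) (hjk : j ≠ k)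
    (hjl : j ≠ l) (f : Laurent N) : gOp q i j (gOp q k l f) = gOp q k l (gOp q i j f) := by
  by_cases hij : i = j
  · subst hij; simp [gOp_self]
  by_cases hkl : k = l
  · subst hkl; simp [gOp_self]
  have e1 := sub_mul_gOp q hij (gOp q k l f)
  have e2 := sub_mul_gOp q hkl (gOp q i j f)
  have e3 := sub_mul_gOp q hkl f
  have e4 := sub_mul_gOp q hij f
  have e5 := sub_mul_gOp q hkl (permVar i j f)
  have e6 := sub_mul_gOp q hij (permVar k l f)
  have s1 := permVar_gOp q i j k l f
  have s2 := permVar_gOp q k l i j f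
  have s3 := permVar_comm N i j k l f
  rw [Equiv.swap_apply_of_ne_of_ne hik.symm hjk.symm,
    Equiv.swap_apply_of_ne_of_ne hil.symm hjl.symm] at s1 s3
  rw [Equiv.swap_apply_of_ne_of_ne hik hil, Equiv.swap_apply_of_ne_of_ne hjk hjl] at s2
  rw [s1] at e1
  rw [s2] at e2
  rw [s3] at e6
  apply mul_left_cancel₀ (zvar_sub_ne_zero hij)
  apply mul_left_cancel₀ (zvar_sub_ne_zero hkl)
  set Q := con N (q : ℂ)
  set Q' := con N (q : ℂ)⁻¹
  linear_combination (zvar k - zvar l) * e1 - (zvar i - zvar j) * e2 +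
    (Q' * zvar i - Q * zvar j) * e5 - (Q' * zvar k - Q * zvar l) * e6 +
    (Q - Q') * zvar i * e3 - (Q - Q') * zvar k * e4

/-- Bookkeeping for a triple product `G` of `g`'s: `a`, `b`, `d` stand for the differences `x - y`,
`y - z`, `x - z`; `u`, `v`, `w`, `t` for numerators `P x - Q y` and the like; `f1`, …, `f5` for the
images of `f` under the nontrivial permutations of three variables; capital letters for intermediate
products. The minus sign in `e5` comes from a `g` with its indices reversed. -/
theorem braid_expand {R : Type*} [CommRing R]
    {x y a b d c u v w t f f1 f2 f3 f4 f5 G W R1 S V T U : R}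
    (e1 : a * G = u * R1 + c * x * W)
    (e2 : d * R1 = w * S + c * x * V)
    (e3 : b * W = v * T + c * y * U)
    (e4 : b * S = v * f5 + c * y * f3)
    (e5 : -a * V = t * f + c * y * f1)
    (e6 : d * T = w * f4 + c * x * f2)
    (e7 : a * U = u * f1 + c * x * f) :
    d * (b * (a ^ 2 * G)) = u * a * w * (v * f5 + c * y * f3) - u * b * c * x * (t * f + c * y * f1) +
      c * x * a * v * (w * f4 + c * x * f2) + c * x * d * c * y * (u * f1 + c * x * f) := by
  have h1 : d * (b * (a ^ 2 * G)) = u * a * b * (d * R1) + c * x * a * d * (b * W) := by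
    linear_combination a * b * d * e1
  have h2 : u * a * b * (d * R1) = u * a * w * (b * S) + u * b * c * x * (a * V) := by
    rw [e2]; ring
  have h3 : c * x * a * d * (b * W) = c * x * a * v * (d * T) + c * x * d * c * y * (a * U) := by
    rw [e3]; ring
  rw [h1, h2, h3, e4, e6, e7]
  linear_combination (-(u * b * c * x)) * e5

theorem braid_expand' {R : Type*} [CommRing R]
    {x y z a b d c u v w t f f1 f2 f3 f4 f5 G W R1 S V T U : R}
    (e1 : b * G = v * R1 + c * y * W)
    (e2 : d * R1 = w * S + c * x * V)
    (e3 : a * W = u * T + c * x * U)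
    (e4 : a * S = u * f5 + c * x * f4)
    (e5 : -b * V = t * f + c * z * f2)
    (e6 : d * T = w * f3 + c * x * f1)
    (e7 : b * U = v * f2 + c * y * f) :
    d * (a * (b ^ 2 * G)) = v * b * w * (u * f5 + c * x * f4) - v * a * c * x * (t * f + c * z * f2) +
      c * y * b * u * (w * f3 + c * x * f1) + c * y * d * c * x * (v * f2 + c * y * f) := by
  have h1 : d * (a * (b ^ 2 * G)) = v * b * a * (d * R1) + c * y * b * d * (a * W) := by
    linear_combination a * b * d * e1
  have h2 : v * b * a * (d * R1) = v * b * w * (a * S) + v * a * c * x * (b * V) := by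
    rw [e2]; ring
  have h3 : c * y * b * d * (a * W) = c * y * b * u * (d * T) + c * y * d * c * x * (b * U) := by
    rw [e3]; ring
  rw [h1, h2, h3, e4, e6, e7]
  linear_combination (-(v * a * c * x)) * e5

theorem braid_aux {R : Type*} [CommRing R] [IsDomain R]
    {x y z P Q f f1 f2 f3 f4 f5 G W R1 S V T U G' W' R' S' V' T' U' : R}
    (hxy : x - y ≠ 0) (hyz : y - z ≠ 0) (hxz : x - z ≠ 0)
    (e1 : (x - y) * G = (P * x - Q * y) * R1 + (Q - P) * x * W)
    (e2 : (x - z) * R1 = (P * x - Q * z) * S + (Q - P) * x * V)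
    (e3 : (y - z) * W = (P * y - Q * z) * T + (Q - P) * y * U)
    (e4 : (y - z) * S = (P * y - Q * z) * f5 + (Q - P) * y * f3)
    (e5 : (y - x) * V = (P * y - Q * x) * f + (Q - P) * y * f1)
    (e6 : (x - z) * T = (P * x - Q * z) * f4 + (Q - P) * x * f2)
    (e7 : (x - y) * U = (P * x - Q * y) * f1 + (Q - P) * x * f)
    (k1 : (y - z) * G' = (P * y - Q * z) * R' + (Q - P) * y * W')
    (k2 : (x - z) * R' = (P * x - Q * z) * S' + (Q - P) * x * V')
    (k3 : (x - y) * W' = (P * x - Q * y) * T' + (Q - P) * x * U')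
    (k4 : (x - y) * S' = (P * x - Q * y) * f5 + (Q - P) * x * f4)
    (k5 : (z - y) * V' = (P * z - Q * y) * f + (Q - P) * z * f2)
    (k6 : (x - z) * T' = (P * x - Q * z) * f3 + (Q - P) * x * f1)
    (k7 : (y - z) * U' = (P * y - Q * z) * f2 + (Q - P) * y * f) : G = G' := by
  rw [← neg_sub] at e5 k5
  have h1 := braid_expand e1 e2 e3 e4 e5 e6 e7
  have h2 := braid_expand' k1 k2 k3 k4 k5 k6 k7
  apply mul_left_cancel₀ (pow_ne_zero 2 hxy)
  apply mul_left_cancel₀ (pow_ne_zero 2 hyz)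
  apply mul_left_cancel₀ hxz
  linear_combination (y - z) * h1 - (x - y) * h2

theorem gOp_braid (q : ℂˣ) {N : ℕ} {i j k : Fin N} (hij : i ≠ j) (hjk : j ≠ k) (hik : i ≠ k)
    (f : Laurent N) :
    gOp q i j (gOp q j k (gOp q i j f)) = gOp q j k (gOp q i j (gOp q j k f)) := by
  have A := fun h => sub_mul_gOp q hij h
  have A' := fun h => sub_mul_gOp q hij.symm h
  have B := fun h => sub_mul_gOp q hjk h
  have B' := fun h => sub_mul_gOp q hjk.symm h
  have C := fun h => sub_mul_gOp q hik h
  have sk : Equiv.swap i j k = k := Equiv.swap_apply_of_ne_of_ne hik.symm hjk.symm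
  have ti : Equiv.swap j k i = i := Equiv.swap_apply_of_ne_of_ne hij hik
  have rj : Equiv.swap i k j = j := Equiv.swap_apply_of_ne_of_ne hij.symm hjk
  have sH := fun h => permVar_gOp q i j j k h
  have tG := fun h => permVar_gOp q j k i j h
  have sG := fun h => permVar_gOp q i j i j h
  have tH := fun h => permVar_gOp q j k j k h
  have rG := fun h => permVar_gOp q i k j i h
  have rH := fun h => permVar_gOp q i k k j h
  have st := fun h => permVar_comm N i j j k h
  have ts := fun h => permVar_comm N j k i j h
  simp only [Equiv.swap_apply_right, Equiv.swap_apply_left, sk, ti, rj] at sH tG sG tH rG rH st ts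
  have c1 : ∀ a b, permVar (N := N) a b = permVar b a := fun a b => by
    rw [permVar, permVar, Equiv.swap_comm]
  have e1 := A (gOp q j k (gOp q i j f))
  have e2 := C (permVar i j (gOp q i j f))
  have e3 := B (gOp q i j f)
  have e4 := B (permVar i k (permVar i j f))
  have e5 := A' (permVar i j f)
  have e6 := C (permVar j k f)
  have e7 := A f
  rw [c1 j i, permVar_permVar] at e5
  rw [sH, sG] at e1
  rw [sG, rG] at e2
  rw [tG] at e3
  have k1 := B (gOp q i j (gOp q j k f))
  have k2 := C (permVar j k (gOp q j k f))
  have k3 := A (gOp q j k f)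
  have k4 := A (permVar i k (permVar j k f))
  have k5 := B' (permVar j k f)
  have k6 := C (permVar i j f)
  have k7 := B f
  rw [c1 k j, permVar_permVar] at k5
  rw [tG, tH] at k1
  rw [tH, rH] at k2
  rw [sH] at k3
  rw [← st] at e2 e4 k6
  rw [← ts] at k2 k4 e6
  -- The longest permutation has two reduced words; they must be identified so that both expansions
  -- use the same `f5`.
  have hb : permVar j k (permVar i j (permVar j k f)) =
      permVar i j (permVar j k (permVar i j f)) := by
    rw [ts, permVar_permVar, st, permVar_permVar]
  rw [hb] at e4
  exact braid_aux (zvar_sub_ne_zero hij) (zvar_sub_ne_zero hjk) (zvar_sub_ne_zero hik)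
    e1 e2 e3 e4 e5 e6 e7 k1 k2 k3 k4 k5 k6 k7

/-! ### Relations between the invertible operators -/

/-- The shift `f(…, z_i, …) ↦ f(…, p z_i, …)` as an algebra homomorphism. -/
def shiftAlg (p : ℂˣ) {N : ℕ} (i : Fin N) : Laurent N →ₐ[ℂ] Laurent N :=
  AddMonoidAlgebra.lift ℂ (Laurent N) (Fin N → ℤ)
    { toFun := fun m => ((p ^ m.toAdd i : ℂˣ) : ℂ) • mono m.toAdd
      map_one' := by simp [mono, AddMonoidAlgebra.one_def]
      map_mul' := fun a b => by
        simp only [toAdd_mul, Pi.add_apply, zpow_add, Units.val_mul, smul_mul_smul_comm, mono_mul] }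

theorem shiftAlg_mono (p : ℂˣ) {N : ℕ} (i : Fin N) (m : Fin N → ℤ) :
    shiftAlg p i (mono m) = ((p ^ m i : ℂˣ) : ℂ) • mono m := by
  simp [shiftAlg, mono]

theorem shiftAlg_toLinearMap (p : ℂˣ) {N : ℕ} (i : Fin N) :
    (shiftAlg p i).toLinearMap = shiftOp p i :=
  end_ext fun m => by simp [shiftAlg_mono, shiftOp_mono]

theorem shiftAlg_zvar_self (p : ℂˣ) {N : ℕ} (i : Fin N) :
    shiftAlg p i (zvar i) = con N p * zvar i := by
  rw [zvar, shiftAlg_mono, Algebra.smul_def, Pi.single_eq_same, zpow_one]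

theorem shiftAlg_zvar_of_ne (p : ℂˣ) {N : ℕ} {i j : Fin N} (h : i ≠ j) :
    shiftAlg p i (zvar j) = zvar j := by
  simp [zvar, shiftAlg_mono, h]

theorem permVar_shiftOp (p : ℂˣ) {N : ℕ} (a b i : Fin N) (f : Laurent N) :
    permVar a b (shiftOp p i f) = shiftOp p (Equiv.swap a b i) (permVar a b f) := by
  have : (permVar a b).toLinearMap ∘ₗ shiftOp p i =
      shiftOp p (Equiv.swap a b i) ∘ₗ (permVar a b).toLinearMap := by
    apply end_ext
    intro m
    simp [permVar_mono, shiftOp_mono]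
  simpa using LinearMap.congr_fun this f

theorem shiftOp_comm (p : ℂˣ) {N : ℕ} (i j : Fin N) (f : Laurent N) :
    shiftOp p i (shiftOp p j f) = shiftOp p j (shiftOp p i f) := by
  have : shiftOp p i ∘ₗ shiftOp p j = shiftOp p j ∘ₗ shiftOp p i := by
    apply end_ext
    intro m
    simp [shiftOp_mono, smul_smul, mul_comm]
  simpa using LinearMap.congr_fun this f

theorem shiftOp_gOp (q p : ℂˣ) {N : ℕ} {a i j : Fin N} (hi : a ≠ i) (hj : a ≠ j)
    (f : Laurent N) : shiftOp p a (gOp q i j f) = gOp q i j (shiftOp p a f) := by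
  by_cases hij : i = j
  · subst hij; simp [gOp_self]
  have h := map_gOp q (shiftAlg p a) hij hij 1 (by simp [shiftAlg_zvar_of_ne p hi])
    (by simp [shiftAlg_zvar_of_ne p hj]) (fun f => by
      have := permVar_shiftOp p i j a f
      rw [Equiv.swap_apply_of_ne_of_ne hi hj, ← shiftAlg_toLinearMap] at this
      exact this.symm) f
  rw [← shiftAlg_toLinearMap]
  exact h

theorem shiftAlg_apply (p : ℂˣ) {N : ℕ} (i : Fin N) (f : Laurent N) :
    shiftAlg p i f = shiftOp p i f := by
  rw [← shiftAlg_toLinearMap, AlgHom.toLinearMap_apply]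

theorem permVar_shiftOp_shiftOp (p : ℂˣ) {N : ℕ} (i j : Fin N) (f : Laurent N) :
    permVar i j (shiftOp p j (shiftOp p i f)) = shiftOp p j (shiftOp p i (permVar i j f)) := by
  rw [permVar_shiftOp, permVar_shiftOp, Equiv.swap_apply_left, Equiv.swap_apply_right,
    shiftOp_comm]

theorem shiftOp_shiftOp_gOp (q p : ℂˣ) {N : ℕ} {i j : Fin N} (hij : i ≠ j) (f : Laurent N) :
    shiftOp p j (shiftOp p i (gOp q i j f)) = gOp q i j (shiftOp p j (shiftOp p i f)) := by
  -- Shifting both variables scales `z_i` and `z_j` by the same factor `p`, to which `g` is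
  -- insensitive.
  have h := map_gOp q ((shiftAlg p j).comp (shiftAlg p i)) hij hij p
    (by rw [AlgHom.comp_apply, shiftAlg_zvar_self, map_mul, shiftAlg_zvar_of_ne p hij.symm,
          AlgHom.commutes])
    (by rw [AlgHom.comp_apply, shiftAlg_zvar_of_ne p hij, shiftAlg_zvar_self]) (fun f => by
      simp only [AlgHom.comp_apply, shiftAlg_apply, permVar_shiftOp_shiftOp]) f
  simpa only [AlgHom.comp_apply, shiftAlg_apply] using h

section Units

variable (q p : ℂˣ) {N : ℕ}

theorem gUnit_val (i j : Fin N) : (gUnit q i j : Module.End ℂ (Laurent N)) = gOp q i j := rfl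

theorem shiftUnit_val (i : Fin N) :
    (shiftUnit p i : Module.End ℂ (Laurent N)) = shiftOp p i := rfl

theorem gUnit_comm {i j k l : Fin N} (hik : i ≠ k) (hil : i ≠ l) (hjk : j ≠ k)
    (hjl : j ≠ l) : Commute (gUnit q i j) (gUnit q k l) :=
  Units.ext <| LinearMap.ext fun f => by
    simpa only [Units.val_mul, gUnit_val, Module.End.mul_apply] using gOp_comm q hik hil hjk hjl f

theorem gUnit_braid {i j k : Fin N} (hij : i ≠ j) (hjk : j ≠ k) (hik : i ≠ k) :
    gUnit q i j * gUnit q j k * gUnit q i j = gUnit q j k * gUnit q i j * gUnit q j k :=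
  Units.ext <| LinearMap.ext fun f => by
    simpa only [Units.val_mul, gUnit_val, Module.End.mul_apply] using gOp_braid q hij hjk hik f

theorem permUnit_mul_self (i j : Fin N) : permUnit i j * permUnit i j = 1 :=
  Units.ext (LinearMap.ext (permVar_permVar i j))

theorem permUnit_mul_permUnit (a b c d : Fin N) : permUnit a b * permUnit c d =
    permUnit (Equiv.swap a b c) (Equiv.swap a b d) * permUnit a b :=
  Units.ext (LinearMap.ext (permVar_comm N a b c d))

theorem permUnit_mul_gUnit (a b c d : Fin N) : permUnit a b * gUnit q c d =
    gUnit q (Equiv.swap a b c) (Equiv.swap a b d) * permUnit a b :=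
  Units.ext (LinearMap.ext (permVar_gOp q a b c d))

theorem permUnit_mul_shiftUnit (a b i : Fin N) : permUnit a b * shiftUnit p i =
    shiftUnit p (Equiv.swap a b i) * permUnit a b :=
  Units.ext (LinearMap.ext (permVar_shiftOp p a b i))

theorem permUnit_mul_xiUnit (a b c d : Fin N) : permUnit a b * xiUnit q c d =
    xiUnit q (Equiv.swap a b c) (Equiv.swap a b d) * permUnit a b := by
  rw [xiUnit, xiUnit, ← mul_assoc, permUnit_mul_permUnit, mul_assoc, permUnit_mul_gUnit, mul_assoc]

theorem permUnit_comm_gUnit {a b c d : Fin N} (hac : a ≠ c) (had : a ≠ d) (hbc : b ≠ c)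
    (hbd : b ≠ d) : Commute (permUnit a b) (gUnit q c d) := by
  have := permUnit_mul_gUnit q a b c d
  rwa [Equiv.swap_apply_of_ne_of_ne hac.symm hbc.symm,
    Equiv.swap_apply_of_ne_of_ne had.symm hbd.symm] at this

theorem permUnit_comm_permUnit {a b c d : Fin N} (hac : a ≠ c) (had : a ≠ d) (hbc : b ≠ c)
    (hbd : b ≠ d) : Commute (permUnit a b) (permUnit c d) := by
  have := permUnit_mul_permUnit a b c d
  rwa [Equiv.swap_apply_of_ne_of_ne hac.symm hbc.symm,
    Equiv.swap_apply_of_ne_of_ne had.symm hbd.symm] at this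

theorem gUnit_comm_xiUnit {a b c d : Fin N} (hac : a ≠ c) (had : a ≠ d) (hbc : b ≠ c)
    (hbd : b ≠ d) : Commute (gUnit q a b) (xiUnit q c d) :=
  (permUnit_comm_gUnit q hac.symm hbc.symm had.symm hbd.symm).symm.mul_right
    (gUnit_comm q hac had hbc hbd)

theorem xiUnit_comm {a b c d : Fin N} (hac : a ≠ c) (had : a ≠ d) (hbc : b ≠ c)
    (hbd : b ≠ d) : Commute (xiUnit q a b) (xiUnit q c d) :=
  Commute.mul_left ((permUnit_comm_permUnit hac had hbc hbd).mul_right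
    (permUnit_comm_gUnit q hac had hbc hbd)) (gUnit_comm_xiUnit q hac had hbc hbd)

theorem shiftUnit_comm_gUnit {a i j : Fin N} (hi : a ≠ i) (hj : a ≠ j) :
    Commute (shiftUnit p a) (gUnit q i j) :=
  Units.ext <| LinearMap.ext fun f => by
    simpa only [Units.val_mul, gUnit_val, shiftUnit_val, Module.End.mul_apply] using
      shiftOp_gOp q p hi hj f

theorem shiftUnit_comm_xiUnit {a i j : Fin N} (hi : a ≠ i) (hj : a ≠ j) :
    Commute (shiftUnit p a) (xiUnit q i j) := by
  refine Commute.mul_right ?_ (shiftUnit_comm_gUnit q p hi hj)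
  have := permUnit_mul_shiftUnit p i j a
  rw [Equiv.swap_apply_of_ne_of_ne hi hj] at this
  exact this.symm

theorem shiftUnit_mul_comm_gUnit {i j : Fin N} (hij : i ≠ j) :
    Commute (shiftUnit p j * shiftUnit p i) (gUnit q i j) :=
  Units.ext <| LinearMap.ext fun f => by
    simpa only [Units.val_mul, gUnit_val, shiftUnit_val, Module.End.mul_apply] using
      shiftOp_shiftOp_gOp q p hij f

/-- A form of the Yang–Baxter equation: once the permutations are moved to the left, the claim is
the braid relation for `g`. -/
theorem gUnit_comm_xi_left {i j l : Fin N} (hij : i ≠ j) (hil : l ≠ i) (hjl : l ≠ j) :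
    Commute (xiUnit q l j * xiUnit q l i) (gUnit q i j) := by
  have h1 := permUnit_mul_gUnit q l i l j
  rw [Equiv.swap_apply_left, Equiv.swap_apply_of_ne_of_ne hjl.symm hij.symm] at h1
  have h2 := permUnit_mul_gUnit q l j i l
  rw [Equiv.swap_apply_left, Equiv.swap_apply_of_ne_of_ne hil.symm hij] at h2
  have h3 := permUnit_mul_gUnit q l i l i
  rw [Equiv.swap_apply_left, Equiv.swap_apply_right] at h3
  have h1' : gUnit q l j * permUnit l i = permUnit l i * gUnit q i j := by
    have h := permUnit_mul_gUnit q l i i j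
    rw [Equiv.swap_apply_right, Equiv.swap_apply_of_ne_of_ne hjl.symm hij.symm] at h
    exact h.symm
  have hb := gUnit_braid q hil hij hjl
  calc xiUnit q l j * xiUnit q l i * gUnit q i j
      = permUnit l j * (gUnit q l j * permUnit l i) * gUnit q l i * gUnit q i j := by
        simp only [xiUnit, mul_assoc]
    _ = permUnit l j * permUnit l i * (gUnit q i j * gUnit q l i * gUnit q i j) := by
        rw [h1']; simp only [mul_assoc]
    _ = permUnit l j * (permUnit l i * gUnit q l i) * gUnit q i j * gUnit q l i := by
        rw [← hb]; simp only [mul_assoc]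
    _ = (permUnit l j * gUnit q i l) * permUnit l i * gUnit q i j * gUnit q l i := by
        rw [h3]; simp only [mul_assoc]
    _ = gUnit q i j * permUnit l j * (permUnit l i * gUnit q i j) * gUnit q l i := by
        rw [h2]; simp only [mul_assoc]
    _ = gUnit q i j * (xiUnit q l j * xiUnit q l i) := by
        rw [← h1']; simp only [xiUnit, mul_assoc]

theorem gUnit_comm_xi_right {i j l : Fin N} (hij : i ≠ j) (hil : l ≠ i) (hjl : l ≠ j) :
    Commute (xiUnit q i l * xiUnit q j l) (gUnit q i j) := by
  have h1 := permUnit_mul_gUnit q j l i j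
  rw [Equiv.swap_apply_left, Equiv.swap_apply_of_ne_of_ne hij hil.symm] at h1
  have h2 := permUnit_mul_gUnit q i l l j
  rw [Equiv.swap_apply_right, Equiv.swap_apply_of_ne_of_ne hij.symm hjl.symm] at h2
  have h3 := permUnit_mul_gUnit q j l j l
  rw [Equiv.swap_apply_left, Equiv.swap_apply_right] at h3
  have hb := gUnit_braid q hij hjl.symm hil.symm
  calc xiUnit q i l * xiUnit q j l * gUnit q i j
      = permUnit i l * (gUnit q i l * permUnit j l) * gUnit q j l * gUnit q i j := by
        simp only [xiUnit, mul_assoc]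
    _ = permUnit i l * permUnit j l * (gUnit q i j * gUnit q j l * gUnit q i j) := by
        rw [← h1]; simp only [mul_assoc]
    _ = permUnit i l * (permUnit j l * gUnit q j l) * gUnit q i j * gUnit q j l := by
        rw [hb]; simp only [mul_assoc]
    _ = (permUnit i l * gUnit q l j) * permUnit j l * gUnit q i j * gUnit q j l := by
        rw [h3]; simp only [mul_assoc]
    _ = gUnit q i j * permUnit i l * (permUnit j l * gUnit q i j) * gUnit q j l := by
        rw [h2]; simp only [mul_assoc]
    _ = gUnit q i j * (xiUnit q i l * xiUnit q j l) := by
        rw [h1]; simp only [xiUnit, mul_assoc]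

end Units

/-! ### Products over lists of sites -/

theorem semiconj_list_prod {G ι : Type*} [Monoid G] (k : G) (a b : ι → G) (l : List ι)
    (h : ∀ x ∈ l, SemiconjBy k (a x) (b x)) :
    SemiconjBy k (l.map a).prod (l.map b).prod := by
  induction l with
  | nil => simp
  | cons x l ih =>
    simp only [List.map_cons, List.prod_cons]
    exact (h x (by simp)).mul_right (ih fun y hy => h y (by simp [hy]))

/-- Used to pair the factors `ξ` that join one site `k` to both neighbours `i`, `j`: only such a
pair, not its single members, commutes with `g_{i,j}`. -/
theorem list_prod_interleave {G ι : Type*} [Monoid G] (a b : ι → G) (l : List ι) (hl : l.Nodup)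
    (h : ∀ x ∈ l, ∀ y ∈ l, x ≠ y → Commute (a x) (b y)) :
    (l.map a).prod * (l.map b).prod = (l.map fun x => a x * b x).prod := by
  induction l with
  | nil => simp
  | cons x l ih =>
    rw [List.nodup_cons] at hl
    have hc : Commute (l.map a).prod (b x) := by
      apply Commute.list_prod_left
      intro y hy
      obtain ⟨z, hz, rfl⟩ := List.mem_map.mp hy
      exact h z (by simp [hz]) x (by simp) (fun e => hl.1 (e ▸ hz))
    simp only [List.map_cons, List.prod_cons]
    rw [← ih hl.2 fun y hy z hz => h y (by simp [hy]) z (by simp [hz])]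
    calc a x * (l.map a).prod * (b x * (l.map b).prod)
        = a x * ((l.map a).prod * b x) * (l.map b).prod := by simp only [mul_assoc]
      _ = _ := by rw [hc.eq]; simp only [mul_assoc]

/-- The sites to the right of `i`, in increasing order. -/
abbrev above {N : ℕ} (i : Fin N) : List (Fin N) := (List.finRange N).filter (fun j => i < j)

/-- The sites to the left of `i`, in increasing order. -/
abbrev below {N : ℕ} (i : Fin N) : List (Fin N) := (List.finRange N).filter (fun j => j < i)

theorem list_eq_of_pairwise_lt {N : ℕ} {l l' : List (Fin N)} (h : l.Pairwise (· < ·))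
    (h' : l'.Pairwise (· < ·)) (hm : ∀ x, x ∈ l ↔ x ∈ l') : l = l' := by
  refine List.Perm.eq_of_pairwise (le := (· < ·)) (fun a b _ _ h1 h2 => absurd h1 h2.not_gt) h h' ?_
  exact (List.perm_ext_iff_of_nodup (h.imp ne_of_lt) (h'.imp ne_of_lt)).mpr hm

theorem pairwise_filter_finRange {N : ℕ} (P : Fin N → Prop) [DecidablePred P] :
    ((List.finRange N).filter (fun j => P j)).Pairwise (· < ·) :=
  (List.pairwise_lt_finRange N).filter _

theorem above_eq_cons {N : ℕ} {i j : Fin N} (h : (i : ℕ) + 1 = j) : above i = j :: above j := by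
  apply list_eq_of_pairwise_lt (pairwise_filter_finRange _)
  · rw [List.pairwise_cons]
    exact ⟨fun x hx => by simpa using hx, pairwise_filter_finRange _⟩
  · intro x
    simp only [List.mem_filter, List.mem_finRange, true_and, decide_eq_true_eq, List.mem_cons,
      Fin.lt_def, Fin.ext_iff]
    omega

theorem below_eq_append {N : ℕ} {i j : Fin N} (h : (i : ℕ) + 1 = j) :
    below j = below i ++ [i] := by
  apply list_eq_of_pairwise_lt (pairwise_filter_finRange _)
  · rw [List.pairwise_append]
    exact ⟨pairwise_filter_finRange _, by simp, fun x hx y hy => by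
      simp only [List.mem_filter, List.mem_finRange, true_and, decide_eq_true_eq,
        List.mem_singleton] at hx hy
      exact hy ▸ hx⟩
  · intro x
    simp only [List.mem_filter, List.mem_finRange, true_and, decide_eq_true_eq, List.mem_append,
      List.mem_singleton, Fin.lt_def, Fin.ext_iff]
    omega

/-! ### Affine Hecke relations -/

section Affine

variable (q p : ℂˣ) {N : ℕ}

/-- `Y_i` without the factors `ξ_{i,j}^{±1}`, for the right neighbour `j` of `i`. -/
def YCore (i j a : Fin N) : (Module.End ℂ (Laurent N))ˣ :=
  ((above j).map fun k => (xiUnit q a k)⁻¹).prod * shiftUnit p a *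
    ((below i).map fun k => xiUnit q k a).prod

theorem YUnit_eq (i : Fin N) : YUnit q p i =
    ((above i).map fun j => (xiUnit q i j)⁻¹).prod * shiftUnit p i *
      ((below i).map fun j => xiUnit q j i).prod := rfl

variable {i j : Fin N} (h : (i : ℕ) + 1 = j)

include h

theorem YUnit_left : YUnit q p i = (xiUnit q i j)⁻¹ * YCore q p i j i := by
  rw [YUnit_eq, above_eq_cons h, List.map_cons, List.prod_cons, YCore]
  simp only [mul_assoc]

theorem YUnit_right : YUnit q p j = YCore q p i j j * xiUnit q i j := by
  rw [YUnit_eq, below_eq_append h, List.map_append, List.prod_append, YCore]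
  simp [mul_assoc]

theorem ne_of_succ : i ≠ j := by rintro rfl; omega

theorem ne_of_mem_above {k : Fin N} (hk : k ∈ above j) : i ≠ k ∧ j ≠ k := by
  simp only [List.mem_filter, List.mem_finRange, true_and, decide_eq_true_eq, Fin.lt_def] at hk
  constructor <;> rintro rfl <;> omega

theorem ne_of_mem_below {k : Fin N} (hk : k ∈ below i) : i ≠ k ∧ j ≠ k := by
  simp only [List.mem_filter, List.mem_finRange, true_and, decide_eq_true_eq, Fin.lt_def] at hk
  constructor <;> rintro rfl <;> omega

/-- All other indices occurring in the product differ from `i` and `j`, so conjugation by `K_{i,j}`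
just renames `i` to `j` in each factor. -/
theorem permUnit_mul_YCore : permUnit i j * YCore q p i j i = YCore q p i j j * permUnit i j := by
  have h1 : SemiconjBy (permUnit i j) ((above j).map fun k => (xiUnit q i k)⁻¹).prod
      ((above j).map fun k => (xiUnit q j k)⁻¹).prod := by
    apply semiconj_list_prod
    intro k hk
    obtain ⟨h1, h2⟩ := ne_of_mem_above h hk
    apply SemiconjBy.inv_right
    have := permUnit_mul_xiUnit q i j i k
    rwa [Equiv.swap_apply_left, Equiv.swap_apply_of_ne_of_ne h1.symm h2.symm] at this
  have h2 : SemiconjBy (permUnit i j) (shiftUnit p i) (shiftUnit p j) := by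
    have := permUnit_mul_shiftUnit p i j i
    rwa [Equiv.swap_apply_left] at this
  have h3 : SemiconjBy (permUnit i j) ((below i).map fun k => xiUnit q k i).prod
      ((below i).map fun k => xiUnit q k j).prod := by
    apply semiconj_list_prod
    intro k hk
    obtain ⟨h1, h2⟩ := ne_of_mem_below h hk
    have := permUnit_mul_xiUnit q i j k i
    rwa [Equiv.swap_apply_left, Equiv.swap_apply_of_ne_of_ne h1.symm h2.symm] at this
  exact (h1.mul_right h2).mul_right h3

/-- `g_{i,i+1} Y_i g_{i,i+1} = Y_{i+1}`. -/
theorem gUnit_YUnit_gUnit : gUnit q i j * YUnit q p i * gUnit q i j = YUnit q p j := by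
  have hK : (permUnit i j)⁻¹ = permUnit i j := inv_eq_of_mul_eq_one_right (permUnit_mul_self i j)
  rw [YUnit_left q p h, YUnit_right q p h, xiUnit, mul_inv_rev, hK]
  calc gUnit q i j * ((gUnit q i j)⁻¹ * permUnit i j * YCore q p i j i) * gUnit q i j
      = permUnit i j * YCore q p i j i * gUnit q i j := by group
    _ = _ := by rw [permUnit_mul_YCore q p h, mul_assoc]

/-- Rearranged, the product is a block of paired inverse `ξ`'s, the double shift, and a block of
paired `ξ`'s. The outer blocks commute with `g` by Yang–Baxter and the shift by homogeneity. -/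
theorem gUnit_comm_YCore :
    Commute (YCore q p i j j * YCore q p i j i) (gUnit q i j) := by
  have hij := ne_of_succ h
  have hA : ∀ k ∈ above j, i ≠ k ∧ j ≠ k := fun k => ne_of_mem_above h
  have hB : ∀ k ∈ below i, i ≠ k ∧ j ≠ k := fun k => ne_of_mem_below h
  have hAB : ∀ k ∈ above j, ∀ l ∈ below i, k ≠ l := by
    intro k hk l hl
    simp only [List.mem_filter, List.mem_finRange, true_and, decide_eq_true_eq,
      Fin.lt_def] at hk hl
    rintro rfl; omega
  set Aj := ((above j).map fun k => (xiUnit q j k)⁻¹).prod with hAj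
  set Ai := ((above j).map fun k => (xiUnit q i k)⁻¹).prod with hAi
  set Bj := ((below i).map fun k => xiUnit q k j).prod with hBj
  set Bi := ((below i).map fun k => xiUnit q k i).prod with hBi
  have c1 : Commute Bj Ai := by
    rw [hBj, hAi]
    apply Commute.list_prod_left
    intro x hx
    obtain ⟨l, hl, rfl⟩ := List.mem_map.mp hx
    apply Commute.list_prod_right
    intro y hy
    obtain ⟨k, hk, rfl⟩ := List.mem_map.mp hy
    exact (xiUnit_comm q (hB l hl).1.symm (hAB k hk l hl).symm hij.symm (hA k hk).2).inv_right
  have c2 : Commute (shiftUnit p j) Ai := by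
    rw [hAi]
    apply Commute.list_prod_right
    intro y hy
    obtain ⟨k, hk, rfl⟩ := List.mem_map.mp hy
    exact (shiftUnit_comm_xiUnit q p hij.symm (hA k hk).2).inv_right
  have c3 : Commute (shiftUnit p i) Bj := by
    rw [hBj]
    apply Commute.list_prod_right
    intro y hy
    obtain ⟨k, hk, rfl⟩ := List.mem_map.mp hy
    exact shiftUnit_comm_xiUnit q p (hB k hk).1 hij
  have e : YCore q p i j j * YCore q p i j i =
      (Aj * Ai) * (shiftUnit p j * shiftUnit p i) * (Bj * Bi) := by
    calc Aj * shiftUnit p j * Bj * (Ai * shiftUnit p i * Bi)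
        = Aj * shiftUnit p j * (Bj * Ai) * shiftUnit p i * Bi := by simp only [mul_assoc]
      _ = Aj * (shiftUnit p j * Ai) * (Bj * shiftUnit p i) * Bi := by
        rw [c1.eq]; simp only [mul_assoc]
      _ = _ := by rw [c2.eq, ← c3.eq]; simp only [mul_assoc]
  rw [e, hAj, hAi, hBj, hBi, list_prod_interleave, list_prod_interleave]
  · refine (Commute.mul_left ?_ (shiftUnit_mul_comm_gUnit q p hij)).mul_left ?_
    · apply Commute.list_prod_left
      intro y hy
      obtain ⟨k, hk, rfl⟩ := List.mem_map.mp hy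
      have := (gUnit_comm_xi_right q hij (hA k hk).1.symm (hA k hk).2.symm).inv_left
      rwa [mul_inv_rev] at this
    · apply Commute.list_prod_left
      intro y hy
      obtain ⟨k, hk, rfl⟩ := List.mem_map.mp hy
      exact gUnit_comm_xi_left q hij (hB k hk).1.symm (hB k hk).2.symm
  · exact (pairwise_filter_finRange _).imp ne_of_lt
  · intro x hx y hy hxy
    exact xiUnit_comm q hxy (hB x hx).1.symm (hB y hy).2 hij.symm
  · exact (pairwise_filter_finRange _).imp ne_of_lt
  · intro x hx y hy hxy
    exact (xiUnit_comm q hij.symm (hA y hy).2 (hA x hx).1.symm hxy).inv_left.inv_right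

/-- With `C_i`, `C_j` the two cores and `ξ = K g`, one has `Y_i = ξ⁻¹ C_i` and `Y_j = C_j ξ`. The
claim becomes `ξ C_j C_i = C_i C_j ξ`, which holds because `g` commutes with `C_j C_i` and `K`
interchanges the cores. -/
theorem YUnit_comm : Commute (YUnit q p i) (YUnit q p j) := by
  have hc := gUnit_comm_YCore q p h
  have hK := permUnit_mul_YCore q p h
  have hK' : YCore q p i j i * permUnit i j = permUnit i j * YCore q p i j j := by
    have h1 := permUnit_mul_self i j
    calc YCore q p i j i * permUnit i j
        = (permUnit i j * permUnit i j) * YCore q p i j i * permUnit i j := by rw [h1, one_mul]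
      _ = permUnit i j * (permUnit i j * YCore q p i j i) * permUnit i j := by
        simp only [mul_assoc]
      _ = permUnit i j * YCore q p i j j * (permUnit i j * permUnit i j) := by
        rw [hK]; simp only [mul_assoc]
      _ = _ := by rw [h1, mul_one]
  have key : xiUnit q i j * (YCore q p i j j * YCore q p i j i) =
      YCore q p i j i * YCore q p i j j * xiUnit q i j := by
    calc xiUnit q i j * (YCore q p i j j * YCore q p i j i)
        = permUnit i j * YCore q p i j j * (YCore q p i j i) * gUnit q i j := by
          rw [xiUnit, mul_assoc, ← hc.eq]; simp only [mul_assoc]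
      _ = YCore q p i j i * (permUnit i j * YCore q p i j i) * gUnit q i j := by
        rw [← hK']; simp only [mul_assoc]
      _ = _ := by rw [hK, xiUnit]; simp only [mul_assoc]
  rw [YUnit_left q p h, YUnit_right q p h]
  show _ = _
  calc (xiUnit q i j)⁻¹ * YCore q p i j i * (YCore q p i j j * xiUnit q i j)
      = (xiUnit q i j)⁻¹ * (YCore q p i j i * YCore q p i j j * xiUnit q i j) := by
        simp only [mul_assoc]
    _ = _ := by rw [← key]; group

/-- The factors of `Y_l` that involve `i` and `j` stand next to each other, since `i`, `j` are
neighbours, and commute with `g_{i,j}` as a pair by Yang–Baxter; all other factors involve disjoint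
sites. -/
theorem gUnit_comm_YUnit {l : Fin N} (hi : l ≠ i) (hj : l ≠ j) :
    Commute (YUnit q p l) (gUnit q i j) := by
  have hij := ne_of_succ h
  have hlt : l < i ∨ j < l := by
    simp only [Fin.lt_def]
    have := Fin.val_ne_of_ne hi
    have := Fin.val_ne_of_ne hj
    omega
  have pairA : ∀ L : List (Fin N), (∀ k ∈ L, k ≠ i ∧ k ≠ j ∧ k ≠ l) →
      Commute (L.map fun k => (xiUnit q l k)⁻¹).prod (gUnit q i j) := by
    intro L hL
    apply Commute.list_prod_left
    intro y hy
    obtain ⟨k, hk, rfl⟩ := List.mem_map.mp hy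
    obtain ⟨h1, h2, h3⟩ := hL k hk
    exact (gUnit_comm_xiUnit q hi.symm h1.symm hj.symm h2.symm).symm.inv_left
  have pairB : ∀ L : List (Fin N), (∀ k ∈ L, k ≠ i ∧ k ≠ j ∧ k ≠ l) →
      Commute (L.map fun k => xiUnit q k l).prod (gUnit q i j) := by
    intro L hL
    apply Commute.list_prod_left
    intro y hy
    obtain ⟨k, hk, rfl⟩ := List.mem_map.mp hy
    obtain ⟨h1, h2, h3⟩ := hL k hk
    exact (gUnit_comm_xiUnit q h1.symm hi.symm h2.symm hj.symm).symm
  have hs := shiftUnit_comm_gUnit q p hi hj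
  rw [YUnit_eq]
  rcases hlt with hl | hl
  · refine (Commute.mul_left ?_ hs).mul_left (pairB _ ?_)
    · have : above l = (List.finRange N).filter (fun k => l < k ∧ k < i) ++ (i :: j :: above j) := by
        apply list_eq_of_pairwise_lt (pairwise_filter_finRange _)
        · rw [List.pairwise_append]
          refine ⟨pairwise_filter_finRange _, ?_, ?_⟩
          · rw [List.pairwise_cons, List.pairwise_cons]
            refine ⟨?_, ?_, pairwise_filter_finRange _⟩
            all_goals
              intro x
              simp only [List.mem_filter, List.mem_finRange, true_and, decide_eq_true_eq,
                List.mem_cons, Fin.lt_def, Fin.ext_iff]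
              omega
          · intro x hx y
            simp only [List.mem_filter, List.mem_finRange, true_and, decide_eq_true_eq,
              List.mem_cons, Fin.lt_def, Fin.ext_iff] at hx ⊢
            omega
        · intro x
          simp only [List.mem_filter, List.mem_finRange, true_and, decide_eq_true_eq,
            List.mem_cons, List.mem_append, Fin.lt_def, Fin.ext_iff] at hl ⊢
          omega
      rw [this, List.map_append, List.prod_append]
      refine Commute.mul_left (pairA _ ?_) ?_
      · intro k
        simp only [List.mem_filter, List.mem_finRange, true_and, decide_eq_true_eq, Fin.lt_def,
          Fin.ext_iff, ne_eq]
        omega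
      · rw [List.map_cons, List.map_cons, List.prod_cons, List.prod_cons, ← mul_assoc]
        refine Commute.mul_left ?_ (pairA _ ?_)
        · have := (gUnit_comm_xi_left q hij hi hj).inv_left
          rwa [mul_inv_rev] at this
        · intro k
          simp only [List.mem_filter, List.mem_finRange, true_and, decide_eq_true_eq, Fin.lt_def,
            Fin.ext_iff, ne_eq] at hl ⊢
          omega
    · intro k
      simp only [List.mem_filter, List.mem_finRange, true_and, decide_eq_true_eq, Fin.lt_def,
        Fin.ext_iff, ne_eq] at hl ⊢
      omega
  · refine (Commute.mul_left (pairA _ ?_) hs).mul_left ?_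
    · intro k
      simp only [List.mem_filter, List.mem_finRange, true_and, decide_eq_true_eq, Fin.lt_def,
        Fin.ext_iff, ne_eq] at hl ⊢
      omega
    · have : below l = below i ++ (i :: j :: (List.finRange N).filter (fun k => j < k ∧ k < l)) := by
        apply list_eq_of_pairwise_lt (pairwise_filter_finRange _)
        · rw [List.pairwise_append]
          refine ⟨pairwise_filter_finRange _, ?_, ?_⟩
          · rw [List.pairwise_cons, List.pairwise_cons]
            refine ⟨?_, ?_, pairwise_filter_finRange _⟩
            all_goals
              intro x
              simp only [List.mem_filter, List.mem_finRange, true_and, decide_eq_true_eq,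
                List.mem_cons, Fin.lt_def, Fin.ext_iff]
              omega
          · intro x hx y
            simp only [List.mem_filter, List.mem_finRange, true_and, decide_eq_true_eq,
              List.mem_cons, Fin.lt_def, Fin.ext_iff] at hx ⊢
            omega
        · intro x
          simp only [List.mem_filter, List.mem_finRange, true_and, decide_eq_true_eq,
            List.mem_cons, List.mem_append, Fin.lt_def, Fin.ext_iff] at hl ⊢
          omega
      rw [this, List.map_append, List.prod_append]
      refine Commute.mul_left (pairB _ ?_) ?_
      · intro k
        simp only [List.mem_filter, List.mem_finRange, true_and, decide_eq_true_eq, Fin.lt_def,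
          Fin.ext_iff, ne_eq] at hl ⊢
        omega
      · rw [List.map_cons, List.map_cons, List.prod_cons, List.prod_cons, ← mul_assoc]
        refine Commute.mul_left (gUnit_comm_xi_right q hij hi hj) (pairB _ ?_)
        intro k
        simp only [List.mem_filter, List.mem_finRange, true_and, decide_eq_true_eq, Fin.lt_def,
          Fin.ext_iff, ne_eq] at hl ⊢
        omega

end Affine

/-! ### Relations on the tensor power of `ℂⁿ` -/

theorem update_comp_swap {N : ℕ} {α : Type*} {i j : Fin N} (hij : i ≠ j) (e : Fin N → α) (x y : α) :
    Function.update (Function.update e i x) j y ∘ Equiv.swap i j =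
      Function.update (Function.update e i y) j x := by
  funext k
  by_cases hk : k = j
  · subst hk; simp [hij]
  · by_cases hk' : k = i
    · subst hk'; simp [hk]
    · simp [hk, hk', Equiv.swap_apply_of_ne_of_ne hk' hk]

theorem SOp_vec_update (q : ℂˣ) {n N : ℕ} {i j : Fin N} (hij : i ≠ j) (e : Fin N → Fin n)
    (x y : Fin n) :
    SOp q n i j (vec (Function.update (Function.update e i x) j y)) =
      if x = y then (-(q : ℂ)⁻¹) • vec (Function.update (Function.update e i x) j y)
      else (if x < y then ((q : ℂ) - (q : ℂ)⁻¹) •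
          vec (Function.update (Function.update e i x) j y) else 0) -
        vec (Function.update (Function.update e i y) j x) := by
  rw [SOp_vec q hij, update_comp_swap hij]
  simp [hij]

/-- Only the action on a family indexed by three slots matters, which leaves a finite check over the
relative orders of `x`, `y`, `z`. -/
theorem braid_of_three_site (q : ℂˣ) {n : ℕ} {M : Type*} [AddCommGroup M] [Module ℂ M]
    (A B : Module.End ℂ M) (W : Fin n → Fin n → Fin n → M)
    (hA : ∀ x y z, A (W x y z) = if x = y then (-(q : ℂ)⁻¹) • W x y z
      else (if x < y then ((q : ℂ) - (q : ℂ)⁻¹) • W x y z else 0) - W y x z)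
    (hB : ∀ x y z, B (W x y z) = if y = z then (-(q : ℂ)⁻¹) • W x y z
      else (if y < z then ((q : ℂ) - (q : ℂ)⁻¹) • W x y z else 0) - W x z y) (x y z : Fin n) :
    A (B (A (W x y z))) = B (A (B (W x y z))) := by
  have hq : (q : ℂ) ≠ 0 := q.ne_zero
  have key : ∀ x y : Fin n, x < y → ¬ (x = y) ∧ ¬ (y = x) ∧ ¬ (y < x) := fun x y h =>
    ⟨h.ne, h.ne', h.not_gt⟩
  rcases lt_trichotomy x y with h1 | h1 | h1 <;> rcases lt_trichotomy y z with h2 | h2 | h2 <;>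
    rcases lt_trichotomy x z with h3 | h3 | h3 <;> first | (exfalso; omega) | skip
  all_goals
    first
    | obtain ⟨a1, a2, a3⟩ := key _ _ h1
    | subst h1
    first
    | obtain ⟨b1, b2, b3⟩ := key _ _ h2
    | subst h2
    first
    | obtain ⟨c1, c2, c3⟩ := key _ _ h3
    | subst h3
    | skip
    simp only [map_sub, map_smul, map_neg, zero_sub, if_true, if_false, lt_irrefl, *]
    try (match_scalars <;> field_simp <;> ring)

theorem SOp_braid (q : ℂˣ) (n : ℕ) {N : ℕ} {i j k : Fin N} (hij : i ≠ j) (hjk : j ≠ k)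
    (hik : i ≠ k) : SOp q n i j * SOp q n j k * SOp q n i j =
      SOp q n j k * SOp q n i j * SOp q n j k := by
  apply spin_ext
  intro e
  have := braid_of_three_site q (SOp q n i j) (SOp q n j k)
    (fun x y z => vec (Function.update (Function.update (Function.update e i x) j y) k z))
    (fun x y z => by
      have h : ∀ x y, Function.update (Function.update (Function.update e i x) j y) k z =
          Function.update (Function.update (Function.update e k z) i x) j y := fun x y => by
        rw [Function.update_comm hjk, Function.update_comm hik]
      simp only [h]
      exact SOp_vec_update q hij _ x y)
    (fun x y z => SOp_vec_update q hjk _ y z) (e i) (e j) (e k)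
  simpa only [Module.End.mul_apply, Function.update_eq_self] using this

theorem siteOp_comm {n N : ℕ} {i j : Fin N} (hij : i ≠ j) (A B : Module.End ℂ (Fin n → ℂ)) :
    Commute (siteOp i A) (siteOp j B) := by
  change _ = _
  rw [siteOp, siteOp, ← PiTensorProduct.map_mul, ← PiTensorProduct.map_mul]
  congr 1
  funext k
  by_cases hi : k = i
  · subst hi; simp only [if_true, if_neg hij]; rfl
  · by_cases hj : k = j
    · subst hj; simp only [if_true, if_neg hi]; rfl
    · simp only [if_neg hi, if_neg hj]

theorem siteOp_comm_SOp (q : ℂˣ) {n N : ℕ} {i j l : Fin N} (hi : l ≠ i) (hj : l ≠ j)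
    (A : Module.End ℂ (Fin n → ℂ)) : Commute (siteOp l A) (SOp q n i j) := by
  have h : ∀ B C : Module.End ℂ (Fin n → ℂ), Commute (siteOp l A) (siteOp i B * siteOp j C) := fun B C =>
    (siteOp_comm hi A B).mul_right (siteOp_comm hj A C)
  rw [SOp.eq_1 q n i j]
  refine Commute.sub_right (R := Module.End ℂ (Spin n N))
    (Commute.add_right (R := Module.End ℂ (Spin n N)) ?_ ?_) ?_
  · exact Commute.smul_right (Commute.sum_right _ _ _ fun a _ => h _ _) _
  · refine Commute.smul_right ?_ _
    refine Commute.sum_right _ _ _ fun a _ => Commute.sum_right _ _ _ fun b _ => ?_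
    split_ifs
    · exact h _ _
    · exact Commute.zero_right _
  · refine Commute.sum_right _ _ _ fun a _ => Commute.sum_right _ _ _ fun b _ => ?_
    split_ifs
    · exact h _ _
    · exact Commute.zero_right _

theorem SOp_comm (q : ℂˣ) (n : ℕ) {N : ℕ} {i j k l : Fin N} (hik : i ≠ k) (hil : i ≠ l)
    (hjk : j ≠ k) (hjl : j ≠ l) : Commute (SOp q n i j) (SOp q n k l) := by
  have h : ∀ B C : Module.End ℂ (Fin n → ℂ),
      Commute (siteOp i B * siteOp j C) (SOp q n k l) := fun B C =>
    (siteOp_comm_SOp q hik hil B).mul_left (siteOp_comm_SOp q hjk hjl C)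
  rw [SOp.eq_1 q n i j]
  refine Commute.sub_left (R := Module.End ℂ (Spin n N))
    (Commute.add_left (R := Module.End ℂ (Spin n N)) ?_ ?_) ?_
  · exact Commute.smul_left (Commute.sum_left _ _ _ fun a _ => h _ _) _
  · refine Commute.smul_left ?_ _
    refine Commute.sum_left _ _ _ fun a _ => Commute.sum_left _ _ _ fun b _ => ?_
    split_ifs
    · exact h _ _
    · exact Commute.zero_left _
  · refine Commute.sum_left _ _ _ fun a _ => Commute.sum_left _ _ _ fun b _ => ?_
    split_ifs
    · exact h _ _
    · exact Commute.zero_left _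

/-- The eigenvalue of `q^{t (E^{ε,ε} - E^{ε+1,ε+1})}` on a basis vector. -/
def kap (q : ℂˣ) {n : ℕ} (c : Fin n) (t : ℤ) (a : Fin n) : ℂ :=
  ((q ^ (t * ((if a = pos c then 1 else 0) - (if a = c then 1 else 0))) : ℂˣ) : ℂ)

theorem Kmat_single (q : ℂˣ) {n : ℕ} (c : Fin n) (t : ℤ) (a : Fin n) :
    Kmat q c t (Pi.single a 1) = kap q c t a • Pi.single a 1 := by
  ext x
  rw [Kmat, Matrix.toLin'_apply, Matrix.mulVec_diagonal, Pi.smul_apply, smul_eq_mul, kap]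
  by_cases h : x = a
  · subst h; rfl
  · simp [h]

/-- The operators `q^{t (E^{ε,ε} - E^{ε+1,ε+1})}` acting in all the factors selected by `P`. -/
def diagOp (q : ℂˣ) {n : ℕ} (c : Fin n) (t : ℤ) {N : ℕ} (P : Fin N → Prop) [DecidablePred P] :
    Module.End ℂ (Spin n N) :=
  PiTensorProduct.map (fun j => if P j then Kmat q c t else LinearMap.id)

/-- The eigenvalue of `diagOp` on a basis vector. -/
def chi (q : ℂˣ) {n : ℕ} (c : Fin n) (t : ℤ) {N : ℕ} (P : Fin N → Prop) [DecidablePred P]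
    (e : Fin N → Fin n) : ℂ :=
  ∏ j, if P j then kap q c t (e j) else 1

theorem diagOp_vec (q : ℂˣ) {n : ℕ} (c : Fin n) (t : ℤ) {N : ℕ} (P : Fin N → Prop)
    [DecidablePred P] (e : Fin N → Fin n) :
    diagOp q c t P (vec e) = chi q c t P e • vec e := by
  rw [diagOp, vec, PiTensorProduct.map_tprod, chi, ← MultilinearMap.map_smul_univ]
  congr 1
  funext j
  split_ifs
  · exact Kmat_single q c t (e j)
  · simp

theorem chi_comp_swap (q : ℂˣ) {n : ℕ} (c : Fin n) (t : ℤ) {N : ℕ} (P : Fin N → Prop)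
    [DecidablePred P] {i j : Fin N} (hP : P i ↔ P j) (e : Fin N → Fin n) :
    chi q c t P (e ∘ Equiv.swap i j) = chi q c t P e := by
  rw [chi, chi, ← Equiv.prod_comp (Equiv.swap i j)]
  apply Finset.prod_congr rfl
  intro k _
  have : P (Equiv.swap i j k) ↔ P k := by
    by_cases hi : k = i
    · subst hi; simp [hP]
    · by_cases hj : k = j
      · subst hj; simp [hP]
      · rw [Equiv.swap_apply_of_ne_of_ne hi hj]
  simp [this]

theorem chi_update (q : ℂˣ) {n : ℕ} (c : Fin n) (t : ℤ) {N : ℕ} (P : Fin N → Prop)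
    [DecidablePred P] {i : Fin N} (hP : ¬ P i) (e : Fin N → Fin n) (a : Fin n) :
    chi q c t P (Function.update e i a) = chi q c t P e := by
  apply Finset.prod_congr rfl
  intro k _
  by_cases hi : k = i
  · subst hi; simp [hP]
  · simp [hi]

/-- Compares the strings of `K` factors attached to two neighbouring sites, which differ by a single
site. -/
theorem chi_insert (q : ℂˣ) {n : ℕ} (c : Fin n) (t : ℤ) {N : ℕ} (P P' : Fin N → Prop)
    [DecidablePred P] [DecidablePred P'] {i : Fin N} (hi : ¬ P i)
    (hP : ∀ k, P' k ↔ P k ∨ k = i) (e : Fin N → Fin n) :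
    chi q c t P' e = kap q c t (e i) * chi q c t P e := by
  rw [chi, chi, ← Finset.mul_prod_erase _ _ (Finset.mem_univ i),
    ← Finset.mul_prod_erase (a := i) _ (fun j => if P j then kap q c t (e j) else 1)
      (Finset.mem_univ i), if_neg hi, one_mul, if_pos ((hP i).mpr (Or.inr rfl))]
  congr 1
  apply Finset.prod_congr rfl
  intro k hk
  have : P' k ↔ P k := by simp [hP, Finset.ne_of_mem_erase hk]
  simp [this]

/-- `S` only mixes a basis vector with its swap, and the eigenvalue is the same on both when `i` and
`j` are both selected or both omitted. -/
theorem diagOp_comm_SOp (q : ℂˣ) {n : ℕ} (c : Fin n) (t : ℤ) {N : ℕ} (P : Fin N → Prop)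
    [DecidablePred P] {i j : Fin N} (hij : i ≠ j) (hP : P i ↔ P j) :
    Commute (diagOp q c t P) (SOp q n i j) := by
  apply spin_ext
  intro e
  rw [Module.End.mul_apply, Module.End.mul_apply, diagOp_vec, map_smul, SOp_vec q hij]
  have h := diagOp_vec q c t P (e ∘ Equiv.swap i j)
  rw [chi_comp_swap q c t P hP] at h
  split_ifs <;> simp only [map_sub, map_smul, map_zero, h, diagOp_vec, smul_sub, smul_smul,
    smul_zero, mul_comm]

/-! ### The cyclic predecessor of a basis index -/

section PosLemmas

variable {n : ℕ} (hn : 2 ≤ n) (c : Fin n)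

theorem pos_of_ne_zero (h : (c : ℕ) ≠ 0) : (pos c : ℕ) + 1 = c := by
  obtain ⟨m, rfl⟩ : ∃ m, n = m + 1 := ⟨n - 1, by have := c.2; omega⟩
  have : c = finRotate (m + 1) (⟨c - 1, by omega⟩) := by
    ext
    rw [finRotate_of_lt (by have := c.2; omega)]
    simp; omega
  rw [pos]
  conv_lhs => rw [this]
  rw [Equiv.symm_apply_apply]
  simp; omega

theorem pos_of_eq_zero (h : (c : ℕ) = 0) : (pos c : ℕ) + 1 = n := by
  obtain ⟨m, rfl⟩ : ∃ m, n = m + 1 := ⟨n - 1, by have := c.2; omega⟩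
  have : c = finRotate (m + 1) (Fin.last m) := by
    ext
    rw [finRotate_last]; simpa using h
  rw [pos, this, Equiv.symm_apply_apply]
  simp

include hn in
theorem pos_ne : pos c ≠ c := by
  intro h
  have h' := congrArg Fin.val h
  by_cases h0 : (c : ℕ) = 0
  · have := pos_of_eq_zero c h0; omega
  · have := pos_of_ne_zero c h0; omega

end PosLemmas

theorem kap_one (q : ℂˣ) {n : ℕ} (hn : 2 ≤ n) (c : Fin n) :
    kap q c 1 (pos c) = q ∧ kap q c 1 c = (q : ℂ)⁻¹ ∧
      ∀ a, a ≠ pos c → a ≠ c → kap q c 1 a = 1 := by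
  refine ⟨?_, ?_, fun a h1 h2 => ?_⟩
  · simp [kap, pos_ne hn c]
  · simp [kap, (pos_ne hn c).symm]
  · simp [kap, h1, h2]

theorem kap_neg_one (q : ℂˣ) {n : ℕ} (hn : 2 ≤ n) (c : Fin n) :
    kap q c (-1) (pos c) = (q : ℂ)⁻¹ ∧ kap q c (-1) c = q ∧
      ∀ a, a ≠ pos c → a ≠ c → kap q c (-1) a = 1 := by
  refine ⟨?_, ?_, fun a h1 h2 => ?_⟩
  · simp [kap, pos_ne hn c]
  · simp [kap, (pos_ne hn c).symm]
  · simp [kap, h1, h2]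

/-- The order relations of `v_ε`, `v_{ε+1}` with the other basis vectors. -/
theorem lt_pos_iff {n : ℕ} (c : Fin n) (z : Fin n) (h1 : z ≠ pos c) (h2 : z ≠ c) :
    ((c : ℕ) = 0 → z < pos c ∧ c < z) ∧
      ((c : ℕ) ≠ 0 → (z < pos c ∧ z < c) ∨ (pos c < z ∧ c < z)) := by
  have h1 := Fin.val_ne_of_ne h1
  have h2 := Fin.val_ne_of_ne h2
  have := z.2
  simp only [Fin.lt_def]
  constructor
  · intro h; have := pos_of_eq_zero c h; omega
  · intro h; have := pos_of_ne_zero c h; omega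

/-- The order of `v_ε`, `v_{ε+1}` is reversed for `ε = 0`, with the two at opposite ends of the
basis. This is why the affine generator satisfies a different relation with `S`. -/
theorem pos_lt_self {n : ℕ} (hn : 2 ≤ n) (c : Fin n) :
    ((c : ℕ) = 0 → c < pos c) ∧ ((c : ℕ) ≠ 0 → pos c < c) := by
  simp only [Fin.lt_def]
  constructor
  · intro h; have := pos_of_eq_zero c h; omega
  · intro h; have := pos_of_ne_zero c h; omega

/-! ### Exchange relations for the root vectors on two neighbouring sites -/

section TwoSite

variable (q : ℂˣ) {n : ℕ} (b t : Fin n) {M : Type*} [AddCommGroup M] [Module ℂ M]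
  (S Bi Bj : Module.End ℂ M) (F : Fin n → Fin n → M) (X : ℂ) (κ : Fin n → ℂ)
  (hS : ∀ x y, S (F x y) = if x = y then (-(q : ℂ)⁻¹) • F x y
      else (if x < y then ((q : ℂ) - (q : ℂ)⁻¹) • F x y else 0) - F y x)
  (hκ : ∀ x, x ≠ t → x ≠ b → κ x = 1) (ht : κ t = q) (hb : κ b = (q : ℂ)⁻¹)

include hS hκ ht hb

/-- `F x y` has `x`, `y` in the slots `i`, `j`, and `X` collects the other sites. The source `b` is
the least index and the target `t` the greatest, so `S` carries one summand to the other instead of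
commuting with the sum. The check runs over `x`, `y` equal to `b`, equal to `t`, or strictly
between. -/
theorem two_site_affine_raise (hbt : b < t) (hz : ∀ z, z ≠ t → z ≠ b → z < t ∧ b < z)
    (hBi : ∀ x y, Bi (F x y) = (X * κ y) • if x = b then F t y else 0)
    (hBj : ∀ x y, Bj (F x y) = X • if y = b then F x t else 0) (x y : Fin n) :
    Bj (S (F x y)) = S (Bi (F x y)) := by
  have hq : (q : ℂ) ≠ 0 := q.ne_zero
  have h1 := hbt.ne
  have h2 := hbt.ne'
  have h3 := hbt.not_gt
  have cases : ∀ z, z = b ∨ z = t ∨ (z ≠ t ∧ z ≠ b ∧ t ≠ z ∧ b ≠ z ∧ z < t ∧ b < z ∧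
      ¬ t < z ∧ ¬ z < b) := fun z => by
    by_cases u : z = b
    · exact Or.inl u
    · by_cases v : z = t
      · exact Or.inr (Or.inl v)
      · obtain ⟨h, h'⟩ := hz z v u
        exact Or.inr (Or.inr ⟨v, u, Ne.symm v, Ne.symm u, h, h', h.not_gt, h'.not_gt⟩)
  rcases cases x with rfl | rfl | ⟨u1, u2, u3, u4, u5, u6, u7, u8⟩ <;>
    rcases cases y with rfl | rfl | ⟨v1, v2, v3, v4, v5, v6, v7, v8⟩
  all_goals
    try simp [*]
  all_goals
    first
    | done
    | (match_scalars; field_simp)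
    | (split_ifs <;> simp [*])

theorem two_site_affine_lower (hbt : t < b) (hz : ∀ z, z ≠ t → z ≠ b → z < b ∧ t < z)
    (hBi : ∀ x y, Bi (F x y) = X • if x = b then F t y else 0)
    (hBj : ∀ x y, Bj (F x y) = (X * κ x) • if y = b then F x t else 0) (x y : Fin n) :
    Bi (S (F x y)) = S (Bj (F x y)) := by
  have hq : (q : ℂ) ≠ 0 := q.ne_zero
  have h1 := hbt.ne
  have h2 := hbt.ne'
  have h3 := hbt.not_gt
  have cases : ∀ z, z = b ∨ z = t ∨ (z ≠ t ∧ z ≠ b ∧ t ≠ z ∧ b ≠ z ∧ z < b ∧ t < z ∧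
      ¬ b < z ∧ ¬ z < t) := fun z => by
    by_cases u : z = b
    · exact Or.inl u
    · by_cases v : z = t
      · exact Or.inr (Or.inl v)
      · obtain ⟨h, h'⟩ := hz z v u
        exact Or.inr (Or.inr ⟨v, u, Ne.symm v, Ne.symm u, h, h', h.not_gt, h'.not_gt⟩)
  rcases cases x with rfl | rfl | ⟨u1, u2, u3, u4, u5, u6, u7, u8⟩ <;>
    rcases cases y with rfl | rfl | ⟨v1, v2, v3, v4, v5, v6, v7, v8⟩
  all_goals
    try simp [*]
  all_goals
    first
    | done
    | (match_scalars; field_simp)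
    | (split_ifs <;> simp [*])

/-- Here `t` and `b` are adjacent in the order, so every other index compares with both in the same
way. The relation is the commutation of `S` with the coproduct of a raising generator. -/
theorem two_site_finite_raise (hbt : t < b)
    (hz : ∀ z, z ≠ t → z ≠ b → (z < t ∧ z < b) ∨ (t < z ∧ b < z))
    (hBi : ∀ x y, Bi (F x y) = (X * κ y) • if x = b then F t y else 0)
    (hBj : ∀ x y, Bj (F x y) = X • if y = b then F x t else 0) (x y : Fin n) :
    (Bi + Bj) (S (F x y)) = S ((Bi + Bj) (F x y)) := by
  have hq : (q : ℂ) ≠ 0 := q.ne_zero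
  have h1 := hbt.ne
  have h2 := hbt.ne'
  have h3 := hbt.not_gt
  have cases : ∀ z, z = b ∨ z = t ∨ (z ≠ t ∧ z ≠ b ∧ t ≠ z ∧ b ≠ z ∧ z < t ∧ z < b ∧
      ¬ t < z ∧ ¬ b < z) ∨ (z ≠ t ∧ z ≠ b ∧ t ≠ z ∧ b ≠ z ∧ t < z ∧ b < z ∧
      ¬ z < t ∧ ¬ z < b) := fun z => by
    by_cases u : z = b
    · exact Or.inl u
    · by_cases v : z = t
      · exact Or.inr (Or.inl v)
      · rcases hz z v u with ⟨h, h'⟩ | ⟨h, h'⟩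
        · exact Or.inr (Or.inr (Or.inl ⟨v, u, Ne.symm v, Ne.symm u, h, h', h.not_gt, h'.not_gt⟩))
        · exact Or.inr (Or.inr (Or.inr ⟨v, u, Ne.symm v, Ne.symm u, h, h', h.not_gt, h'.not_gt⟩))
  rw [LinearMap.add_apply, LinearMap.add_apply]
  rcases cases x with rfl | rfl | ⟨u1, u2, u3, u4, u5, u6, u7, u8⟩ |
      ⟨u1, u2, u3, u4, u5, u6, u7, u8⟩ <;>
    rcases cases y with rfl | rfl | ⟨v1, v2, v3, v4, v5, v6, v7, v8⟩ |
      ⟨v1, v2, v3, v4, v5, v6, v7, v8⟩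
  all_goals
    try simp [*]
  all_goals
    first
    | done
    | (match_scalars <;> field_simp <;> ring)
    | (split_ifs <;> simp [*])

theorem two_site_finite_lower (hbt : b < t)
    (hz : ∀ z, z ≠ t → z ≠ b → (z < t ∧ z < b) ∨ (t < z ∧ b < z))
    (hBi : ∀ x y, Bi (F x y) = X • if x = b then F t y else 0)
    (hBj : ∀ x y, Bj (F x y) = (X * κ x) • if y = b then F x t else 0) (x y : Fin n) :
    (Bi + Bj) (S (F x y)) = S ((Bi + Bj) (F x y)) := by
  have hq : (q : ℂ) ≠ 0 := q.ne_zero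
  have h1 := hbt.ne
  have h2 := hbt.ne'
  have h3 := hbt.not_gt
  have cases : ∀ z, z = b ∨ z = t ∨ (z ≠ t ∧ z ≠ b ∧ t ≠ z ∧ b ≠ z ∧ z < t ∧ z < b ∧
      ¬ t < z ∧ ¬ b < z) ∨ (z ≠ t ∧ z ≠ b ∧ t ≠ z ∧ b ≠ z ∧ t < z ∧ b < z ∧
      ¬ z < t ∧ ¬ z < b) := fun z => by
    by_cases u : z = b
    · exact Or.inl u
    · by_cases v : z = t
      · exact Or.inr (Or.inl v)
      · rcases hz z v u with ⟨h, h'⟩ | ⟨h, h'⟩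
        · exact Or.inr (Or.inr (Or.inl ⟨v, u, Ne.symm v, Ne.symm u, h, h', h.not_gt, h'.not_gt⟩))
        · exact Or.inr (Or.inr (Or.inr ⟨v, u, Ne.symm v, Ne.symm u, h, h', h.not_gt, h'.not_gt⟩))
  rw [LinearMap.add_apply, LinearMap.add_apply]
  rcases cases x with rfl | rfl | ⟨u1, u2, u3, u4, u5, u6, u7, u8⟩ |
      ⟨u1, u2, u3, u4, u5, u6, u7, u8⟩ <;>
    rcases cases y with rfl | rfl | ⟨v1, v2, v3, v4, v5, v6, v7, v8⟩ |
      ⟨v1, v2, v3, v4, v5, v6, v7, v8⟩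
  all_goals
    try simp [*]
  all_goals
    first
    | done
    | (match_scalars <;> field_simp <;> ring)
    | (split_ifs <;> simp [*])

end TwoSite

/-! ### The relations of the `q`-wedge product -/

/-- `q + q⁻¹ = 0` would make `q` a primitive fourth root of unity. All that follows uses the
hypothesis on `q` through this inequality alone. -/
theorem add_inv_ne_zero (q : ℂˣ) (hq : ∀ k : ℕ, 0 < k → q ^ k = 1 → q = 1) :
    (q : ℂ) + (q : ℂ)⁻¹ ≠ 0 := by
  intro h
  have h2 : (q : ℂ) ^ 2 = -1 := by
    have := congrArg (· * (q : ℂ)) h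
    simp only [add_mul, inv_mul_cancel₀ q.ne_zero, zero_mul] at this
    linear_combination this
  have h4 : q = 1 := hq 4 (by norm_num) (by
    ext
    push_cast
    linear_combination ((q : ℂ) ^ 2 - 1) * h2)
  rw [h4] at h2
  norm_num at h2

/-- If `G` and `S` commute and satisfy the same quadratic relation, then `Ker (G + S⁻¹)` is the
range of `G - S`. -/
theorem ker_eq_range {M : Type*} [AddCommGroup M] [Module ℂ M] (q : ℂˣ)
    (hq : (q : ℂ) + (q : ℂ)⁻¹ ≠ 0) (G S : Module.End ℂ M) (hGS : Commute G S)
    (hG : G * G = ((q : ℂ) - (q : ℂ)⁻¹) • G + 1) (hS : S * S = ((q : ℂ) - (q : ℂ)⁻¹) • S + 1) :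
    LinearMap.ker (G + (S + ((q : ℂ)⁻¹ - (q : ℂ)) • 1)) = LinearMap.range (G - S) := by
  have hqq : (q : ℂ) * (q : ℂ)⁻¹ = 1 := mul_inv_cancel₀ q.ne_zero
  apply le_antisymm
  · intro x hx
    have hx' : G x + (S x + ((q : ℂ)⁻¹ - (q : ℂ)) • x) = 0 := by
      simpa [LinearMap.mem_ker] using hx
    have hSS : S (S x) = ((q : ℂ) - (q : ℂ)⁻¹) • S x + x := by
      simpa using LinearMap.congr_fun hS x
    have hGSx : G (S x) = S (G x) := by simpa using LinearMap.congr_fun hGS.eq x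
    have hGx : G x = -(S x + ((q : ℂ)⁻¹ - (q : ℂ)) • x) := eq_neg_of_add_eq_zero_left hx'
    -- On the kernel `G = -S⁻¹`, so `G - S` acts as `-(S + S⁻¹)`. Since `(S + S⁻¹)² = (q + q⁻¹)²`, a
    -- preimage of `x` is `-(q + q⁻¹)⁻² (S + S⁻¹) x`, with `S + S⁻¹ = 2 S + (q⁻¹ - q)`.
    refine ⟨-((((q : ℂ) + (q : ℂ)⁻¹) ^ 2)⁻¹ • ((2 : ℂ) • S x + ((q : ℂ)⁻¹ - (q : ℂ)) • x)), ?_⟩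
    have h1 : (G - S) ((2 : ℂ) • S x + ((q : ℂ)⁻¹ - (q : ℂ)) • x) =
        -((((q : ℂ) + (q : ℂ)⁻¹) ^ 2) • x) := by
      simp only [LinearMap.sub_apply, map_add, map_smul, hGSx, hGx, map_neg, hSS]
      match_scalars
      · ring
      · linear_combination (4 : ℂ) * hqq
    rw [map_neg, map_smul, h1, smul_neg, neg_neg, smul_smul, inv_mul_cancel₀ (pow_ne_zero 2 hq),
      one_smul]
  · rintro _ ⟨y, rfl⟩
    rw [LinearMap.mem_ker, ← Module.End.mul_apply]
    have : (G + (S + ((q : ℂ)⁻¹ - (q : ℂ)) • 1)) * (G - S) = 0 := by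
      have e : (G + (S + ((q : ℂ)⁻¹ - (q : ℂ)) • 1)) * (G - S) =
          G * G - S * S + (S * G - G * S) - ((q : ℂ) - (q : ℂ)⁻¹) • (G - S) := by
        rw [show ((q : ℂ)⁻¹ - (q : ℂ)) = -((q : ℂ) - (q : ℂ)⁻¹) by ring, neg_smul]
        simp only [mul_sub, add_mul, neg_mul, smul_mul_assoc, one_mul, smul_sub]
        abel
      rw [e, hG, hS, hGS.eq, smul_sub]
      abel
    rw [this, LinearMap.zero_apply]

theorem ker_eq_range_adjacent (n : ℕ) (q : ℂˣ) (hq : (q : ℂ) + (q : ℂ)⁻¹ ≠ 0) {N : ℕ}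
    {i j : Fin N} (hij : i ≠ j) :
    LinearMap.ker ((gOp q i j).rTensor (Spin n N) +
        ((SUnit q n hij)⁻¹.val).lTensor (Laurent N)) =
      LinearMap.range ((gOp q i j).rTensor (Spin n N) - (SOp q n i j).lTensor (Laurent N)) := by
  rw [← ker_eq_range q hq]
  · congr 2
    change (SOp q n i j + ((q : ℂ)⁻¹ - (q : ℂ)) • 1).lTensor (Laurent N) = _
    rw [LinearMap.lTensor_add, LinearMap.lTensor_smul]
    congr 2
    exact LinearMap.lTensor_id _ _
  · change _ ∘ₗ _ = _ ∘ₗ _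
    rw [LinearMap.rTensor_comp_lTensor, LinearMap.lTensor_comp_rTensor]
  · rw [← LinearMap.rTensor_mul, gOp_quadratic, LinearMap.rTensor_add, LinearMap.rTensor_smul]
    congr 1
    exact LinearMap.rTensor_id _ _
  · rw [← LinearMap.lTensor_mul, SOp_quadratic q n hij, LinearMap.lTensor_add,
      LinearMap.lTensor_smul]
    congr 1
    exact LinearMap.lTensor_id _ _

section Relations

variable {n : ℕ} {q : ℂˣ} (hq : (q : ℂ) + (q : ℂ)⁻¹ ≠ 0) {N : ℕ}

/-- The projection of `⊗^N V(z)` to the wedge product. -/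
abbrev cls (n : ℕ) (q : ℂˣ) (N : ℕ) : Tens n N →ₗ[ℂ] Wedge n q N := (Omega n q N).mkQ

include hq

/-- The working form of the wedge relations: by `ker_eq_range_adjacent`, `Ω` is generated by the
differences of the two sides, and `g` may be traded for `S`. -/
theorem cls_gOp {i j : Fin N} (h : (i : ℕ) + 1 = j) (f : Laurent N) (v : Spin n N) :
    cls n q N (gOp q i j f ⊗ₜ v) = cls n q N (f ⊗ₜ SOp q n i j v) := by
  rw [← sub_eq_zero, ← map_sub, Submodule.mkQ_apply, Submodule.Quotient.mk_eq_zero]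
  have h1 := ker_eq_range_adjacent n q hq (ne_of_succ h)
  refine Submodule.mem_iSup_of_mem i (Submodule.mem_iSup_of_mem j
    (Submodule.mem_iSup_of_mem h ?_))
  rw [h1]
  exact ⟨f ⊗ₜ v, by simp⟩

theorem Omega_le_of {K : Submodule ℂ (Tens n N)}
    (H : ∀ i j : Fin N, (i : ℕ) + 1 = j → ∀ (f : Laurent N) (v : Spin n N),
      gOp q i j f ⊗ₜ v - f ⊗ₜ SOp q n i j v ∈ K) : Omega n q N ≤ K := by
  refine iSup_le fun i => iSup_le fun j => iSup_le fun h => ?_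
  rw [ker_eq_range_adjacent n q hq (ne_of_succ h)]
  rintro _ ⟨x, rfl⟩
  induction x using TensorProduct.induction_on with
  | zero => simp
  | tmul f v => simpa using H i j h f v
  | add x y hx hy => rw [map_add]; exact K.add_mem hx hy

theorem descends_of {A : Module.End ℂ (Tens n N)}
    (H : ∀ i j : Fin N, (i : ℕ) + 1 = j → ∀ (f : Laurent N) (v : Spin n N),
      cls n q N (A (gOp q i j f ⊗ₜ v)) = cls n q N (A (f ⊗ₜ SOp q n i j v))) :
    Descends q A := by
  refine Omega_le_of hq fun i j h f v => ?_
  rw [Submodule.mem_comap, map_sub, ← Submodule.Quotient.mk_eq_zero, ← Submodule.mkQ_apply,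
    map_sub, sub_eq_zero]
  exact H i j h f v

theorem descends_lTensor {B : Module.End ℂ (Spin n N)}
    (hB : ∀ i j : Fin N, (i : ℕ) + 1 = j → Commute B (SOp q n i j)) :
    Descends q (B.lTensor (Laurent N)) := by
  refine descends_of hq fun i j h f v => ?_
  rw [LinearMap.lTensor_tmul, LinearMap.lTensor_tmul, cls_gOp hq h]
  congr 2
  exact (LinearMap.congr_fun (hB i j h).eq v).symm

theorem descends_rTensor {Y : Module.End ℂ (Laurent N)}
    (hY : ∀ i j : Fin N, (i : ℕ) + 1 = j → Commute Y (gOp q i j)) :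
    Descends q (Y.rTensor (Spin n N)) := by
  refine descends_of hq fun i j h f v => ?_
  rw [LinearMap.rTensor_tmul, LinearMap.rTensor_tmul, ← cls_gOp hq h]
  congr 2
  exact LinearMap.congr_fun (hY i j h).eq f

/-- The summands at `i` and `j` respect the relation `g = S` only together: the correction terms
produced by moving `g` past the `Y`'s cancel those produced by moving `S` past the `B`'s. The two
options for `(a, b)` serve `F_0` and `E_0`. -/
theorem descends_sum (Y : Fin N → (Module.End ℂ (Laurent N))ˣ) (B : Fin N → Module.End ℂ (Spin n N))
    (hY : ∀ i j : Fin N, (i : ℕ) + 1 = j → ∀ l, l ≠ i → l ≠ j → Commute (Y l) (gUnit q i j))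
    (hB : ∀ i j : Fin N, (i : ℕ) + 1 = j → ∀ l, l ≠ i → l ≠ j → Commute (B l) (SOp q n i j))
    (hYB : ∀ i j : Fin N, (i : ℕ) + 1 = j → ∃ a b : Fin N, ((a = i ∧ b = j) ∨ (a = j ∧ b = i)) ∧
      gUnit q i j * Y a * gUnit q i j = Y b ∧ B a * SOp q n i j = SOp q n i j * B b) :
    Descends q (∑ l, TensorProduct.map (Y l : Module.End ℂ (Laurent N)) (B l)) := by
  refine descends_of hq fun i j h f v => ?_
  obtain ⟨a, b, hab, h1, h2⟩ := hYB i j h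
  have hij := ne_of_succ h
  have hne : a ≠ b := by rcases hab with ⟨rfl, rfl⟩ | ⟨rfl, rfl⟩ <;> [exact hij; exact hij.symm]
  have hall : ∀ l, l ≠ a ∧ l ≠ b → l ≠ i ∧ l ≠ j := by
    intro l hl
    rcases hab with ⟨rfl, rfl⟩ | ⟨rfl, rfl⟩ <;> [exact hl; exact hl.symm]
  simp only [LinearMap.sum_apply, TensorProduct.map_tmul, map_sum]
  rw [← sub_eq_zero, ← Finset.sum_sub_distrib, Finset.sum_eq_add a b hne]
  · have c1 := LinearMap.congr_fun (SOp_quadratic q n hij)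
    have c2 := LinearMap.congr_fun (gOp_quadratic q i j)
    simp only [Module.End.mul_apply, LinearMap.add_apply, LinearMap.smul_apply,
      Module.End.one_apply] at c1 c2
    have h1' : ∀ f, gOp q i j ((Y a : Module.End ℂ (Laurent N)) (gOp q i j f)) =
        (Y b : Module.End ℂ (Laurent N)) f := fun f => by rw [← h1]; rfl
    have h2' : ∀ v, B a (SOp q n i j v) = SOp q n i j (B b v) := fun v =>
      LinearMap.congr_fun h2 v
    set c : ℂ := (q : ℂ) - (q : ℂ)⁻¹
    set Ya := (Y a : Module.End ℂ (Laurent N))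
    set Yb := (Y b : Module.End ℂ (Laurent N))
    have e1 : Ya (gOp q i j f) = gOp q i j (Yb f) - c • Yb f := by
      rw [← h1' f, c2]; abel
    have e2 : Yb (gOp q i j f) = c • Yb f + gOp q i j (Ya f) := by
      rw [← h1', c2, map_add, map_smul, map_add, map_smul, h1']
    -- This is `S⁻¹ B_a = B_b S⁻¹`, equivalent to the exchange relation, written with `S⁻¹ = S - c`.
    have e3 : SOp q n i j (B a v) = c • B a v + B b (SOp q n i j v) - c • B b v := by
      have := h2' (SOp q n i j v)
      rw [c1, map_add, map_smul, h2'] at this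
      have h3 := congrArg (SOp q n i j) this
      rw [map_add, map_smul, c1, c1] at h3
      have h4 : SOp q n i j (B a v) =
        c • SOp q n i j (B b (SOp q n i j v)) + B b (SOp q n i j v)
          - c • (c • SOp q n i j (B b v) + B b v) := by rw [← h3]; abel
      rw [h4, ← this]
      module
    rw [e1, e2]
    simp only [TensorProduct.sub_tmul, TensorProduct.add_tmul, map_sub, map_add, cls_gOp hq h, e3,
      h2', TensorProduct.tmul_sub, TensorProduct.tmul_add, TensorProduct.tmul_smul,
      ← TensorProduct.smul_tmul', map_smul]
    abel
  · intro l _ hl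
    obtain ⟨u1, u2⟩ := hall l hl
    rw [sub_eq_zero]
    have k1 : (Y l : Module.End ℂ (Laurent N)) (gOp q i j f) =
        gOp q i j ((Y l : Module.End ℂ (Laurent N)) f) :=
      LinearMap.congr_fun (congrArg Units.val (hY i j h l u1 u2).eq) f
    have k2 : B l (SOp q n i j v) = SOp q n i j (B l v) :=
      LinearMap.congr_fun (hB i j h l u1 u2).eq v
    rw [k1, k2, cls_gOp hq h]
  · simp
  · simp

end Relations

/-! ### The level-zero action and the Hamiltonians on the wedge product -/

/-- Invertible scalars as units of an algebra. -/
def scalarUnit (R : Type*) [Ring R] [Algebra ℂ R] : ℂˣ →* Rˣ :=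
  Units.map (algebraMap ℂ R).toMonoidHom

theorem scalarUnit_val {R : Type*} [Ring R] [Algebra ℂ R] (c : ℂˣ) :
    (scalarUnit R c : R) = algebraMap ℂ R c := rfl

theorem scalarUnit_comm {R : Type*} [Ring R] [Algebra ℂ R] (c : ℂˣ) (u : Rˣ) :
    Commute (scalarUnit R c) u :=
  Units.ext (Algebra.commutes _ _)

section Preserve

variable (q p : ℂˣ) {N : ℕ}

theorem yUnit_eq (i : Fin N) :
    yUnit q p i = scalarUnit (Module.End ℂ (Laurent N)) (q ^ (1 - (N : ℤ))) * YUnit q p i := by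
  rw [yUnit]
  apply Units.ext
  exact Algebra.smul_def (R := ℂ) _ _

theorem yUnit_comm_gUnit {i j l : Fin N} (h : (i : ℕ) + 1 = j) (hi : l ≠ i) (hj : l ≠ j) :
    Commute (yUnit q p l) (gUnit q i j) := by
  rw [yUnit_eq]
  exact Commute.mul_left (scalarUnit_comm (R := Module.End ℂ (Laurent N)) _ _) (gUnit_comm_YUnit q p h hi hj)

theorem gUnit_yUnit_gUnit {i j : Fin N} (h : (i : ℕ) + 1 = j) :
    gUnit q i j * yUnit q p i * gUnit q i j = yUnit q p j := by
  rw [yUnit_eq, yUnit_eq, ← gUnit_YUnit_gUnit q p h, ← mul_assoc, ← (scalarUnit_comm (R := Module.End ℂ (Laurent N)) _ _).eq]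
  simp only [mul_assoc]

theorem yUnit_comm {i j : Fin N} (h : (i : ℕ) + 1 = j) :
    Commute (yUnit q p i) (yUnit q p j) := by
  rw [yUnit_eq, yUnit_eq]
  exact Commute.mul_left (scalarUnit_comm (R := Module.End ℂ (Laurent N)) _ _)
    (Commute.mul_right (scalarUnit_comm (R := Module.End ℂ (Laurent N)) _ _).symm (YUnit_comm q p h))

/-- In the affine Hecke algebra of rank one, power sums of `y, y'` commute with `g`. -/
theorem commute_zpow_add_zpow {R : Type*} [Ring R] [Algebra ℂ R] (c : ℂ) (g y y' : Rˣ)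
    (hg : (g : R) * g = c • (g : R) + 1) (hy : g * y * g = y') (hc : Commute y y') (l : ℤ) :
    Commute (((y ^ l : Rˣ) : R) + ((y' ^ l : Rˣ) : R)) (g : R) := by
  have hyR : (g : R) * y * g = y' := congrArg Units.val hy
  have hcR : (y : R) * y' = y' * y := congrArg Units.val hc.eq
  have hgy' : (y' : R) * g = c • (y' : R) + g * y := by
    rw [← hyR, mul_assoc, hg, mul_add, mul_smul_comm, mul_one]
  have hgy : (g : R) * y' = c • (y' : R) + y * g := by
    rw [← hyR, ← mul_assoc, ← mul_assoc, hg, add_mul, add_mul, smul_mul_assoc, smul_mul_assoc,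
      one_mul]
  have hadd : Commute ((y : R) + y') (g : R) := by
    change _ = _
    rw [add_mul, mul_add, hgy', hgy]; abel
  have hmul : Commute (y * y') g := by
    apply Units.ext
    push_cast
    rw [mul_assoc, hgy', ← mul_assoc, mul_add, mul_smul_comm, hcR]
    have : (y : R) * (g * y) = (g * y' - c • (y' : R)) * y := by rw [hgy]; noncomm_ring
    rw [this]
    simp only [sub_mul, smul_mul_assoc, mul_assoc, ← hcR, add_sub_cancel]
  -- Newton's recursion in the elementary symmetric functions `y + y'` and `y y'`, both of which
  -- commute with `g`. As `y y'` is invertible, it can also be run downwards to negative powers.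
  have hrec : ∀ l : ℤ, ((y ^ (l + 1) : Rˣ) : R) + ((y' ^ (l + 1) : Rˣ) : R) =
      (y + y') * (((y ^ l : Rˣ) : R) + ((y' ^ l : Rˣ) : R)) -
        ((y * y' : Rˣ) : R) * (((y ^ (l - 1) : Rˣ) : R) + ((y' ^ (l - 1) : Rˣ) : R)) := by
    intro l
    have e1 : y ^ (l + 1) = y * y ^ l := by rw [add_comm, zpow_one_add]
    have e2 : y' ^ (l + 1) = y' * y' ^ l := by rw [add_comm, zpow_one_add]
    have e3 : y * y' * y ^ (l - 1) = y' * y ^ l := by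
      rw [hc.eq, mul_assoc, ← zpow_one_add, add_sub_cancel]
    have e4 : y * y' * y' ^ (l - 1) = y * y' ^ l := by
      rw [mul_assoc, ← zpow_one_add, add_sub_cancel]
    rw [mul_add ((y * y' : Rˣ) : R), ← Units.val_mul (y * y'), ← Units.val_mul (y * y'), e3, e4, e1, e2]
    push_cast
    noncomm_ring
  have hmulR : Commute ((y * y' : Rˣ) : R) (g : R) := congrArg Units.val hmul.eq
  have hinvR : Commute (((y * y')⁻¹ : Rˣ) : R) (g : R) := congrArg Units.val hmul.inv_left.eq
  have hback : ∀ l : ℤ, ((y ^ (l - 1) : Rˣ) : R) + ((y' ^ (l - 1) : Rˣ) : R) =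
      (((y * y')⁻¹ : Rˣ) : R) * ((y + y') * (((y ^ l : Rˣ) : R) + ((y' ^ l : Rˣ) : R)) -
        (((y ^ (l + 1) : Rˣ) : R) + ((y' ^ (l + 1) : Rˣ) : R))) := by
    intro l
    rw [hrec, sub_sub_cancel, Units.inv_mul_cancel_left]
  have main : Commute (((y ^ l : Rˣ) : R) + ((y' ^ l : Rˣ) : R)) (g : R) ∧
      Commute (((y ^ (l + 1) : Rˣ) : R) + ((y' ^ (l + 1) : Rˣ) : R)) (g : R) := by
    induction l using Int.induction_on with
    | zero =>
      refine ⟨?_, ?_⟩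
      · simp
      · simpa using hadd
    | succ l ih =>
      refine ⟨ih.2, ?_⟩
      rw [hrec, add_sub_cancel_right]
      exact (hadd.mul_left ih.2).sub_left (hmulR.mul_left ih.1)
    | pred l ih =>
      refine ⟨?_, by simpa using ih.1⟩
      rw [hback]
      exact hinvR.mul_left ((hadd.mul_left ih.1).sub_left ih.2)
  exact main.1

theorem sum_yUnit_zpow_comm {i j : Fin N} (h : (i : ℕ) + 1 = j) (l : ℤ) :
    Commute (∑ k : Fin N, ((yUnit q p k ^ l : (Module.End ℂ (Laurent N))ˣ) :
      Module.End ℂ (Laurent N))) (gOp q i j) := by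
  have hij := ne_of_succ h
  rw [← Finset.add_sum_erase _ _ (Finset.mem_univ i),
    ← Finset.add_sum_erase _ _ (Finset.mem_erase.mpr ⟨hij.symm, Finset.mem_univ j⟩), ← add_assoc]
  refine Commute.add_left (R := Module.End ℂ (Laurent N)) ?_ (Commute.sum_left _ _ _ ?_)
  · exact commute_zpow_add_zpow ((q : ℂ) - (q : ℂ)⁻¹) (gUnit q i j) _ _ (gOp_quadratic q i j)
      (gUnit_yUnit_gUnit q p h) (yUnit_comm q p h) l
  · intro k hk
    simp only [Finset.mem_erase, Finset.mem_univ, and_true] at hk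
    have := ((yUnit_comm_gUnit q p h hk.2 hk.1).zpow_left l).eq
    exact congrArg Units.val this

theorem descends_hOp (n : ℕ) (hq : (q : ℂ) + (q : ℂ)⁻¹ ≠ 0) (l : ℤ) :
    Descends q (hOp n q p N l) :=
  descends_rTensor hq fun _ _ h => sum_yUnit_zpow_comm q p h l

/-- The `i`-th summand of `E_ε` on the spin factor. -/
abbrev spinE {n : ℕ} (c : Fin n) (i : Fin N) : Module.End ℂ (Spin n N) :=
  siteOp i (unitMat (pos c) c) * diagOp q c 1 (fun j => i < j)

/-- The `i`-th summand of `F_ε` on the spin factor. -/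
abbrev spinF {n : ℕ} (c : Fin n) (i : Fin N) : Module.End ℂ (Spin n N) :=
  diagOp q c (-1) (fun j => j < i) * siteOp i (unitMat c (pos c))

theorem spinE_vec {n : ℕ} (c : Fin n) (i : Fin N) (e : Fin N → Fin n) :
    spinE q c i (vec e) = chi q c 1 (fun j => i < j) e •
      if e i = c then vec (Function.update e i (pos c)) else 0 := by
  rw [spinE, Module.End.mul_apply, diagOp_vec, map_smul, siteOp_vec]

theorem spinF_vec {n : ℕ} (c : Fin n) (i : Fin N) (e : Fin N → Fin n) :
    spinF q c i (vec e) = chi q c (-1) (fun j => j < i) e •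
      if e i = pos c then vec (Function.update e i c) else 0 := by
  rw [spinF, Module.End.mul_apply, siteOp_vec]
  split_ifs
  · rw [diagOp_vec, chi_update q c (-1) (fun j => j < i) (lt_irrefl i)]
  · simp

theorem spinE_comm_SOp {n : ℕ} (c : Fin n) {i j l : Fin N} (h : (i : ℕ) + 1 = j) (hi : l ≠ i)
    (hj : l ≠ j) : Commute (spinE q c l) (SOp q n i j) := by
  refine (siteOp_comm_SOp q hi hj _).mul_left (diagOp_comm_SOp q c 1 _ (ne_of_succ h) ?_)
  have := Fin.val_ne_of_ne hi
  have := Fin.val_ne_of_ne hj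
  simp only [Fin.lt_def]; omega

theorem spinF_comm_SOp {n : ℕ} (c : Fin n) {i j l : Fin N} (h : (i : ℕ) + 1 = j) (hi : l ≠ i)
    (hj : l ≠ j) : Commute (spinF q c l) (SOp q n i j) := by
  refine (diagOp_comm_SOp q c (-1) _ (ne_of_succ h) ?_).mul_left (siteOp_comm_SOp q hi hj _)
  have := Fin.val_ne_of_ne hi
  have := Fin.val_ne_of_ne hj
  simp only [Fin.lt_def]; omega

/-- The `K` factors to the right of `j` are common to both summands and form the scalar `X` of the
two-site lemmas; the summand at `i` carries one more factor, the eigenvalue of `K_j`. -/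
theorem spinE_two_site {n : ℕ} (hn : 2 ≤ n) (c : Fin n) {i j : Fin N} (h : (i : ℕ) + 1 = j) :
    ((c : ℕ) = 0 → spinE q c j * SOp q n i j = SOp q n i j * spinE q c i) ∧
    ((c : ℕ) ≠ 0 → Commute (spinE q c i + spinE q c j) (SOp q n i j)) := by
  have hij := ne_of_succ h
  have key : ∀ e : Fin N → Fin n,
      ((c : ℕ) = 0 → spinE q c j (SOp q n i j (vec e)) = SOp q n i j (spinE q c i (vec e))) ∧
      ((c : ℕ) ≠ 0 → (spinE q c i + spinE q c j) (SOp q n i j (vec e)) =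
        SOp q n i j ((spinE q c i + spinE q c j) (vec e))) := by
    intro e
    set F : Fin n → Fin n → Spin n N :=
      fun x y => vec (Function.update (Function.update e i x) j y) with hF
    have heF : vec e = F (e i) (e j) := by simp [hF]
    have hS : ∀ x y, SOp q n i j (F x y) = _ := SOp_vec_update q hij e
    have hX : ∀ x y, chi q c 1 (fun k => j < k)
        (Function.update (Function.update e i x) j y) = chi q c 1 (fun k => j < k) e := by
      intro x y
      rw [chi_update q c 1 _ (lt_irrefl j), chi_update]
      simp only [Fin.lt_def]; omega
    have hBj : ∀ x y, spinE q c j (F x y) =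
        chi q c 1 (fun k => j < k) e • if y = c then F x (pos c) else 0 := by
      intro x y
      rw [hF, spinE_vec, hX]
      simp
    have hBi : ∀ x y, spinE q c i (F x y) =
        (chi q c 1 (fun k => j < k) e * kap q c 1 y) • if x = c then F (pos c) y else 0 := by
      intro x y
      rw [hF, spinE_vec, chi_insert q c 1 (fun k => j < k) (fun k => i < k) (lt_irrefl j), hX,
        mul_comm]
      · simp only [Function.update_self, ne_eq, hij, not_false_eq_true, Function.update_of_ne]
        rw [Function.update_comm hij.symm, Function.update_idem]
      · intro k
        simp only [Fin.lt_def, Fin.ext_iff]; omega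
    obtain ⟨k1, k2, k3⟩ := kap_one q hn c
    rw [heF]
    refine ⟨fun h0 => ?_, fun h0 => ?_⟩
    · exact two_site_affine_raise q c (pos c) _ _ _ F _ (kap q c 1) hS k3 k1 k2
        ((pos_lt_self hn c).1 h0) (fun z h1 h2 => (lt_pos_iff c z h1 h2).1 h0) hBi hBj _ _
    · exact two_site_finite_raise q c (pos c) _ _ _ F _ (kap q c 1) hS k3 k1 k2
        ((pos_lt_self hn c).2 h0) (fun z h1 h2 => (lt_pos_iff c z h1 h2).2 h0) hBi hBj _ _
  exact ⟨fun h0 => spin_ext fun e => (key e).1 h0, fun h0 => spin_ext fun e => (key e).2 h0⟩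

theorem spinF_two_site {n : ℕ} (hn : 2 ≤ n) (c : Fin n) {i j : Fin N} (h : (i : ℕ) + 1 = j) :
    ((c : ℕ) = 0 → spinF q c i * SOp q n i j = SOp q n i j * spinF q c j) ∧
    ((c : ℕ) ≠ 0 → Commute (spinF q c i + spinF q c j) (SOp q n i j)) := by
  have hij := ne_of_succ h
  have key : ∀ e : Fin N → Fin n,
      ((c : ℕ) = 0 → spinF q c i (SOp q n i j (vec e)) = SOp q n i j (spinF q c j (vec e))) ∧
      ((c : ℕ) ≠ 0 → (spinF q c i + spinF q c j) (SOp q n i j (vec e)) =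
        SOp q n i j ((spinF q c i + spinF q c j) (vec e))) := by
    intro e
    set F : Fin n → Fin n → Spin n N :=
      fun x y => vec (Function.update (Function.update e i x) j y) with hF
    have heF : vec e = F (e i) (e j) := by simp [hF]
    have hS : ∀ x y, SOp q n i j (F x y) = _ := SOp_vec_update q hij e
    have hX : ∀ x y, chi q c (-1) (fun k => k < i)
        (Function.update (Function.update e i x) j y) = chi q c (-1) (fun k => k < i) e := by
      intro x y
      rw [chi_update, chi_update q c (-1) (fun j => j < i) (lt_irrefl i)]
      simp only [Fin.lt_def]; omega
    have hBi : ∀ x y, spinF q c i (F x y) =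
        chi q c (-1) (fun k => k < i) e • if x = pos c then F c y else 0 := by
      intro x y
      rw [hF, spinF_vec, hX]
      simp only [ne_eq, hij, not_false_eq_true, Function.update_of_ne, Function.update_self]
      rw [Function.update_comm hij.symm, Function.update_idem]
    have hBj : ∀ x y, spinF q c j (F x y) =
        (chi q c (-1) (fun k => k < i) e * kap q c (-1) x) •
          if y = pos c then F x c else 0 := by
      intro x y
      rw [hF, spinF_vec, chi_insert q c (-1) (fun k => k < i) (fun k => k < j) (lt_irrefl i), hX,
        mul_comm]
      · simp [hij]
      · intro k
        simp only [Fin.lt_def, Fin.ext_iff]; omega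
    obtain ⟨k1, k2, k3⟩ := kap_neg_one q hn c
    rw [heF]
    refine ⟨fun h0 => ?_, fun h0 => ?_⟩
    · exact two_site_affine_lower q (pos c) c _ _ _ F _ (kap q c (-1)) hS
        (fun x h1 h2 => k3 x h2 h1) k2 k1 ((pos_lt_self hn c).1 h0)
        (fun z h1 h2 => (lt_pos_iff c z h2 h1).1 h0) hBi hBj _ _
    · exact two_site_finite_lower q (pos c) c _ _ _ F _ (kap q c (-1)) hS
        (fun x h1 h2 => k3 x h2 h1) k2 k1 ((pos_lt_self hn c).2 h0)
        (fun z h1 h2 => ((lt_pos_iff c z h2 h1).2 h0).imp And.symm And.symm) hBi hBj _ _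
  exact ⟨fun h0 => spin_ext fun e => (key e).1 h0, fun h0 => spin_ext fun e => (key e).2 h0⟩

theorem descends_sum_spin {n : ℕ} (hq : (q : ℂ) + (q : ℂ)⁻¹ ≠ 0) (B : Fin N → Module.End ℂ (Spin n N))
    (hB : ∀ i j : Fin N, (i : ℕ) + 1 = j → ∀ l, l ≠ i → l ≠ j → Commute (B l) (SOp q n i j))
    (hB' : ∀ i j : Fin N, (i : ℕ) + 1 = j → Commute (B i + B j) (SOp q n i j)) :
    Descends q (∑ l, TensorProduct.map
      ((1 : (Module.End ℂ (Laurent N))ˣ) : Module.End ℂ (Laurent N)) (B l)) := by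
  have e : ∑ l, TensorProduct.map
      ((1 : (Module.End ℂ (Laurent N))ˣ) : Module.End ℂ (Laurent N)) (B l) =
      (∑ l, B l).lTensor (Laurent N) := by
    apply TensorProduct.ext'
    intro f v
    simp [LinearMap.sum_apply, TensorProduct.tmul_sum]
  rw [e]
  refine descends_lTensor hq fun i j h => ?_
  have hij := ne_of_succ h
  rw [← Finset.add_sum_erase _ _ (Finset.mem_univ i),
    ← Finset.add_sum_erase _ _ (Finset.mem_erase.mpr ⟨hij.symm, Finset.mem_univ j⟩), ← add_assoc]
  refine Commute.add_left (R := Module.End ℂ (Spin n N)) (hB' i j h) (Commute.sum_left _ _ _ ?_)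
  intro k hk
  simp only [Finset.mem_erase, Finset.mem_univ, and_true] at hk
  exact hB i j h k hk.2 hk.1

theorem descends_genOp {n : ℕ} (hn : 2 ≤ n) (hq : (q : ℂ) + (q : ℂ)⁻¹ ≠ 0) (x : Gen n) :
    Descends q (genOp n q p N x) := by
  have hyc : ∀ (t : ℤ) (i j : Fin N), (i : ℕ) + 1 = j → ∀ l, l ≠ i → l ≠ j →
      Commute (yUnit q p l ^ t) (gUnit q i j) :=
    fun t i j h l hi hj => (yUnit_comm_gUnit q p h hi hj).zpow_left t
  cases x with
  | E c =>
    by_cases h0 : (c : ℕ) = 0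
    · simp only [genOp, if_pos h0]
      -- `E_0` contains `y⁻¹`. Inverting `g y_i g = y_j` gives `g y_j⁻¹ g = y_i⁻¹`, so the roles of
      -- the two sites are interchanged compared with `F_0`.
      refine descends_sum hq _ (spinE q c) (hyc _) (fun i j h l hi hj => spinE_comm_SOp q c h hi hj)
        fun i j h => ⟨j, i, Or.inr ⟨rfl, rfl⟩, ?_, (spinE_two_site q hn c h).1 h0⟩
      rw [zpow_neg_one, zpow_neg_one, ← gUnit_yUnit_gUnit q p h]
      group
    · simp only [genOp, if_neg h0, zpow_zero]
      exact descends_sum_spin q hq (spinE q c) (fun i j h l hi hj => spinE_comm_SOp q c h hi hj)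
        fun i j h => (spinE_two_site q hn c h).2 h0
  | F c =>
    by_cases h0 : (c : ℕ) = 0
    · simp only [genOp, if_pos h0]
      refine descends_sum hq _ (spinF q c) (hyc _) (fun i j h l hi hj => spinF_comm_SOp q c h hi hj)
        fun i j h => ⟨i, j, Or.inl ⟨rfl, rfl⟩, ?_, (spinF_two_site q hn c h).1 h0⟩
      rw [zpow_one, zpow_one, gUnit_yUnit_gUnit q p h]
    · simp only [genOp, if_neg h0, zpow_zero]
      exact descends_sum_spin q hq (spinF q c) (fun i j h l hi hj => spinF_comm_SOp q c h hi hj)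
        fun i j h => (spinF_two_site q hn c h).2 h0
  | K c =>
    refine descends_lTensor hq fun i j h => ?_
    have := diagOp_comm_SOp q c 1 (fun _ : Fin N => True) (ne_of_succ h) Iff.rfl
    simpa [diagOp] using this
  | Kinv c =>
    refine descends_lTensor hq fun i j h => ?_
    have := diagOp_comm_SOp q c (-1) (fun _ : Fin N => True) (ne_of_succ h) Iff.rfl
    simpa [diagOp] using this

/-- The operators that preserve `Ω`. -/
def descendsSubalgebra (n N : ℕ) : Subalgebra ℂ (Module.End ℂ (Tens n N)) where
  carrier := {A | Descends q A}
  mul_mem' := fun hA hB _ hx => hA (hB hx)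
  add_mem' := fun hA hB _ hx => (Omega n q N).add_mem (hA hx) (hB hx)
  algebraMap_mem' := fun c _ hx => (Omega n q N).smul_mem c hx

theorem descends_U0 {n : ℕ} (hn : 2 ≤ n) (hq : (q : ℂ) + (q : ℂ)⁻¹ ≠ 0)
    (x : FreeAlgebra ℂ (Gen n)) : Descends q (U0 n q p N x) := by
  change _ ∈ descendsSubalgebra q n N
  induction x using FreeAlgebra.induction with
  | grade0 r => rw [AlgHom.commutes]; exact Subalgebra.algebraMap_mem _ r
  | grade1 x =>
    rw [U0, FreeAlgebra.lift_ι_apply]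
    exact descends_genOp q p hn hq x
  | mul a b ha hb => rw [map_mul]; exact Subalgebra.mul_mem _ ha hb
  | add a b ha hb => rw [map_add]; exact Subalgebra.add_mem _ ha hb

end Preserve

/-! ### Monomial bases -/

/-- The basis `v_{ε₁} ⊗ ⋯ ⊗ v_{ε_N}`. -/
def vecBasis (n N : ℕ) : Module.Basis (Fin N → Fin n) ℂ (Spin n N) :=
  Basis.piTensorProduct (fun _ : Fin N => Pi.basisFun ℂ (Fin n))

theorem vecBasis_apply {n N : ℕ} (e : Fin N → Fin n) : vecBasis n N e = vec e := by
  simp [vecBasis, vec, Pi.basisFun_apply]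

/-- The basis of monomials. -/
def monoBasis (N : ℕ) : Module.Basis (Fin N → ℤ) ℂ (Laurent N) :=
  Module.Basis.ofRepr (AddMonoidAlgebra.coeffLinearEquiv ℂ)

theorem monoBasis_apply {N : ℕ} (m : Fin N → ℤ) : monoBasis N m = mono m := by
  apply (AddMonoidAlgebra.coeffLinearEquiv ℂ).injective
  rw [monoBasis, Module.Basis.coe_ofRepr, LinearEquiv.apply_symm_apply]
  simp [mono]

/-- The basis `z^m ⊗ v_ε` of `⊗^N V(z)`. -/
def tensBasis (n N : ℕ) : Module.Basis ((Fin N → ℤ) × (Fin N → Fin n)) ℂ (Tens n N) :=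
  (monoBasis N).tensorProduct (vecBasis n N)

theorem tensBasis_apply {n N : ℕ} (b : (Fin N → ℤ) × (Fin N → Fin n)) :
    tensBasis n N b = mono b.1 ⊗ₜ vec b.2 := by
  rw [tensBasis, Module.Basis.tensorProduct_apply', monoBasis_apply, vecBasis_apply]

theorem mem_of_vec {n N : ℕ} {K : Submodule ℂ (Spin n N)} (h : ∀ e, vec e ∈ K) (v : Spin n N) :
    v ∈ K := by
  have : Submodule.span ℂ (Set.range (vecBasis n N)) ≤ K := by
    rw [Submodule.span_le]
    rintro _ ⟨e, rfl⟩
    rw [vecBasis_apply]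
    exact h e
  rw [Module.Basis.span_eq] at this
  exact this trivial

/-! ### The action of `g_{i,j}` on monomials -/

/-- The exponents with `k` units moved from `z_j` to `z_i`. -/
def squeeze {N : ℕ} (m : Fin N → ℤ) (i j : Fin N) (k : ℤ) : Fin N → ℤ :=
  Function.update (Function.update m i (m i + k)) j (m j - k)

theorem squeeze_comm {N : ℕ} (m : Fin N → ℤ) {i j : Fin N} (hij : i ≠ j) (k : ℤ) :
    squeeze (m ∘ Equiv.swap i j) i j k = squeeze m j i (m i - m j - k) := by
  funext x
  by_cases hx : x = i
  · subst hx; simp [squeeze, hij]; ring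
  · by_cases hx' : x = j
    · subst hx'; simp [squeeze, hx]; ring
    · simp [squeeze, hx, hx', Equiv.swap_apply_of_ne_of_ne hx hx']

/-- For an ascent the monomial `z^m` itself drops out: the summand `+q` of `g` cancels the first
term of the divided difference. Triangularity of the antisymmetrizer rests on this. -/
theorem gOp_mono_of_lt (q : ℂˣ) {N : ℕ} {i j : Fin N} (m : Fin N → ℤ) (h : m i < m j) :
    gOp q i j (mono m) = (q : ℂ)⁻¹ • mono (m ∘ Equiv.swap i j) + ((q : ℂ)⁻¹ - q) •
      ∑ k ∈ Finset.range ((m j - m i).toNat - 1), mono (squeeze m i j (k + 1)) := by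
  have hij : i ≠ j := by rintro rfl; exact lt_irrefl _ h
  obtain ⟨d, hd⟩ : ∃ d : ℕ, m j = m i + d + 1 := ⟨(m j - m i - 1).toNat, by omega⟩
  have h1 : (m j - m i).toNat = d + 1 := by omega
  have h2 : (m i - m j).toNat = 0 := by omega
  have e1 : ∀ k : ℕ, zvar i * mono (Function.update (Function.update m i (m i + k)) j
      (m j - 1 - k)) = mono (squeeze m i j (k + 1)) := by
    intro k
    rw [zvar, mono_mul]
    congr 1
    funext x
    by_cases hx : x = j
    · subst hx; simp [squeeze, hij.symm]; ring
    · by_cases hx' : x = i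
      · subst hx'; simp [squeeze, hx]; ring
      · simp [squeeze, hx, hx']
  have e2 : ∀ k : ℕ, zvar j * mono (Function.update (Function.update m i (m i + k)) j
      (m j - 1 - k)) = mono (squeeze m i j k) := by
    intro k
    rw [zvar, mono_mul]
    congr 1
    funext x
    by_cases hx : x = j
    · subst hx; simp [squeeze]; ring
    · by_cases hx' : x = i
      · subst hx'; simp [squeeze, hx]
      · simp [squeeze, hx, hx']
  have e3 : squeeze m i j 0 = m := by simp [squeeze]
  have e4 : squeeze m i j ((d : ℤ) + 1) = m ∘ Equiv.swap i j := by
    funext x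
    by_cases hx : x = j
    · subst hx; simp [squeeze]; omega
    · by_cases hx' : x = i
      · subst hx'; simp [squeeze, hx]; omega
      · simp [squeeze, hx, hx', Equiv.swap_apply_of_ne_of_ne hx' hx]
  simp only [gOp, LinearMap.add_apply, LinearMap.comp_apply, LinearMap.mulLeft_apply,
    LinearMap.smul_apply, LinearMap.id_apply, divDiff_mono, divDiffMono, h1, h2,
    Finset.range_zero, Finset.sum_empty, sub_zero, sub_mul, smul_mul_assoc, Finset.mul_sum, e1,
    e2, Nat.add_sub_cancel, Finset.sum_sub_distrib, ← Finset.smul_sum]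
  -- The `z_i` and `z_j` parts are sums over overlapping ranges. The last term of the first is the
  -- swapped monomial, the first term of the second is `z^m`.
  rw [Finset.sum_range_succ, Finset.sum_range_succ']
  push_cast
  rw [e3, e4]
  module

theorem divDiff_permVar {N : ℕ} {i j : Fin N} (hij : i ≠ j) (f : Laurent N) :
    divDiff i j (permVar i j f) = - divDiff i j f := by
  apply mul_left_cancel₀ (zvar_sub_ne_zero hij)
  rw [sub_mul_divDiff hij, mul_neg, sub_mul_divDiff hij, permVar_permVar]
  ring

theorem gOp_permVar (q : ℂˣ) {N : ℕ} {i j : Fin N} (hij : i ≠ j) (f : Laurent N) :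
    gOp q i j (permVar i j f) = (q : ℂ) • f + (q : ℂ) • permVar i j f - gOp q i j f := by
  simp only [gOp, LinearMap.add_apply, LinearMap.comp_apply, LinearMap.mulLeft_apply,
    LinearMap.smul_apply, LinearMap.id_apply, divDiff_permVar hij, mul_neg]
  abel

/-- Reduced to an ascent by `g K = q + q K - g`; reflecting the sum turns squeezes of the swapped
exponents into squeezes of `m`. -/
theorem gOp_mono_of_gt (q : ℂˣ) {N : ℕ} {i j : Fin N} (m : Fin N → ℤ) (h : m j < m i) :
    gOp q i j (mono m) = (q : ℂ) • mono (m ∘ Equiv.swap i j) + ((q : ℂ) - (q : ℂ)⁻¹) • mono m +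
      ((q : ℂ) - (q : ℂ)⁻¹) •
      ∑ k ∈ Finset.range ((m i - m j).toNat - 1), mono (squeeze m j i (k + 1)) := by
  have hij : i ≠ j := by rintro rfl; exact lt_irrefl _ h
  have hs : (m ∘ Equiv.swap i j) ∘ Equiv.swap i j = m := by funext x; simp
  have h1 := gOp_mono_of_lt q (i := i) (j := j) (m ∘ Equiv.swap i j) (by simpa using h)
  have h2 := gOp_permVar q hij (mono (m ∘ Equiv.swap i j))
  rw [permVar_mono, hs, h1] at h2
  simp only [squeeze_comm m hij, Function.comp_apply, Equiv.swap_apply_left,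
    Equiv.swap_apply_right, hs] at h2
  rw [h2, ← Finset.sum_range_reflect]
  have e : ∀ k ∈ Finset.range ((m i - m j).toNat - 1),
      mono (squeeze m j i (m i - m j - (((m i - m j).toNat - 1 - 1 - k : ℕ) + 1))) =
      mono (squeeze m j i (k + 1)) := by
    intro k hk
    rw [Finset.mem_range] at hk
    congr 2
    omega
  rw [Finset.sum_congr rfl e]
  module

theorem gOp_mono_of_eq (q : ℂˣ) {N : ℕ} {i j : Fin N} (m : Fin N → ℤ) (h : m i = m j) :
    gOp q i j (mono m) = (q : ℂ) • mono m := by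
  simp [gOp, divDiff_mono, divDiffMono, h]

/-! ### Sets of monomials preserved by all the operators -/

/-- A property of exponents that is preserved by permutations and by moving two exponents
towards each other. -/
structure Squeezable {N : ℕ} (P : (Fin N → ℤ) → Prop) : Prop where
  swap : ∀ m i j, P m → P (m ∘ Equiv.swap i j)
  squeeze : ∀ m i j (k : ℤ), i ≠ j → P m → 0 < k → k < m j - m i → P (squeeze m i j k)

/-- The span of the monomials whose exponents satisfy `P`. -/
def monoSpan {N : ℕ} (P : (Fin N → ℤ) → Prop) : Submodule ℂ (Laurent N) :=
  Submodule.span ℂ (mono '' {m | P m})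

theorem mono_mem {N : ℕ} {P : (Fin N → ℤ) → Prop} {m : Fin N → ℤ} (h : P m) :
    mono m ∈ monoSpan P := Submodule.subset_span ⟨m, h, rfl⟩

theorem monoSpan_le {N : ℕ} {P : (Fin N → ℤ) → Prop} {K : Submodule ℂ (Laurent N)}
    (h : ∀ m, P m → mono m ∈ K) : monoSpan P ≤ K := by
  rw [monoSpan, Submodule.span_le]
  rintro _ ⟨m, hm, rfl⟩
  exact h m hm

section Squeezable

variable {N : ℕ} {P : (Fin N → ℤ) → Prop} (hP : Squeezable P)

include hP

theorem sum_squeeze_mem (m : Fin N → ℤ) {i j : Fin N} (hm : P m) :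
    ∑ k ∈ Finset.range ((m j - m i).toNat - 1), mono (squeeze m i j (k + 1)) ∈ monoSpan P := by
  refine Submodule.sum_mem _ fun k hk => ?_
  rw [Finset.mem_range] at hk
  have hij : i ≠ j := by rintro rfl; simp at hk
  exact mono_mem (hP.squeeze _ _ _ _ hij hm (by omega) (by omega))

theorem gOp_mem (q : ℂˣ) (i j : Fin N) {f : Laurent N} (hf : f ∈ monoSpan P) :
    gOp q i j f ∈ monoSpan P := by
  refine monoSpan_le (K := (monoSpan P).comap (gOp q i j)) (fun m hm => ?_) hf
  rw [Submodule.mem_comap]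
  rcases lt_trichotomy (m i) (m j) with h | h | h
  · rw [gOp_mono_of_lt q m h]
    exact Submodule.add_mem _ (Submodule.smul_mem _ _ (mono_mem (hP.swap _ _ _ hm)))
      (Submodule.smul_mem _ _ (sum_squeeze_mem hP m hm))
  · rw [gOp_mono_of_eq q m h]
    exact Submodule.smul_mem _ _ (mono_mem hm)
  · rw [gOp_mono_of_gt q m h]
    exact Submodule.add_mem _ (Submodule.add_mem _
      (Submodule.smul_mem _ _ (mono_mem (hP.swap _ _ _ hm))) (Submodule.smul_mem _ _ (mono_mem hm)))
      (Submodule.smul_mem _ _ (sum_squeeze_mem hP m hm))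

theorem permVar_mem (i j : Fin N) {f : Laurent N} (hf : f ∈ monoSpan P) :
    permVar i j f ∈ monoSpan P := by
  refine monoSpan_le (K := (monoSpan P).comap (permVar i j).toLinearMap) (fun m hm => ?_) hf
  rw [Submodule.mem_comap, AlgEquiv.toLinearMap_apply, permVar_mono]
  exact mono_mem (hP.swap _ _ _ hm)

omit hP in
theorem shiftOp_mem (p : ℂˣ) (i : Fin N) {f : Laurent N} (hf : f ∈ monoSpan P) :
    shiftOp p i f ∈ monoSpan P := by
  refine monoSpan_le (K := (monoSpan P).comap (shiftOp p i)) (fun m hm => ?_) hf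
  rw [Submodule.mem_comap, shiftOp_mono]
  exact Submodule.smul_mem _ _ (mono_mem hm)

end Squeezable

/-! ### Straightening -/

/-- The quadratic energy of a sequence of exponents. -/
def energy {N : ℕ} (m : Fin N → ℤ) : ℤ := ∑ i, m i ^ 2

theorem sum_sub_sum_of_eq {N : ℕ} {i j : Fin N} (hij : i ≠ j) (f g : Fin N → ℤ)
    (h : ∀ k, k ≠ i → k ≠ j → f k = g k) :
    ∑ k, f k - ∑ k, g k = (f i - g i) + (f j - g j) := by
  rw [← Finset.sum_sub_distrib, Finset.sum_eq_add i j hij]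
  · intro k _ hk
    rw [h k hk.1 hk.2, sub_self]
  · simp
  · simp

theorem energy_comp_swap {N : ℕ} (m : Fin N → ℤ) (i j : Fin N) :
    energy (m ∘ Equiv.swap i j) = energy m :=
  Equiv.sum_comp (Equiv.swap i j) (fun k => m k ^ 2)

/-- With the sum of two exponents fixed, bringing them closer lowers the sum of squares, here by `2
k (m_j - m_i - k)`. -/
theorem energy_squeeze {N : ℕ} (m : Fin N → ℤ) {i j : Fin N} (hij : i ≠ j) {k : ℤ} (hk : 0 < k)
    (hk' : k < m j - m i) : energy (squeeze m i j k) < energy m := by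
  have h := sum_sub_sum_of_eq hij (fun x => squeeze m i j k x ^ 2) (fun x => m x ^ 2)
    (fun x h1 h2 => by simp [squeeze, h1, h2])
  have e1 : squeeze m i j k i = m i + k := by simp [squeeze, hij]
  have e2 : squeeze m i j k j = m j - k := by simp [squeeze]
  simp only [e1, e2] at h
  rw [energy, energy]
  nlinarith [mul_pos hk (sub_pos.mpr hk')]

theorem energy_nonneg {N : ℕ} (m : Fin N → ℤ) : 0 ≤ energy m :=
  Finset.sum_nonneg fun _ _ => sq_nonneg _

theorem le_energy {N : ℕ} (m : Fin N → ℤ) (i : Fin N) : m i ≤ energy m := by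
  have h1 : m i ^ 2 ≤ energy m :=
    Finset.single_le_sum (f := fun i => m i ^ 2) (fun _ _ => sq_nonneg _) (Finset.mem_univ i)
  nlinarith [sq_nonneg (m i - 1), sq_nonneg (m i)]

/-- The moment `∑ i x_i`, a measure for sorting. -/
def moment {N : ℕ} (x : Fin N → ℤ) : ℤ := ∑ i : Fin N, (i : ℤ) * x i

theorem moment_comp_swap {N : ℕ} (x : Fin N → ℤ) {i j : Fin N} (h : (i : ℕ) + 1 = j) :
    moment (x ∘ Equiv.swap i j) = moment x + (x i - x j) := by
  have hij := ne_of_succ h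
  have := sum_sub_sum_of_eq hij (fun k => (k : ℤ) * (x ∘ Equiv.swap i j) k) (fun k => (k : ℤ) * x k)
    (fun k h1 h2 => by simp [Equiv.swap_apply_of_ne_of_ne h1 h2])
  simp only [Function.comp_apply, Equiv.swap_apply_left, Equiv.swap_apply_right] at this
  rw [moment, moment]
  simp only [Function.comp_apply]
  have hj : ((j : ℕ) : ℤ) = (i : ℤ) + 1 := by omega
  rw [hj] at this
  linear_combination this

/-- Removing a descent raises the moment and keeps the energy, so a bound in terms of the energy
makes sorting terminate. -/
theorem moment_le {N : ℕ} (m : Fin N → ℤ) : moment m ≤ N * (N * energy m) := by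
  have : moment m ≤ ∑ _i : Fin N, (N : ℤ) * energy m := by
    refine Finset.sum_le_sum fun i _ => ?_
    have h1 := le_energy m i
    have h2 := energy_nonneg m
    have h3 : ((i : ℕ) : ℤ) ≤ N := by have := i.2; omega
    calc (i : ℤ) * m i ≤ (i : ℤ) * energy m := by gcongr
      _ ≤ N * energy m := by gcongr
  simpa using this

/-- The pairs `(m_i, ε_i)` are strictly increasing, for the order with `ε` reversed. -/
def Sorted {n N : ℕ} (m : Fin N → ℤ) (e : Fin N → Fin n) : Prop :=
  ∀ i j, i < j → m i < m j ∨ (m i = m j ∧ e j < e i)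

theorem sorted_of_adjacent {n N : ℕ} {m : Fin N → ℤ} {e : Fin N → Fin n}
    (h : ∀ i j : Fin N, (i : ℕ) + 1 = j → m i < m j ∨ (m i = m j ∧ e j < e i)) : Sorted m e := by
  have : ∀ d : ℕ, ∀ i j : Fin N, (i : ℕ) + d + 1 = j → m i < m j ∨ (m i = m j ∧ e j < e i) := by
    intro d
    induction d with
    | zero => exact fun i j hij => h i j hij
    | succ d ih =>
      intro i j hij
      have h1 := ih i ⟨i + d + 1, by omega⟩ rfl
      have h2 := h ⟨i + d + 1, by omega⟩ j (by simp; omega)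
      rcases h1 with h1 | ⟨h1, h1'⟩ <;> rcases h2 with h2 | ⟨h2, h2'⟩
      · exact Or.inl (h1.trans h2)
      · exact Or.inl (h2 ▸ h1)
      · exact Or.inl (h1 ▸ h2)
      · exact Or.inr ⟨h1.trans h2, h2'.trans h1'⟩
  intro i j hij
  exact this (j - i - 1) i j (by have := Fin.lt_def.mp hij; omega)

/-- The multiplicity condition is redundant: on sites with equal exponents the spins are strictly
monotone, hence distinct, and there are only `n` of them. -/
theorem normallyOrdered_iff {n N : ℕ} {m : Fin N → ℤ} {e : Fin N → Fin n} :
    NormallyOrdered m e ↔ Sorted m e := by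
  constructor
  · rintro ⟨h1, -, h3⟩
    apply sorted_of_adjacent
    intro i j hij
    rcases (h1 (show i ≤ j by rw [Fin.le_def]; omega)).lt_or_eq with h | h
    · exact Or.inl h
    · exact Or.inr ⟨h, h3 i j hij h⟩
  · intro h
    refine ⟨?_, ?_, ?_⟩
    · intro i j hij
      rcases hij.lt_or_eq with h' | rfl
      · rcases h i j h' with h'' | h''
        exacts [h''.le, h''.1.le]
      · exact le_rfl
    · intro c
      have := Finset.card_le_card_of_injOn (s := Finset.univ.filter (fun i => m i = c))
        (t := Finset.univ) e (fun _ _ => Finset.mem_coe.mpr (Finset.mem_univ _)) (by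
          intro i hi j hj hij
          simp only [Finset.coe_filter, Finset.mem_univ, true_and, Set.mem_ofPred_eq] at hi hj
          by_contra hne
          rcases lt_or_gt_of_ne hne with h' | h'
          · rcases h i j h' with h'' | h''
            · omega
            · exact absurd hij h''.2.ne'
          · rcases h j i h' with h'' | h''
            · omega
            · exact absurd hij h''.2.ne)
      simpa using this
    · intro i j hij hm
      rcases h i j (by rw [Fin.lt_def]; omega) with h' | h'
      · omega
      · exact h'.2

/-- The span of the normally ordered wedges with exponents satisfying `P`. -/
def wedgeSpan (n : ℕ) (q : ℂˣ) {N : ℕ} (P : (Fin N → ℤ) → Prop) : Submodule ℂ (Wedge n q N) :=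
  Submodule.span ℂ {w | ∃ m e, NormallyOrdered m e ∧ P m ∧ w = wedge n q m e}

section Straightening

variable {n : ℕ} {q : ℂˣ} (hq : (q : ℂ) + (q : ℂ)⁻¹ ≠ 0) {N : ℕ}

include hq

/-- `g` acts by `q` and `S` by `-q⁻¹`, so the wedge is killed by `q + q⁻¹`. -/
theorem cls_eq_zero_of_eq {i j : Fin N} (h : (i : ℕ) + 1 = j) {m : Fin N → ℤ} {e : Fin N → Fin n}
    (hm : m i = m j) (he : e i = e j) : cls n q N (mono m ⊗ₜ vec e) = 0 := by
  have h1 := cls_gOp hq h (mono m) (vec e)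
  rw [gOp_mono_of_eq q m hm, SOp_vec q (ne_of_succ h), if_pos he, TensorProduct.tmul_smul,
    ← TensorProduct.smul_tmul', map_smul, map_smul, ← sub_eq_zero, ← sub_smul,
    sub_neg_eq_add] at h1
  exact (smul_eq_zero.mp h1).resolve_left hq

theorem cls_swap_of_lt {i j : Fin N} (h : (i : ℕ) + 1 = j) {m : Fin N → ℤ} {e : Fin N → Fin n}
    (hm : m i = m j) (he : e i < e j) : cls n q N (mono m ⊗ₜ vec e) =
      -((q : ℂ) • cls n q N (mono m ⊗ₜ vec (e ∘ Equiv.swap i j))) := by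
  have h1 := cls_gOp hq h (mono m) (vec (e ∘ Equiv.swap i j))
  have hs : (e ∘ Equiv.swap i j) ∘ Equiv.swap i j = e := by funext x; simp
  rw [gOp_mono_of_eq q m hm, SOp_vec q (ne_of_succ h), hs] at h1
  simp only [Function.comp_apply, Equiv.swap_apply_left, Equiv.swap_apply_right, if_neg he.ne',
    if_neg he.not_gt, zero_sub, TensorProduct.tmul_neg, map_neg, ← TensorProduct.smul_tmul',
    map_smul] at h1
  rw [h1, neg_neg]

/-- Apply the relation `g = S` to the swapped monomial, which has an ascent: `z^m` occurs there with
coefficient `q⁻¹`, and can be solved for. The swapped monomial reappears with the spin `S v`, so it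
is needed for all spins. -/
theorem cls_mem_of_descent {i j : Fin N} (h : (i : ℕ) + 1 = j) {m : Fin N → ℤ} (hm : m j < m i)
    {W : Submodule ℂ (Wedge n q N)} (v : Spin n N)
    (h1 : ∀ v, cls n q N (mono (m ∘ Equiv.swap i j) ⊗ₜ v) ∈ W)
    (h2 : ∀ k : ℤ, 0 < k → k < m i - m j → cls n q N (mono (squeeze m j i k) ⊗ₜ v) ∈ W) :
    cls n q N (mono m ⊗ₜ v) ∈ W := by
  have hij := ne_of_succ h
  have hr := cls_gOp hq h (mono (m ∘ Equiv.swap i j)) v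
  have hs : (m ∘ Equiv.swap i j) ∘ Equiv.swap i j = m := by funext x; simp
  rw [gOp_mono_of_lt q _ (by simpa using hm), hs, TensorProduct.add_tmul, map_add,
    ← TensorProduct.smul_tmul', ← TensorProduct.smul_tmul', map_smul, map_smul,
    TensorProduct.sum_tmul, map_sum] at hr
  have h3 : (q : ℂ)⁻¹ • cls n q N (mono m ⊗ₜ v) ∈ W := by
    rw [eq_sub_of_add_eq hr]
    refine W.sub_mem (h1 _) (W.smul_mem _ (Submodule.sum_mem _ fun k hk => ?_))
    rw [squeeze_comm m hij]
    simp only [Finset.mem_range, Function.comp_apply, Equiv.swap_apply_left,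
      Equiv.swap_apply_right] at hk
    exact h2 _ (by omega) (by omega)
  have := W.smul_mem (q : ℂ) h3
  rwa [smul_smul, mul_inv_cancel₀ q.ne_zero, one_smul] at this

/-- Nested induction. Squeezing lowers the energy; at fixed energy, removing a descent lowers `N²
energy - moment`; once the exponents are non-decreasing, sorting the spins inside blocks of equal
exponents lowers the moment of the spins. Only swaps and squeezes of exponents occur, so `P`
survives. -/
theorem cls_mem_wedgeSpan {P : (Fin N → ℤ) → Prop} (hP : Squeezable P) (m : Fin N → ℤ)
    (hm : P m) (v : Spin n N) : cls n q N (mono m ⊗ₜ v) ∈ wedgeSpan n q P := by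
  obtain ⟨E, hE⟩ : ∃ E : ℕ, energy m = E := ⟨_, (Int.toNat_of_nonneg (energy_nonneg m)).symm⟩
  induction E using Nat.strong_induction_on generalizing m v with
  | _ E ihE =>
    obtain ⟨A, hA⟩ : ∃ A : ℕ, (N : ℤ) * (N * energy m) - moment m = A :=
      ⟨_, (Int.toNat_of_nonneg (sub_nonneg.mpr (moment_le m))).symm⟩
    induction A using Nat.strong_induction_on generalizing m v with
    | _ A ihA =>
      by_cases hmono : ∀ i j : Fin N, (i : ℕ) + 1 = j → m i ≤ m j
      · suffices H : ∀ e, cls n q N (mono m ⊗ₜ vec e) ∈ wedgeSpan n q P from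
          mem_of_vec (K := (wedgeSpan n q P).comap
            (cls n q N ∘ₗ TensorProduct.mk ℂ (Laurent N) (Spin n N) (mono m))) H v
        intro e
        obtain ⟨B, hB⟩ : ∃ B : ℕ, moment (fun i => ((e i : ℕ) : ℤ)) = B :=
          ⟨_, (Int.toNat_of_nonneg (Finset.sum_nonneg fun _ _ => by positivity)).symm⟩
        induction B using Nat.strong_induction_on generalizing e with
        | _ B ihB =>
          by_cases hs : ∀ i j : Fin N, (i : ℕ) + 1 = j → m i < m j ∨ (m i = m j ∧ e j < e i)
          · exact Submodule.subset_span
              ⟨m, e, normallyOrdered_iff.mpr (sorted_of_adjacent hs), hm, rfl⟩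
          · push Not at hs
            obtain ⟨i, j, hij, h1, h2⟩ := hs
            have hmij : m i = m j := le_antisymm (hmono i j hij) h1
            rcases (h2 hmij).lt_or_eq with he | he
            · rw [cls_swap_of_lt hq hij hmij he]
              refine Submodule.neg_mem _ (Submodule.smul_mem _ _ ?_)
              have hmom := moment_comp_swap (fun i => ((e i : ℕ) : ℤ)) hij
              have he' : (e i : ℕ) < e j := he
              obtain ⟨B', hB'⟩ : ∃ B' : ℕ,
                  moment (fun k => (((e ∘ Equiv.swap i j) k : ℕ) : ℤ)) = B' :=
                ⟨_, (Int.toNat_of_nonneg (Finset.sum_nonneg fun _ _ => by positivity)).symm⟩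
              refine ihB B' ?_ _ hB'
              change moment (fun k => (((e ∘ Equiv.swap i j) k : ℕ) : ℤ)) = _ at hmom
              omega
            · rw [cls_eq_zero_of_eq hq hij hmij he]
              exact Submodule.zero_mem _
      · push Not at hmono
        obtain ⟨i, j, hij, hlt⟩ := hmono
        refine cls_mem_of_descent hq hij hlt v (fun v => ?_) (fun k hk hk' => ?_)
        · have hen := energy_comp_swap m i j
          have hmom := moment_comp_swap m hij
          have hle := moment_le (m ∘ Equiv.swap i j)
          obtain ⟨A', hA'⟩ : ∃ A' : ℕ, (N : ℤ) * (N * energy (m ∘ Equiv.swap i j)) -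
              moment (m ∘ Equiv.swap i j) = A' :=
            ⟨_, (Int.toNat_of_nonneg (sub_nonneg.mpr hle)).symm⟩
          refine ihA A' ?_ _ (hP.swap _ _ _ hm) v (hen.trans hE) hA'
          rw [hen] at hA'
          omega
        · have hen := energy_squeeze m (ne_of_succ hij).symm hk hk'
          obtain ⟨E', hE'⟩ : ∃ E' : ℕ, energy (squeeze m j i k) = E' :=
            ⟨_, (Int.toNat_of_nonneg (energy_nonneg _)).symm⟩
          exact ihE E' (by omega) _ (hP.squeeze _ _ _ _ (ne_of_succ hij).symm hm hk hk') v hE'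

end Straightening

/-! ### The antisymmetrizer of a pair of commuting Hecke algebra actions -/

section Antisymmetrizer

variable {R : Type*} [Ring R] (a b : ℕ → R)

/-- The sum of `T_w ⊗ T_w` over the minimal representatives `w` of the right cosets of `S_k` in
`S_{k+1}`. -/
def cosetSum : ℕ → R
  | 0 => 1
  | k + 1 => 1 + a k * b k * cosetSum k

/-- The sum of `T_w ⊗ T_w` over `w ∈ S_{k+1}`. -/
def antisym : ℕ → R
  | 0 => 1
  | k + 1 => antisym k * cosetSum a b (k + 1)

variable (K : ℕ)
  (hab : ∀ i < K, ∀ j < K, Commute (a i) (b j))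
  (ha3 : ∀ i, i + 1 < K → a i * a (i + 1) * a i = a (i + 1) * a i * a (i + 1))
  (hb3 : ∀ i, i + 1 < K → b i * b (i + 1) * b i = b (i + 1) * b i * b (i + 1))
  (haa : ∀ i j, j < K → i + 2 ≤ j → Commute (a i) (a j))
  (hbb : ∀ i j, j < K → i + 2 ≤ j → Commute (b i) (b j))

include hab haa hbb in
theorem far_comm {i j : ℕ} (hj : j < K) (h : i + 2 ≤ j) :
    Commute (a i * b i) (a j - b j) ∧ Commute (a j * b j) (a i - b i) := by
  have hi : i < K := by omega
  have h1 := haa i j hj h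
  have h2 := hbb i j hj h
  exact ⟨((h1.sub_right (hab i hi j hj)).mul_left (((hab j hj i hi).symm).sub_right h2)),
    ((h1.symm.sub_right (hab j hj i hi)).mul_left (((hab i hi j hj).symm).sub_right h2.symm))⟩

include hab haa hbb in
theorem cosetSum_comm {k j : ℕ} (hj : j < K) (h : k + 1 ≤ j) :
    Commute (cosetSum a b k) (a j - b j) := by
  induction k with
  | zero => exact Commute.one_left _
  | succ k ih =>
    exact (Commute.one_left _).add_left
      ((far_comm a b K hab haa hbb hj (by omega)).1.mul_left (ih (by omega)))

include hab ha3 hb3 in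
-- The braid relations say that moving past `T_{k+1} T_k`, where `T = a b`, turns the generators
-- with index `k + 1` into those with index `k`, for both actions at once.
theorem braid_sub {k : ℕ} (hk : k + 1 < K) :
    a (k + 1) * b (k + 1) * (a k * b k) * (a (k + 1) - b (k + 1)) =
      (a k - b k) * (a (k + 1) * b (k + 1) * (a k * b k)) := by
  have h1 := (hab k (by omega) (k + 1) hk).eq
  have h2 := (hab (k + 1) hk k (by omega)).eq
  have h3 := (hab k (by omega) k (by omega)).eq
  have h4 := (hab (k + 1) hk (k + 1) hk).eq
  have c1 : a (k + 1) * b (k + 1) * (a k * b k) = a (k + 1) * a k * (b (k + 1) * b k) := by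
    rw [mul_assoc, ← mul_assoc (b (k + 1)), ← h1]; simp only [mul_assoc]
  have c2 : b (k + 1) * b k * a (k + 1) = a (k + 1) * (b (k + 1) * b k) := by
    rw [mul_assoc, ← h2, ← mul_assoc, ← h4, mul_assoc]
  have c3 : b k * (a (k + 1) * a k) = a (k + 1) * a k * b k := by
    rw [← mul_assoc, ← h2, mul_assoc, ← h3, mul_assoc]
  rw [c1, mul_sub, sub_mul]
  congr 1
  · calc a (k + 1) * a k * (b (k + 1) * b k) * a (k + 1)
        = a (k + 1) * a k * (b (k + 1) * b k * a (k + 1)) := by simp only [mul_assoc]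
      _ = a (k + 1) * a k * a (k + 1) * (b (k + 1) * b k) := by rw [c2]; simp only [mul_assoc]
      _ = _ := by rw [← ha3 k hk]; simp only [mul_assoc]
  · calc a (k + 1) * a k * (b (k + 1) * b k) * b (k + 1)
        = a (k + 1) * a k * (b k * b (k + 1) * b k) := by rw [hb3 k hk]; simp only [mul_assoc]
      _ = a (k + 1) * a k * b k * (b (k + 1) * b k) := by simp only [mul_assoc]
      _ = _ := by rw [← c3]; simp only [mul_assoc]

variable [Algebra ℂ R] (c : ℂ)
  (ha : ∀ i < K, a i * a i = c • a i + 1) (hb : ∀ i < K, b i * b i = c • b i + 1)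

include ha hb hab in
-- Since `a` and `b` commute and share the quadratic relation, `a b (a - b) = b a² - a b² = b - a`.
theorem one_add_mul_sub {i : ℕ} (hi : i < K) : (1 + a i * b i) * (a i - b i) = 0 := by
  have h := (hab i hi i hi).eq
  have e : (1 + a i * b i) * (a i - b i) =
      a i - b i + (b i * (a i * a i) - a i * (b i * b i)) + (a i * b i - b i * a i) * a i := by
    noncomm_ring
  rw [e, ha i hi, hb i hi, h]
  simp only [mul_add, mul_smul_comm, mul_one, h]
  noncomm_ring

include ha hb hab ha3 hb3 haa hbb

/-- The left factor `x` plays the antisymmetrizer of the previous stage. It is kept general because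
the induction replaces it by `x T_k`. -/
theorem mul_cosetSum_mul_sub (k : ℕ) (hk : k ≤ K) (x : R)
    (hx : ∀ j, j + 1 < k → x * (a j - b j) = 0) (i : ℕ) (hi : i < k) :
    x * cosetSum a b k * (a i - b i) = 0 := by
  induction k generalizing x i with
  | zero => omega
  | succ k ih =>
    rcases Nat.lt_succ_iff_lt_or_eq.mp hi with hik | rfl
    · have h1 := ih (by omega) (x * (a k * b k)) (fun j hj => by
        rw [mul_assoc, (far_comm a b K hab haa hbb (by omega) (by omega)).2.eq, ← mul_assoc,
          hx j (by omega), zero_mul]) i hik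
      rw [cosetSum, mul_add, add_mul, mul_one, hx i (by omega), zero_add, ← mul_assoc x]
      exact h1
    · cases i with
      | zero =>
        rw [cosetSum, cosetSum, mul_one, mul_assoc,
          one_add_mul_sub a b K hab c ha hb (by omega), mul_zero]
      | succ k =>
        have h1 := one_add_mul_sub a b K hab c ha hb (i := k + 1) (by omega)
        have h2 := braid_sub a b K hab ha3 hb3 (k := k) (by omega)
        have h3 := (cosetSum_comm a b K hab haa hbb (k := k) (j := k + 1) (by omega) le_rfl).eq
        -- Split off `1 + T_{k+1}`, which kills the difference. In the remaining `T_{k+1} T_k` times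
        -- a shorter sum, the difference passes through the shorter sum and emerges on the left with
        -- index `k`, where `x` kills it.
        have e : cosetSum a b (k + 1 + 1) * (a (k + 1) - b (k + 1)) =
            (a k - b k) * (a (k + 1) * b (k + 1) * (a k * b k)) * cosetSum a b k := by
          rw [← h2, mul_assoc _ _ (cosetSum a b k), ← h3, cosetSum, cosetSum, mul_add, mul_one,
            ← add_assoc, add_mul, h1, zero_add]
          simp only [mul_assoc]
        rw [mul_assoc, e, mul_assoc (a k - b k), ← mul_assoc x, hx k (by omega), zero_mul]

theorem antisym_mul_sub (k : ℕ) (hk : k ≤ K) (i : ℕ) (hi : i < k) :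
    antisym a b k * (a i - b i) = 0 := by
  induction k generalizing i with
  | zero => omega
  | succ k ih =>
    exact mul_cosetSum_mul_sub a b K hab ha3 hb3 haa hbb c ha hb (k + 1) hk _
      (fun j hj => ih (by omega) j (by omega)) i hi

end Antisymmetrizer

/-! ### The antisymmetrizer on `⊗^N V(z)` -/

/-- `g_{i,i+1}` on `⊗^N V(z)`, sites being numbered by natural numbers. -/
def gSite (n : ℕ) (q : ℂˣ) (N i : ℕ) : Module.End ℂ (Tens n N) :=
  if h : i + 1 < N then (gOp q ⟨i, by omega⟩ ⟨i + 1, h⟩).rTensor (Spin n N) else 1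

/-- `S_{i,i+1}` on `⊗^N V(z)`, sites being numbered by natural numbers. -/
def sSite (n : ℕ) (q : ℂˣ) (N i : ℕ) : Module.End ℂ (Tens n N) :=
  if h : i + 1 < N then (SOp q n ⟨i, by omega⟩ ⟨i + 1, h⟩).lTensor (Laurent N) else 1

theorem gSite_comm_sSite (n : ℕ) (q : ℂˣ) (N i j : ℕ) : Commute (gSite n q N i) (sSite n q N j) := by
  rw [gSite, sSite]
  split_ifs
  · change _ ∘ₗ _ = _ ∘ₗ _
    rw [LinearMap.rTensor_comp_lTensor, LinearMap.lTensor_comp_rTensor]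
  · exact Commute.one_right _
  · exact Commute.one_left _
  · exact Commute.one_left _

theorem gSite_braid (n : ℕ) (q : ℂˣ) {N i : ℕ} (hi : i + 2 < N) :
    gSite n q N i * gSite n q N (i + 1) * gSite n q N i =
      gSite n q N (i + 1) * gSite n q N i * gSite n q N (i + 1) := by
  have h : i + 1 < N := by omega
  have h' : i + 1 + 1 < N := by omega
  apply TensorProduct.ext'
  intro f v
  simp only [gSite, dif_pos h, dif_pos h', Module.End.mul_apply, LinearMap.rTensor_tmul]
  rw [gOp_braid q (by simp) (by simp) (by simp; omega) f]

theorem gSite_comm (n : ℕ) (q : ℂˣ) {N i j : ℕ} (hj : j + 1 < N) (hij : i + 2 ≤ j) :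
    Commute (gSite n q N i) (gSite n q N j) := by
  have h : i + 1 < N := by omega
  apply TensorProduct.ext'
  intro f v
  simp only [gSite, dif_pos h, dif_pos hj, Module.End.mul_apply, LinearMap.rTensor_tmul]
  rw [gOp_comm q (i := ⟨i, _⟩) (j := ⟨i + 1, _⟩) (by simp; omega) (by simp; omega) (by simp; omega)
    (by simp; omega) f]

theorem sSite_braid (n : ℕ) (q : ℂˣ) {N i : ℕ} (hi : i + 2 < N) :
    sSite n q N i * sSite n q N (i + 1) * sSite n q N i =
      sSite n q N (i + 1) * sSite n q N i * sSite n q N (i + 1) := by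
  have h : i + 1 < N := by omega
  have h' : i + 1 + 1 < N := by omega
  apply TensorProduct.ext'
  intro f v
  simp only [sSite, dif_pos h, dif_pos h', Module.End.mul_apply, LinearMap.lTensor_tmul]
  have := LinearMap.congr_fun (SOp_braid q n (i := (⟨i, by omega⟩ : Fin N)) (j := ⟨i + 1, h⟩)
    (k := ⟨i + 1 + 1, h'⟩) (by simp) (by simp) (by simp; omega)) v
  simp only [Module.End.mul_apply] at this
  rw [this]

theorem sSite_comm (n : ℕ) (q : ℂˣ) {N i j : ℕ} (hj : j + 1 < N) (hij : i + 2 ≤ j) :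
    Commute (sSite n q N i) (sSite n q N j) := by
  have h : i + 1 < N := by omega
  apply TensorProduct.ext'
  intro f v
  simp only [sSite, dif_pos h, dif_pos hj, Module.End.mul_apply, LinearMap.lTensor_tmul]
  have := LinearMap.congr_fun (SOp_comm q n (i := (⟨i, by omega⟩ : Fin N)) (j := ⟨i + 1, h⟩)
    (k := ⟨j, by omega⟩) (l := ⟨j + 1, hj⟩) (by simp; omega) (by simp; omega) (by simp; omega)
    (by simp; omega)).eq v
  simp only [Module.End.mul_apply] at this
  rw [this]

theorem gSite_quadratic (n : ℕ) (q : ℂˣ) {N i : ℕ} (h : i + 1 < N) :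
    gSite n q N i * gSite n q N i = ((q : ℂ) - (q : ℂ)⁻¹) • gSite n q N i + 1 := by
  apply TensorProduct.ext'
  intro f v
  have := LinearMap.congr_fun (gOp_quadratic q (⟨i, by omega⟩ : Fin N) ⟨i + 1, h⟩) f
  simp only [Module.End.mul_apply, LinearMap.add_apply, LinearMap.smul_apply,
    Module.End.one_apply] at this
  simp only [gSite, dif_pos h, Module.End.mul_apply, LinearMap.rTensor_tmul, LinearMap.add_apply,
    LinearMap.smul_apply, Module.End.one_apply, this, TensorProduct.add_tmul,
    TensorProduct.smul_tmul']

theorem sSite_quadratic (n : ℕ) (q : ℂˣ) {N i : ℕ} (h : i + 1 < N) :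
    sSite n q N i * sSite n q N i = ((q : ℂ) - (q : ℂ)⁻¹) • sSite n q N i + 1 := by
  apply TensorProduct.ext'
  intro f v
  have := LinearMap.congr_fun
    (SOp_quadratic q n (i := (⟨i, by omega⟩ : Fin N)) (j := ⟨i + 1, h⟩) (by simp)) v
  simp only [Module.End.mul_apply, LinearMap.add_apply, LinearMap.smul_apply,
    Module.End.one_apply] at this
  simp only [sSite, dif_pos h, Module.End.mul_apply, LinearMap.lTensor_tmul, LinearMap.add_apply,
    LinearMap.smul_apply, Module.End.one_apply, this, TensorProduct.tmul_add,
    TensorProduct.tmul_smul]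

theorem antisym_mul_gSite_sub (n : ℕ) (q : ℂˣ) (N i : ℕ) (hi : i < N - 1) :
    antisym (gSite n q N) (sSite n q N) (N - 1) * (gSite n q N i - sSite n q N i) = 0 :=
  antisym_mul_sub (gSite n q N) (sSite n q N) (N - 1)
    (fun i _ j _ => gSite_comm_sSite n q N i j) (fun i hi => gSite_braid n q (by omega))
    (fun i hi => sSite_braid n q (by omega)) (fun i j hj hij => gSite_comm n q (by omega) hij)
    (fun i j hj hij => sSite_comm n q (by omega) hij) ((q : ℂ) - (q : ℂ)⁻¹)
    (fun i hi => gSite_quadratic n q (by omega)) (fun i hi => sSite_quadratic n q (by omega))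
    (N - 1) le_rfl i hi

/-- The antisymmetrizer on `⊗^N V(z)`. -/
abbrev asym (n : ℕ) (q : ℂˣ) (N : ℕ) : Module.End ℂ (Tens n N) :=
  antisym (gSite n q N) (sSite n q N) (N - 1)

/-- The antisymmetrizer thus factors through the wedge product and can detect linear independence
there. -/
theorem Omega_le_ker_asym {n : ℕ} {q : ℂˣ} (hq : (q : ℂ) + (q : ℂ)⁻¹ ≠ 0) (N : ℕ) :
    Omega n q N ≤ LinearMap.ker (asym n q N) := by
  refine Omega_le_of hq fun i j h f v => ?_
  have hi : (i : ℕ) + 1 < N := by omega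
  have h1 := LinearMap.congr_fun (antisym_mul_gSite_sub n q N i (by omega)) (f ⊗ₜ v)
  obtain rfl : j = ⟨i + 1, hi⟩ := Fin.ext h.symm
  rw [LinearMap.mem_ker]
  simpa [gSite, sSite, hi] using h1

/-! ### Triangularity of the antisymmetrizer -/

/-- The span of the vectors `z^m ⊗ v_ε` with `R m ε`. -/
def pairSpan {n N : ℕ} (R : (Fin N → ℤ) → (Fin N → Fin n) → Prop) : Submodule ℂ (Tens n N) :=
  Submodule.span ℂ {x | ∃ m e, R m e ∧ x = mono m ⊗ₜ vec e}

theorem pair_mem {n N : ℕ} {R : (Fin N → ℤ) → (Fin N → Fin n) → Prop} {m : Fin N → ℤ}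
    {e : Fin N → Fin n} (h : R m e) : mono m ⊗ₜ vec e ∈ pairSpan R :=
  Submodule.subset_span ⟨m, e, h, rfl⟩

theorem pairSpan_le {n N : ℕ} {R : (Fin N → ℤ) → (Fin N → Fin n) → Prop}
    {K : Submodule ℂ (Tens n N)} (h : ∀ m e, R m e → mono m ⊗ₜ vec e ∈ K) : pairSpan R ≤ K := by
  rw [pairSpan, Submodule.span_le]
  rintro _ ⟨m, e, hm, rfl⟩
  exact h m e hm

theorem pairSpan_mono {n N : ℕ} {R R' : (Fin N → ℤ) → (Fin N → Fin n) → Prop}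
    (h : ∀ m e, R m e → R' m e) : pairSpan R ≤ pairSpan R' :=
  pairSpan_le fun m e hm => pair_mem (h m e hm)

theorem tmul_mem_pairSpan {n N : ℕ} {P : (Fin N → ℤ) → Prop} {f : Laurent N}
    (hf : f ∈ monoSpan P) (v : Spin n N) : f ⊗ₜ v ∈ pairSpan (fun m (_ : Fin N → Fin n) => P m) := by
  refine monoSpan_le (K := (pairSpan (fun m (_ : Fin N → Fin n) => P m)).comap
    ((TensorProduct.mk ℂ (Laurent N) (Spin n N)).flip v)) (fun m hm => ?_) hf
  exact mem_of_vec (K := (pairSpan (fun m (_ : Fin N → Fin n) => P m)).comap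
    (TensorProduct.mk ℂ (Laurent N) (Spin n N) (mono m))) (fun e => pair_mem hm) v

theorem gOp_mono_mem (q : ℂˣ) {N : ℕ} {P : (Fin N → ℤ) → Prop} {i j : Fin N} {m : Fin N → ℤ}
    (hs : P (m ∘ Equiv.swap i j)) (hm : m j ≤ m i → P m)
    (h1 : ∀ k : ℤ, 0 < k → k < m j - m i → P (squeeze m i j k))
    (h2 : ∀ k : ℤ, 0 < k → k < m i - m j → P (squeeze m j i k)) :
    gOp q i j (mono m) ∈ monoSpan P := by
  rcases lt_trichotomy (m i) (m j) with h | h | h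
  · rw [gOp_mono_of_lt q m h]
    refine Submodule.add_mem _ (Submodule.smul_mem _ _ (mono_mem hs))
      (Submodule.smul_mem _ _ (Submodule.sum_mem _ fun k hk => mono_mem (h1 _ ?_ ?_))) <;>
    rw [Finset.mem_range] at hk <;> omega
  · rw [gOp_mono_of_eq q m h]
    exact Submodule.smul_mem _ _ (mono_mem (hm h.ge))
  · rw [gOp_mono_of_gt q m h]
    refine Submodule.add_mem _ (Submodule.add_mem _
      (Submodule.smul_mem _ _ (mono_mem hs)) (Submodule.smul_mem _ _ (mono_mem (hm h.le))))
      (Submodule.smul_mem _ _ (Submodule.sum_mem _ fun k hk => mono_mem (h2 _ ?_ ?_))) <;>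
    rw [Finset.mem_range] at hk <;> omega

section Triangularity

variable {n : ℕ} (q : ℂˣ) {N : ℕ}

theorem site_apply {i j : Fin N} (h : (i : ℕ) + 1 = j) (f : Laurent N) (v : Spin n N) :
    (gSite n q N i * sSite n q N i) (f ⊗ₜ v) = gOp q i j f ⊗ₜ SOp q n i j v := by
  have hi : (i : ℕ) + 1 < N := by omega
  obtain rfl : j = ⟨i + 1, hi⟩ := Fin.ext h.symm
  simp [gSite, sSite, hi]

theorem site_mem {P : (Fin N → ℤ) → Prop} {i j : Fin N} (h : (i : ℕ) + 1 = j)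
    (hs : ∀ m, P m → P (m ∘ Equiv.swap i j))
    (h1 : ∀ m, P m → ∀ k : ℤ, 0 < k → k < m j - m i → P (squeeze m i j k))
    (h2 : ∀ m, P m → ∀ k : ℤ, 0 < k → k < m i - m j → P (squeeze m j i k)) :
    pairSpan (fun m (_ : Fin N → Fin n) => P m) ≤
      (pairSpan (fun m (_ : Fin N → Fin n) => P m)).comap (gSite n q N i * sSite n q N i) := by
  refine pairSpan_le fun m e hm => ?_
  rw [Submodule.mem_comap, site_apply q h]
  exact tmul_mem_pairSpan (gOp_mono_mem q (hs m hm) (fun _ => hm) (h1 m hm) (h2 m hm)) _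

/-- For an ascent `z^m` is absent from `g z^m`, so nothing diagonal survives. -/
theorem site_of_lt {i j : Fin N} (h : (i : ℕ) + 1 = j) {m : Fin N → ℤ} (hm : m i < m j)
    (e : Fin N → Fin n) : (gSite n q N i * sSite n q N i) (mono m ⊗ₜ vec e) ∈
      pairSpan (fun m' (_ : Fin N → Fin n) => m' = m ∘ Equiv.swap i j ∨ energy m' < energy m) := by
  rw [site_apply q h]
  refine tmul_mem_pairSpan (P := fun m' => m' = m ∘ Equiv.swap i j ∨ energy m' < energy m)
    (gOp_mono_mem q (Or.inl rfl) (fun h' => by omega)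
      (fun k hk hk' => Or.inr (energy_squeeze m (ne_of_succ h) hk hk')) (fun k hk hk' => by omega)) _

theorem site_of_eq {i j : Fin N} (h : (i : ℕ) + 1 = j) {m : Fin N → ℤ} (hm : m i = m j)
    {e : Fin N → Fin n} (he : e j < e i) : (gSite n q N i * sSite n q N i) (mono m ⊗ₜ vec e) =
      -((q : ℂ) • mono m ⊗ₜ[ℂ] vec (e ∘ Equiv.swap i j)) := by
  rw [site_apply q h, gOp_mono_of_eq q m hm, SOp_vec q (ne_of_succ h), if_neg he.ne',
    if_neg he.not_gt, zero_sub, TensorProduct.tmul_neg, TensorProduct.smul_tmul']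

theorem site_energy_mem {i j : Fin N} (h : (i : ℕ) + 1 = j) (E : ℤ) :
    pairSpan (fun m (_ : Fin N → Fin n) => energy m < E) ≤
      (pairSpan (fun m (_ : Fin N → Fin n) => energy m < E)).comap
        (gSite n q N i * sSite n q N i) := by
  refine site_mem q h (fun m hm => ?_) (fun m hm k hk hk' => ?_) (fun m hm k hk hk' => ?_)
  · rwa [energy_comp_swap]
  · exact (energy_squeeze m (ne_of_succ h) hk hk').trans hm
  · exact (energy_squeeze m (ne_of_succ h).symm hk hk').trans hm

theorem cosetSum_mem {W : Submodule ℂ (Tens n N)} {k : ℕ}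
    (hW : ∀ i j : Fin N, (i : ℕ) + 1 = j → (j : ℕ) ≤ k →
      W ≤ W.comap (gSite n q N i * sSite n q N i)) (hk : k < N) :
    W ≤ W.comap (cosetSum (gSite n q N) (sSite n q N) k) := by
  induction k with
  | zero => exact fun x hx => hx
  | succ k ih =>
    intro x hx
    refine W.add_mem hx ?_
    exact hW ⟨k, by omega⟩ ⟨k + 1, hk⟩ rfl le_rfl
      (ih (fun i j h hj => hW i j h (by omega)) (by omega) hx)

theorem antisym_mem {W : Submodule ℂ (Tens n N)} {k : ℕ}
    (hW : ∀ i j : Fin N, (i : ℕ) + 1 = j → (j : ℕ) ≤ k →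
      W ≤ W.comap (gSite n q N i * sSite n q N i)) (hk : k < N) :
    W ≤ W.comap (antisym (gSite n q N) (sSite n q N) k) := by
  induction k with
  | zero => exact fun x hx => hx
  | succ k ih =>
    intro x hx
    exact ih (fun i j h hj => hW i j h (by omega)) (by omega) (cosetSum_mem q hW hk hx)

/-- The labels at the sites up to `k` are sorted. -/
def SortedTo (k : ℕ) (m : Fin N → ℤ) (e : Fin N → Fin n) : Prop :=
  ∀ x y : Fin N, x < y → (y : ℕ) ≤ k → m x < m y ∨ (m x = m y ∧ e y < e x)

theorem SortedTo.mono_index {k : ℕ} {m : Fin N → ℤ} {e : Fin N → Fin n} (h : SortedTo (k + 1) m e) :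
    SortedTo k m e := fun x y hxy hy => h x y hxy (by omega)

/-- The labels that occur in `cosetSum k` applied to `z^m ⊗ v_ε`, for `(m, ε)` sorted up to the
site `j`, where `i`, `j` are the sites `k`, `k + 1`. -/
def CosetLabel (m : Fin N → ℤ) (e : Fin N → Fin n) (i j : Fin N) (m' : Fin N → ℤ)
    (e' : Fin N → Fin n) : Prop :=
  energy m' < energy m ∨ (energy m' ≤ energy m ∧ m' i < m' j ∧ ∀ x, i < x → m' x = m x) ∨
    (m' = m ∧ m i = m j ∧ e j < e' i ∧ (∀ x, i < x → e' x = e x) ∧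
      SortedTo i m (e' ∘ Equiv.swap i j))

theorem cosetLabel_self {m : Fin N → ℤ} {e : Fin N → Fin n} {i j : Fin N} (h : (i : ℕ) + 1 = j)
    (hs : SortedTo j m e) : CosetLabel m e i j m e := by
  have hij : i < j := by rw [Fin.lt_def]; omega
  rcases hs i j hij le_rfl with h1 | ⟨h1, h2⟩
  · exact Or.inr (Or.inl ⟨le_rfl, h1, fun _ _ => rfl⟩)
  · refine Or.inr (Or.inr ⟨rfl, h1, h2, fun _ _ => rfl, ?_⟩)
    intro x y hxy hy
    have hx : x < i := by rw [Fin.lt_def] at *; omega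
    have e1 : (e ∘ Equiv.swap i j) x = e x := by
      simp [Equiv.swap_apply_of_ne_of_ne hx.ne (hx.trans hij).ne]
    rw [e1]
    rcases (Fin.le_def.mpr hy : y ≤ i).lt_or_eq with hy' | rfl
    · have e2 : (e ∘ Equiv.swap i j) y = e y := by
        simp [Equiv.swap_apply_of_ne_of_ne hy'.ne (hy'.trans hij).ne]
      rw [e2]
      exact hs x y hxy (hy.trans (by omega))
    · have := hs x j (hx.trans hij) le_rfl
      simpa [h1] using this

/-- Up to lower energy, the label at `i` is still below the untouched label at `j`, so the next
factor swaps them with no diagonal term; sortedness up to `k` then places the label moved to `j`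
below the one at `k`. Sortedness of the spins is tracked only while all exponents are those of `m`.
-/
theorem site_cosetLabel {m : Fin N → ℤ} {e : Fin N → Fin n} {i j k : Fin N}
    (h : (i : ℕ) + 1 = j) (h' : (j : ℕ) + 1 = k) (hs : SortedTo k m e) :
    pairSpan (CosetLabel m e i j) ≤
      (pairSpan (CosetLabel m e j k)).comap (gSite n q N i * sSite n q N i) := by
  have hij : i < j := by rw [Fin.lt_def]; omega
  have hjk : j < k := by rw [Fin.lt_def]; omega
  refine pairSpan_le fun m' e' hm => ?_
  rw [Submodule.mem_comap]
  rcases hm with hm | ⟨h1, h2, h3⟩ | ⟨rfl, h1, h2, h3, h4⟩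
  · exact pairSpan_mono (fun _ _ hx => Or.inl hx) (site_energy_mem q h (energy m) (pair_mem hm))
  · refine pairSpan_mono (fun m'' e'' hx => ?_) (site_of_lt q h h2 e')
    rcases hx with rfl | hx
    · refine Or.inr (Or.inl ⟨by rwa [energy_comp_swap], ?_, ?_⟩)
      · have e1 : (m' ∘ Equiv.swap i j) k = m' k := by
          simp [Equiv.swap_apply_of_ne_of_ne (hij.trans hjk).ne' hjk.ne']
        rw [e1, h3 k (hij.trans hjk)]
        have h5 : m j ≤ m k := by
          rcases hs j k hjk le_rfl with h6 | h6
          exacts [h6.le, h6.1.le]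
        rw [h3 j hij] at h2
        simpa using h2.trans_le h5
      · intro x hx
        have e1 : (m' ∘ Equiv.swap i j) x = m' x := by
          simp [Equiv.swap_apply_of_ne_of_ne (hij.trans hx).ne' hx.ne']
        rw [e1, h3 x (hij.trans hx)]
    · exact Or.inl (hx.trans_le h1)
  · rw [site_of_eq q h h1 (by rwa [h3 j hij])]
    refine Submodule.neg_mem _ (Submodule.smul_mem _ _ (pair_mem ?_))
    rcases hs j k hjk le_rfl with h5 | ⟨h5, h6⟩
    · exact Or.inr (Or.inl ⟨le_rfl, h5, fun _ _ => rfl⟩)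
    · refine Or.inr (Or.inr ⟨rfl, h5, ?_, ?_, ?_⟩)
      · simpa using h6.trans h2
      · intro x hx
        have e1 : (e' ∘ Equiv.swap i j) x = e' x := by
          simp [Equiv.swap_apply_of_ne_of_ne (hij.trans hx).ne' hx.ne']
        rw [e1, h3 x (hij.trans hx)]
      · intro x y hxy hy
        have hxj : x < j := by rw [Fin.lt_def] at *; omega
        have e1 : ∀ x, x < j → ((e' ∘ Equiv.swap i j) ∘ Equiv.swap j k) x =
            (e' ∘ Equiv.swap i j) x := by
          intro x hx
          rw [Function.comp_apply, Equiv.swap_apply_of_ne_of_ne hx.ne (hx.trans hjk).ne]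
        have e2 : ((e' ∘ Equiv.swap i j) ∘ Equiv.swap j k) j = e k := by
          rw [Function.comp_apply, Equiv.swap_apply_left, Function.comp_apply,
            Equiv.swap_apply_of_ne_of_ne (hij.trans hjk).ne' hjk.ne', h3 k (hij.trans hjk)]
        have e3 : (e' ∘ Equiv.swap i j) i = e j := by simp [h3 j hij]
        rw [e1 x hxj]
        rcases (Fin.le_def.mpr hy : y ≤ j).lt_or_eq with hy' | rfl
        · rw [e1 y hy']
          exact h4 x y hxy (by rw [Fin.lt_def] at hy'; omega)
        · rw [e2]
          have hxi : x ≤ i := by rw [Fin.lt_def] at hxj; rw [Fin.le_def]; omega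
          rcases hxi.lt_or_eq with hxi | rfl
          · have h7 := h4 x i hxi le_rfl
            rw [e3, h1] at h7
            exact h7.imp_right fun h8 => ⟨h8.1, h6.trans h8.2⟩
          · exact Or.inr ⟨h1, by rwa [e3]⟩

theorem cosetSum_mem_cosetLabel {m : Fin N → ℤ} {e : Fin N → Fin n} (k : ℕ) {i j : Fin N}
    (hi : (i : ℕ) = k) (h : (i : ℕ) + 1 = j) (hs : SortedTo j m e) :
    cosetSum (gSite n q N) (sSite n q N) k (mono m ⊗ₜ vec e) ∈ pairSpan (CosetLabel m e i j) := by
  induction k generalizing i j with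
  | zero => exact pair_mem (cosetLabel_self h hs)
  | succ k ih =>
    refine Submodule.add_mem _ (pair_mem (cosetLabel_self h hs)) ?_
    have := ih (i := ⟨k, by omega⟩) (j := i) rfl hi.symm
      (fun x y hxy hy => hs x y hxy (by omega))
    exact site_cosetLabel q (i := ⟨k, by omega⟩) hi.symm h hs this

/-- On a vector with sorted labels, the antisymmetrizer is the identity up to terms with lower
energy or unsorted labels. -/
theorem antisym_sub_mem (k : ℕ) (hk : k < N) {m : Fin N → ℤ} {e : Fin N → Fin n}
    (hs : SortedTo k m e) :
    antisym (gSite n q N) (sSite n q N) k (mono m ⊗ₜ vec e) - mono m ⊗ₜ vec e ∈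
      pairSpan (fun m' (e' : Fin N → Fin n) => energy m' < energy m ∨ ¬ SortedTo k m' e') := by
  induction k generalizing e with
  | zero => simp [antisym]
  | succ k ih =>
    set i : Fin N := ⟨k, by omega⟩
    set j : Fin N := ⟨k + 1, hk⟩
    have h : (i : ℕ) + 1 = j := rfl
    have hij : i < j := by simp [i, j]
    have hW : ∀ (m' : Fin N → ℤ) (e' : Fin N → Fin n), (energy m' < energy m ∨ ¬ SortedTo k m' e') →
        (energy m' < energy m ∨ ¬ SortedTo (n := n) (k + 1) m' e') :=
      fun m' e' => Or.imp_right fun h1 h2 => h1 h2.mono_index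
    -- `cosetSum (k + 1) = 1 + T_k cosetSum k`: the term `1` is the induction hypothesis, and the
    -- rest must give only lower energy or unsorted labels.
    have h1 : antisym (gSite n q N) (sSite n q N) (k + 1) (mono m ⊗ₜ vec e) - mono m ⊗ₜ vec e =
        (antisym (gSite n q N) (sSite n q N) k (mono m ⊗ₜ vec e) - mono m ⊗ₜ vec e) +
        antisym (gSite n q N) (sSite n q N) k ((gSite n q N i * sSite n q N i)
          (cosetSum (gSite n q N) (sSite n q N) k (mono m ⊗ₜ vec e))) := by
      rw [antisym, cosetSum, mul_add, mul_one, LinearMap.add_apply]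
      simp only [Module.End.mul_apply, i]
      abel
    rw [h1]
    refine Submodule.add_mem _ (pairSpan_mono hW (ih (by omega) hs.mono_index)) ?_
    suffices H : pairSpan (CosetLabel m e i j) ≤
        (pairSpan (fun m' (e' : Fin N → Fin n) => energy m' < energy m ∨
          ¬ SortedTo (k + 1) m' e')).comap (antisym (gSite n q N) (sSite n q N) k *
            (gSite n q N i * sSite n q N i)) from
      H (cosetSum_mem_cosetLabel q k rfl h hs)
    refine pairSpan_le fun m' e' hm => ?_
    rw [Submodule.mem_comap, Module.End.mul_apply]
    rcases hm with hm | ⟨h1, h2, h3⟩ | ⟨rfl, h1, h2, h3, h4⟩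
    · refine pairSpan_mono (fun _ _ hx => Or.inl hx) (antisym_mem q
        (W := pairSpan (fun m' _ => energy m' < energy m))
        (fun a b hab _ => site_energy_mem q hab (energy m)) (by omega) ?_)
      exact site_energy_mem q h (energy m) (pair_mem hm)
    -- After the swap the exponent at `j` is smaller than one at an earlier site. The remaining
    -- antisymmetrizer does not touch site `j` and merely swaps earlier exponents or lowers the
    -- energy, so the disorder persists.
    · have hP := antisym_mem q (n := n) (N := N) (k := k)
        (W := pairSpan (fun m' (_ : Fin N → Fin n) => energy m' < energy m ∨
          (energy m' ≤ energy m ∧ ∃ x : Fin N, (x : ℕ) ≤ k ∧ m' j < m' x)))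
        (fun a b hab hb => by
          have hja : j ≠ a := by rintro rfl; simp [j] at hab; omega
          have hjb : j ≠ b := by rintro rfl; simp [j] at hb
          refine site_mem q hab (fun m hm => ?_) (fun m hm k hk hk' => Or.inl ?_)
            (fun m hm k hk hk' => Or.inl ?_)
          · rw [energy_comp_swap]
            refine hm.imp_right fun ⟨h5, x, hx, h6⟩ => ⟨h5, Equiv.swap a b x, ?_, ?_⟩
            · rw [Equiv.swap_apply_def]; split_ifs <;> omega
            · simpa [Equiv.swap_apply_of_ne_of_ne hja hjb] using h6
          · exact (energy_squeeze m (ne_of_succ hab) hk hk').trans_le (hm.elim le_of_lt And.left)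
          · exact (energy_squeeze m (ne_of_succ hab).symm hk hk').trans_le
              (hm.elim le_of_lt And.left))
        (by omega)
      refine pairSpan_mono (fun m'' e'' hx => ?_)
        (hP (pairSpan_mono (fun m'' e'' hx => ?_) (site_of_lt q h h2 e')))
      · refine hx.imp_right fun ⟨_, x, hx, h5⟩ hs' => ?_
        have hxj : x < j := by rw [Fin.lt_def]; simp [j]; omega
        rcases hs' x j hxj le_rfl with h6 | h6 <;> omega
      · rcases hx with rfl | hx
        · exact Or.inr ⟨by rwa [energy_comp_swap], i, le_rfl, by simpa using h2⟩
        · exact Or.inl (hx.trans_le h1)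
    -- Equal exponents: the swapped vector is sorted up to `k`, so the induction hypothesis returns
    -- it up to allowed terms, and its spins at `i`, `j` are in the wrong order.
    · rw [site_of_eq q h h1 (by rwa [h3 j hij]), map_neg, map_smul]
      refine Submodule.neg_mem _ (Submodule.smul_mem _ _ ?_)
      have h5 := pairSpan_mono hW (ih (by omega) h4)
      rw [← Submodule.sub_mem_iff_left _ (pair_mem _)]
      · exact h5
      · refine Or.inr fun hs' => ?_
        have := hs' i j hij le_rfl
        simp only [Function.comp_apply, Equiv.swap_apply_left, Equiv.swap_apply_right,
          h3 j hij] at this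
        rcases this with h6 | h6
        · omega
        · exact absurd h2 h6.2.not_gt

end Triangularity

/-! ### Linear independence of the normally ordered wedges -/

theorem asym_sub_mem {n N : ℕ} (q : ℂˣ) {m : Fin N → ℤ} {e : Fin N → Fin n} (hs : Sorted m e) :
    asym n q N (mono m ⊗ₜ vec e) - mono m ⊗ₜ vec e ∈
      pairSpan (fun m' (e' : Fin N → Fin n) => energy m' < energy m ∨ ¬ Sorted m' e') := by
  rcases Nat.eq_zero_or_pos N with rfl | hN
  · simp [asym, antisym]
  · refine pairSpan_mono (fun m' e' h => h.imp_right fun h1 h2 => h1 ?_)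
      (antisym_sub_mem q (N - 1) (by omega) (fun x y hxy _ => hs x y hxy))
    exact fun x y hxy _ => h2 x y hxy

theorem tensBasis_repr_of_mem {n N : ℕ} {R : (Fin N → ℤ) → (Fin N → Fin n) → Prop}
    {x : Tens n N} (hx : x ∈ pairSpan R) {m : Fin N → ℤ} {e : Fin N → Fin n} (h : ¬ R m e) :
    (tensBasis n N).repr x (m, e) = 0 := by
  refine pairSpan_le (K := LinearMap.ker ((tensBasis n N).coord (m, e))) (fun m' e' h' => ?_) hx
  have h1 := tensBasis_apply (n := n) (N := N) (m', e')
  simp only at h1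
  rw [LinearMap.mem_ker, ← h1, Module.Basis.coord_apply, Module.Basis.repr_self,
    Finsupp.single_apply, if_neg]
  rintro ⟨rfl, rfl⟩
  exact h h'

/-- The labels of the normally ordered wedges. -/
abbrev Label (n N : ℕ) : Type := {b : (Fin N → ℤ) × (Fin N → Fin n) // Sorted b.1 b.2}

/-- Antisymmetrize a relation and read off the coefficient at a label of maximal energy in its
support. The other members contribute only their own label, labels of smaller energy and unsorted
labels, so that coefficient of the relation vanishes. -/
theorem linearIndependent_wedge {n : ℕ} {q : ℂˣ} (hq : (q : ℂ) + (q : ℂ)⁻¹ ≠ 0) (N : ℕ) :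
    LinearIndependent ℂ (fun b : Label n N => wedge n q b.1.1 b.1.2) := by
  classical
  rw [linearIndependent_iff]
  intro c hc
  by_contra hne
  obtain ⟨b, hb, hmax⟩ := Finset.exists_max_image c.support (fun b => energy b.1.1)
    (Finsupp.support_nonempty_iff.mpr hne)
  have h1 : Finsupp.linearCombination ℂ
      (fun b : Label n N => (mono b.1.1 ⊗ₜ vec b.1.2 : Tens n N)) c ∈ Omega n q N := by
    rw [← Submodule.Quotient.mk_eq_zero, ← Submodule.mkQ_apply, ← hc]
    simp only [Finsupp.linearCombination_apply, Finsupp.sum, map_sum,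
      map_smul]
    rfl
  have h2 := Omega_le_ker_asym hq N h1
  rw [LinearMap.mem_ker, Finsupp.linearCombination_apply, Finsupp.sum, map_sum] at h2
  have h3 := congrArg (fun x => (tensBasis n N).repr x (b.1.1, b.1.2)) h2
  simp only [map_sum, map_smul, map_zero, Finsupp.coe_zero, Pi.zero_apply, Finsupp.coe_finsetSum,
    Finset.sum_apply, Finsupp.smul_apply, smul_eq_mul] at h3
  rw [Finset.sum_eq_single b] at h3
  · have h4 := tensBasis_repr_of_mem (asym_sub_mem q b.2)
      (m := b.1.1) (e := b.1.2) (by simp [b.2])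
    have h5 := tensBasis_apply (n := n) (N := N) b.1
    rw [map_sub, Finsupp.sub_apply, sub_eq_zero, ← h5, Module.Basis.repr_self] at h4
    rw [← h5, h4] at h3
    simp only [Prod.mk.eta, Finsupp.single_eq_same, mul_one] at h3
    exact (Finsupp.mem_support_iff.mp hb) h3
  · intro b' hb' hbb
    have h4 := tensBasis_repr_of_mem (asym_sub_mem q b'.2)
      (m := b.1.1) (e := b.1.2) (by
        rintro (h | h)
        · exact absurd (hmax b' hb') h.not_ge
        · exact h b.2)
    have h5 := tensBasis_apply (n := n) (N := N) b'.1
    rw [map_sub, Finsupp.sub_apply, sub_eq_zero, ← h5, Module.Basis.repr_self,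
      Finsupp.single_apply, if_neg (fun h => hbb (Subtype.ext h))] at h4
    rw [← h5, h4, mul_zero]
  · intro h
    exact absurd hb h

/-! ### The basis of normally ordered wedges -/

theorem wedgeSpan_le {n : ℕ} {q : ℂˣ} {N : ℕ} {P : (Fin N → ℤ) → Prop}
    {W : Submodule ℂ (Wedge n q N)} (h : ∀ m e, Sorted m e → P m → wedge n q m e ∈ W) :
    wedgeSpan n q P ≤ W := by
  rw [wedgeSpan, Submodule.span_le]
  rintro _ ⟨m, e, hs, hm, rfl⟩
  exact h m e (normallyOrdered_iff.mp hs) hm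

theorem cls_tmul_mem {n : ℕ} {q : ℂˣ} (hq : (q : ℂ) + (q : ℂ)⁻¹ ≠ 0) {N : ℕ}
    {P : (Fin N → ℤ) → Prop} (hP : Squeezable P) {f : Laurent N} (hf : f ∈ monoSpan P)
    (v : Spin n N) : cls n q N (f ⊗ₜ v) ∈ wedgeSpan n q P :=
  monoSpan_le (K := (wedgeSpan n q P).comap
    (cls n q N ∘ₗ (TensorProduct.mk ℂ (Laurent N) (Spin n N)).flip v))
    (fun m hm => cls_mem_wedgeSpan hq hP m hm v) hf

theorem span_wedge_eq_top {n : ℕ} {q : ℂˣ} (hq : (q : ℂ) + (q : ℂ)⁻¹ ≠ 0) (N : ℕ) :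
    ⊤ ≤ Submodule.span ℂ (Set.range (fun b : Label n N => wedge n q b.1.1 b.1.2)) := by
  have h1 : wedgeSpan n q (fun _ : Fin N → ℤ => True) ≤
      Submodule.span ℂ (Set.range (fun b : Label n N => wedge n q b.1.1 b.1.2)) :=
    wedgeSpan_le fun m e hs _ => Submodule.subset_span ⟨⟨(m, e), hs⟩, rfl⟩
  intro w _
  obtain ⟨x, rfl⟩ := (Omega n q N).mkQ_surjective w
  apply h1
  have h2 : Submodule.span ℂ (Set.range (tensBasis n N)) ≤
      (wedgeSpan n q (fun _ : Fin N → ℤ => True)).comap (Omega n q N).mkQ := by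
    rw [Submodule.span_le]
    rintro _ ⟨b, rfl⟩
    rw [tensBasis_apply]
    exact cls_mem_wedgeSpan hq ⟨fun _ _ _ _ => trivial, fun _ _ _ _ _ _ _ _ => trivial⟩ b.1
      trivial _
  rw [Module.Basis.span_eq] at h2
  exact h2 trivial

/-- The basis of normally ordered wedges. -/
def wedgeBasis {n : ℕ} {q : ℂˣ} (hq : (q : ℂ) + (q : ℂ)⁻¹ ≠ 0) (N : ℕ) :
    Module.Basis (Label n N) ℂ (Wedge n q N) :=
  Module.Basis.mk (linearIndependent_wedge hq N) (span_wedge_eq_top hq N)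

theorem wedgeBasis_apply {n : ℕ} {q : ℂˣ} (hq : (q : ℂ) + (q : ℂ)⁻¹ ≠ 0) {N : ℕ}
    (b : Label n N) : wedgeBasis hq N b = wedge n q b.1.1 b.1.2 :=
  Module.Basis.mk_apply _ _ b

/-! ### Appending a tail -/

section Append

variable {N : ℕ} (k : ℕ) (ν : ℤ)

/-- Multiplication by the `ν`-th powers of `k` additional variables. -/
def appMono : Laurent N →ₗ[ℂ] Laurent (N + k) :=
  (monoBasis N).constr ℂ fun m => mono (Fin.append m fun _ => ν)

theorem appMono_mono (m : Fin N → ℤ) :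
    appMono k ν (mono m) = mono (Fin.append m fun _ : Fin k => ν) := by
  rw [← monoBasis_apply, appMono, Module.Basis.constr_basis]

variable {k}

/-- Tensoring with `v_{f₁} ⊗ ⋯ ⊗ v_{f_k}` from the right. -/
def appVec {n : ℕ} (f : Fin k → Fin n) : Spin n N →ₗ[ℂ] Spin n (N + k) :=
  (vecBasis n N).constr ℂ fun e => vec (Fin.append e f)

theorem appVec_vec {n : ℕ} (f : Fin k → Fin n) (e : Fin N → Fin n) :
    appVec f (vec e) = vec (Fin.append e f) := by
  rw [← vecBasis_apply, appVec, Module.Basis.constr_basis]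

theorem append_comp_swap {α : Type*} (a : Fin N → α) (b : Fin k → α) (i j : Fin N) :
    Fin.append a b ∘ Equiv.swap (Fin.castAdd k i) (Fin.castAdd k j) =
      Fin.append (a ∘ Equiv.swap i j) b := by
  funext x
  refine Fin.addCases (fun x => ?_) (fun x => ?_) x
  · rw [Function.comp_apply, ← (Fin.castAdd_injective N k).map_swap]
    simp
  · rw [Function.comp_apply, Equiv.swap_apply_of_ne_of_ne] <;>
    simp [Fin.ext_iff] <;> omega

theorem append_update_left {α : Type*} (a : Fin N → α) (b : Fin k → α) (i : Fin N) (x : α) :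
    Function.update (Fin.append a b) (Fin.castAdd k i) x =
      Fin.append (Function.update a i x) b := by
  funext y
  refine Fin.addCases (fun y => ?_) (fun y => ?_) y
  · simp [Function.update_apply, Fin.ext_iff]
  · rw [Function.update_of_ne] <;> simp [Fin.ext_iff]; omega

theorem append_update_right {α : Type*} (a : Fin N → α) (b : Fin k → α) (i : Fin k) (x : α) :
    Function.update (Fin.append a b) (Fin.natAdd N i) x =
      Fin.append a (Function.update b i x) := by
  funext y
  refine Fin.addCases (fun y => ?_) (fun y => ?_) y
  · rw [Function.update_of_ne] <;> simp [Fin.ext_iff]; omega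
  · simp [Function.update_apply, Fin.ext_iff]

theorem end_ext' {M : Type*} [AddCommGroup M] [Module ℂ M] {A B : Laurent N →ₗ[ℂ] M}
    (h : ∀ m, A (mono m) = B (mono m)) : A = B :=
  (monoBasis N).ext fun m => by rw [monoBasis_apply, h]

theorem appMono_permVar (i j : Fin N) (f : Laurent N) :
    appMono k ν (permVar i j f) =
      permVar (Fin.castAdd k i) (Fin.castAdd k j) (appMono k ν f) := by
  have : appMono k ν ∘ₗ (permVar i j).toLinearMap =
      (permVar (Fin.castAdd k i) (Fin.castAdd k j)).toLinearMap ∘ₗ appMono k ν :=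
    end_ext' fun m => by
      simp only [LinearMap.comp_apply, AlgEquiv.toLinearMap_apply, permVar_mono, appMono_mono,
        append_comp_swap]
  exact LinearMap.congr_fun this f

theorem appMono_zvar_mul (i : Fin N) (f : Laurent N) :
    appMono k ν (zvar i * f) = zvar (Fin.castAdd k i) * appMono k ν f := by
  have : appMono k ν ∘ₗ LinearMap.mulLeft ℂ (zvar i) =
      LinearMap.mulLeft ℂ (zvar (Fin.castAdd k i)) ∘ₗ appMono k ν :=
    end_ext' fun m => by
      simp only [LinearMap.comp_apply, LinearMap.mulLeft_apply, zvar, mono_mul, appMono_mono]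
      congr 1
      funext y
      refine Fin.addCases (fun y => ?_) (fun y => ?_) y
      · simp [Pi.single_apply, Fin.ext_iff]
      · have : Fin.natAdd N y ≠ Fin.castAdd k i := by simp [Fin.ext_iff]; omega
        simp [this]
  exact LinearMap.congr_fun this f

theorem appMono_gOp (q : ℂˣ) (i j : Fin N) (f : Laurent N) :
    appMono k ν (gOp q i j f) = gOp q (Fin.castAdd k i) (Fin.castAdd k j) (appMono k ν f) := by
  by_cases hij : i = j
  · subst hij; simp [gOp_self]
  have hij' : Fin.castAdd k i ≠ Fin.castAdd k j := fun h => hij (Fin.castAdd_injective N k h)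
  -- `appMono` is not multiplicative, but it commutes with multiplication by the old variables,
  -- which suffices once denominators are cleared.
  apply mul_left_cancel₀ (zvar_sub_ne_zero hij')
  have h := congrArg (appMono k ν) (sub_mul_gOp q hij f)
  simp only [con, Algebra.algebraMap_eq_smul_one, sub_mul, smul_mul_assoc, one_mul, map_sub,
    map_add, map_smul, appMono_zvar_mul, appMono_permVar] at h
  rw [sub_mul_gOp q hij']
  simp only [con, Algebra.algebraMap_eq_smul_one, sub_mul, smul_mul_assoc, one_mul]
  exact h

theorem appMono_shiftOp (p : ℂˣ) (i : Fin N) (f : Laurent N) :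
    appMono k ν (shiftOp p i f) = shiftOp p (Fin.castAdd k i) (appMono k ν f) := by
  have : appMono k ν ∘ₗ shiftOp p i = shiftOp p (Fin.castAdd k i) ∘ₗ appMono k ν :=
    end_ext' fun m => by
      simp only [LinearMap.comp_apply, shiftOp_mono, map_smul, appMono_mono, Fin.append_left]
  exact LinearMap.congr_fun this f

theorem shiftOp_appMono (p : ℂˣ) (t : Fin k) (f : Laurent N) :
    shiftOp p (Fin.natAdd N t) (appMono k ν f) = ((p ^ ν : ℂˣ) : ℂ) • appMono k ν f := by
  have : shiftOp p (Fin.natAdd N t) ∘ₗ appMono k ν = ((p ^ ν : ℂˣ) : ℂ) • appMono k ν :=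
    end_ext' fun m => by
      simp only [LinearMap.comp_apply, LinearMap.smul_apply, appMono_mono, shiftOp_mono,
        Fin.append_right]
  exact LinearMap.congr_fun this f

theorem append_const_comp_swap (m : Fin N → ℤ) (t u : Fin k) :
    Fin.append m (fun _ => ν) ∘ Equiv.swap (Fin.natAdd N t) (Fin.natAdd N u) =
      Fin.append m (fun _ => ν) := by
  funext x
  refine Fin.addCases (fun x => ?_) (fun x => ?_) x
  · rw [Function.comp_apply, Equiv.swap_apply_of_ne_of_ne] <;>
    simp [Fin.ext_iff] <;> omega
  · rw [Function.comp_apply, ← (Fin.natAdd_injective k N).map_swap]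
    simp

theorem appVec_SOp {n : ℕ} (q : ℂˣ) (f : Fin k → Fin n) {i j : Fin N} (hij : i ≠ j)
    (v : Spin n N) : appVec f (SOp q n i j v) =
      SOp q n (Fin.castAdd k i) (Fin.castAdd k j) (appVec f v) := by
  have hij' : Fin.castAdd k i ≠ Fin.castAdd k j := fun h => hij (Fin.castAdd_injective N k h)
  have : appVec f ∘ₗ SOp q n i j = SOp q n (Fin.castAdd k i) (Fin.castAdd k j) ∘ₗ appVec f := by
    refine (vecBasis n N).ext fun e => ?_
    rw [vecBasis_apply, LinearMap.comp_apply, LinearMap.comp_apply, appVec_vec, SOp_vec q hij,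
      SOp_vec q hij', Fin.append_left, Fin.append_left, append_comp_swap]
    split_ifs <;> simp [appVec_vec]
  exact LinearMap.congr_fun this v

end Append

/-! ### Appending a tail to wedges -/

/-- The map `w ↦ w ∧ z^ν v_{f₁} ∧ ⋯ ∧ z^ν v_{f_k}` before taking quotients. -/
def appTens {n k : ℕ} (N : ℕ) (ν : ℤ) (f : Fin k → Fin n) : Tens n N →ₗ[ℂ] Tens n (N + k) :=
  TensorProduct.map (appMono k ν) (appVec f)

theorem Omega_le_comap_appTens {n : ℕ} {q : ℂˣ} (hq : (q : ℂ) + (q : ℂ)⁻¹ ≠ 0) {k : ℕ} (N : ℕ)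
    (ν : ℤ) (f : Fin k → Fin n) :
    Omega n q N ≤ (Omega n q (N + k)).comap (appTens N ν f) := by
  refine Omega_le_of hq fun i j h g v => ?_
  have h' : ((Fin.castAdd k i : Fin (N + k)) : ℕ) + 1 = (Fin.castAdd k j : Fin (N + k)) := by
    simpa using h
  have h1 := cls_gOp (n := n) hq h' (appMono k ν g) (appVec f v)
  rw [← sub_eq_zero, ← map_sub, Submodule.mkQ_apply, Submodule.Quotient.mk_eq_zero] at h1
  rw [Submodule.mem_comap, map_sub, appTens, TensorProduct.map_tmul, TensorProduct.map_tmul,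
    appMono_gOp, appVec_SOp q f (ne_of_succ h)]
  exact h1

/-- The map `w ↦ w ∧ z^ν v_{f₁} ∧ ⋯ ∧ z^ν v_{f_k}`. -/
def appWedge {n : ℕ} {q : ℂˣ} (hq : (q : ℂ) + (q : ℂ)⁻¹ ≠ 0) {k : ℕ} (N : ℕ) (ν : ℤ)
    (f : Fin k → Fin n) : Wedge n q N →ₗ[ℂ] Wedge n q (N + k) :=
  (Omega n q N).mapQ (Omega n q (N + k)) (appTens N ν f) (Omega_le_comap_appTens hq N ν f)

section AppWedge

variable {n : ℕ} {q : ℂˣ} (hq : (q : ℂ) + (q : ℂ)⁻¹ ≠ 0) {k N : ℕ} (ν : ℤ)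

theorem appWedge_cls (f : Fin k → Fin n) (g : Laurent N) (v : Spin n N) :
    appWedge hq N ν f (cls n q N (g ⊗ₜ v)) =
      cls n q (N + k) (appMono k ν g ⊗ₜ appVec f v) := rfl

theorem appWedge_wedge (f : Fin k → Fin n) (m : Fin N → ℤ) (e : Fin N → Fin n) :
    appWedge hq N ν f (wedge n q m e) =
      wedge n q (Fin.append m fun _ => ν) (Fin.append e f) := by
  change appWedge hq N ν f (cls n q N _) = _
  rw [appWedge_cls, appMono_mono, appVec_vec]
  rfl

include hq in
-- Inside a block of equal exponents neighbouring distinct spins can be exchanged at the cost of a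
-- nonzero scalar, which brings the two equal spins together.
theorem cls_eq_zero_of_const (d : ℕ) {a b : Fin N} (h : (a : ℕ) + d + 1 = b) {m : Fin N → ℤ}
    {e : Fin N → Fin n} (hm : ∀ x, a ≤ x → x ≤ b → m x = m a) (he : e a = e b) :
    cls n q N (mono m ⊗ₜ vec e) = 0 := by
  induction d generalizing b e with
  | zero => exact cls_eq_zero_of_eq hq h (hm b (by rw [Fin.le_def]; omega) le_rfl).symm he
  | succ d ih =>
    set c : Fin N := ⟨a + d + 1, by omega⟩
    have hc : (c : ℕ) + 1 = b := h
    have hac : a ≠ c := by intro h; have := congrArg Fin.val h; simp only [c] at this; omega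
    have hab : a ≠ b := by rintro rfl; omega
    have hcb : m c = m b :=
      (hm c (by rw [Fin.le_def]; simp only [c]; omega) (by rw [Fin.le_def]; omega)).trans
        (hm b (by rw [Fin.le_def]; omega) le_rfl).symm
    have h1 : cls n q N (mono m ⊗ₜ vec (e ∘ Equiv.swap c b)) = 0 := by
      refine ih (b := c) rfl (fun x h1 h2 => hm x h1 (h2.trans (by rw [Fin.le_def]; omega))) ?_
      simp [Equiv.swap_apply_of_ne_of_ne hac hab, he]
    rcases lt_trichotomy (e c) (e b) with h2 | h2 | h2
    · rw [cls_swap_of_lt hq hc hcb h2, h1, smul_zero, neg_zero]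
    · exact cls_eq_zero_of_eq hq hc hcb h2
    · rw [cls_swap_of_lt hq hc hcb (by simpa using h2), neg_eq_zero] at h1
      have hs : (e ∘ Equiv.swap c b) ∘ Equiv.swap c b = e := by funext x; simp
      rw [hs] at h1
      exact (smul_eq_zero.mp h1).resolve_left q.ne_zero

include hq in
theorem cls_append_eq_zero {f : Fin k → Fin n} (hf : ¬ Function.Injective f) (m : Fin N → ℤ)
    (e : Fin N → Fin n) :
    cls n q (N + k) (mono (Fin.append m fun _ => ν) ⊗ₜ vec (Fin.append e f)) = 0 := by
  have H : ∀ t u : Fin k, t < u → f t = f u →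
      cls n q (N + k) (mono (Fin.append m fun _ => ν) ⊗ₜ vec (Fin.append e f)) = 0 := by
    intro t u htu h
    refine cls_eq_zero_of_const hq (u - t - 1) (a := Fin.natAdd N t) (b := Fin.natAdd N u)
      (by simp; rw [Fin.lt_def] at htu; omega) (fun x hx _ => ?_) (by simpa using h)
    obtain ⟨y, rfl⟩ : ∃ y : Fin k, x = Fin.natAdd N y := by
      rw [Fin.le_def, Fin.val_natAdd] at hx
      exact ⟨⟨x - N, by omega⟩, Fin.ext (by simp; omega)⟩
    simp
  simp only [Function.Injective, not_forall] at hf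
  obtain ⟨t, u, h, hne⟩ := hf
  rcases lt_or_gt_of_ne hne with h' | h'
  exacts [H t u h' h, H u t h' h.symm]

include hq in
theorem cls_appMono_eq_zero {f : Fin k → Fin n} (hf : ¬ Function.Injective f) (g : Laurent N)
    (v : Spin n N) : cls n q (N + k) (appMono k ν g ⊗ₜ appVec f v) = 0 := by
  have : cls n q (N + k) ∘ₗ appTens N ν f = 0 := by
    refine (tensBasis n N).ext fun b => ?_
    rw [tensBasis_apply, LinearMap.comp_apply, appTens, TensorProduct.map_tmul, appMono_mono,
      appVec_vec, cls_append_eq_zero hq ν hf, LinearMap.zero_apply]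
  exact LinearMap.congr_fun this (g ⊗ₜ v)

end AppWedge

/-! ### Exponents below the tail value -/

/-- All exponents are less than `ν`. -/
def Low {N : ℕ} (ν : ℤ) (m : Fin N → ℤ) : Prop := ∀ i, m i < ν

/-- All exponents are at most `ν`, and fewer than `k` are equal to `ν`. -/
def Few {N : ℕ} (k : ℕ) (ν : ℤ) (m : Fin N → ℤ) : Prop :=
  (∀ i, m i ≤ ν) ∧ (Finset.univ.filter fun i => m i = ν).card < k

theorem squeeze_apply {N : ℕ} (m : Fin N → ℤ) (i j : Fin N) (k : ℤ) (x : Fin N) :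
    squeeze m i j k x = if x = j then m j - k else if x = i then m i + k else m x := by
  simp [squeeze, Function.update_apply]

theorem squeezable_low (N : ℕ) (ν : ℤ) : Squeezable (Low ν : (Fin N → ℤ) → Prop) where
  swap m i j h x := h _
  squeeze m i j k hij h hk hk' x := by
    have h1 := h j
    have h2 := h x
    rw [squeeze_apply]
    split_ifs <;> omega

/-- Both squeezed exponents lie strictly below the old larger one, hence below `ν`; no new exponent
`ν` arises, and site `j` cannot have one. -/
theorem card_squeeze_le {N : ℕ} {ν : ℤ} {m : Fin N → ℤ} (h : ∀ i, m i ≤ ν) {i j : Fin N} {k : ℤ}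
    (hk : 0 < k) (hk' : k < m j - m i) :
    (Finset.univ.filter fun x => squeeze m i j k x = ν) ⊆
      (Finset.univ.filter fun x => m x = ν).erase j := by
  intro x hx
  rw [Finset.mem_filter, squeeze_apply] at hx
  have h1 := h j
  have h2 := hx.2
  rw [Finset.mem_erase, Finset.mem_filter]
  split_ifs at h2 with h3 h4
  · omega
  · omega
  · exact ⟨h3, Finset.mem_univ _, h2⟩

theorem squeezable_few (N k : ℕ) (ν : ℤ) : Squeezable (Few k ν : (Fin N → ℤ) → Prop) where
  swap m i j h := by
    refine ⟨fun x => h.1 _, ?_⟩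
    have : (Finset.univ.filter fun x => (m ∘ Equiv.swap i j) x = ν) =
        (Finset.univ.filter fun x => m x = ν).map (Equiv.swap i j).toEmbedding := by
      ext x
      simp [Finset.mem_map_equiv]
    rw [this, Finset.card_map]
    exact h.2
  squeeze m i j l hij h hk hk' := by
    refine ⟨fun x => ?_, ?_⟩
    · have h1 := h.1 j
      have h2 := h.1 x
      rw [squeeze_apply]
      split_ifs <;> omega
    · exact (Finset.card_le_card ((card_squeeze_le h.1 hk hk').trans
        (Finset.erase_subset _ _))).trans_lt h.2

/-- A squeeze between a low exponent and a tail exponent destroys one of the exactly `k` exponents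
`ν`. -/
theorem few_squeeze_append {N k : ℕ} {ν : ℤ} {m : Fin N → ℤ} (h : Low ν m) (i : Fin N) (t : Fin k)
    {l : ℤ} (hl : 0 < l) (hl' : l < ν - m i) :
    Few k ν (squeeze (Fin.append m fun _ : Fin k => ν) (Fin.castAdd k i) (Fin.natAdd N t) l) := by
  have hle : ∀ x, (Fin.append m fun _ : Fin k => ν) x ≤ ν := fun x =>
    Fin.addCases (fun x => by simpa using (h x).le) (fun x => by simp) x
  refine ⟨fun x => ?_, ?_⟩
  · have h2 := hle x
    have h3 := h i
    rw [squeeze_apply]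
    simp only [Fin.append_left, Fin.append_right]
    split_ifs <;> omega
  · have h1 : (Finset.univ.filter fun x => (Fin.append m fun _ : Fin k => ν) x = ν) ⊆
        (Finset.univ : Finset (Fin k)).map (Fin.natAddEmb N) := by
      intro x hx
      rw [Finset.mem_filter] at hx
      obtain ⟨-, hx⟩ := hx
      induction x using Fin.addCases with
      | left x => simp only [Fin.append_left] at hx; exact absurd hx (h x).ne
      | right x => simp
    have h2 := card_squeeze_le (k := l) hle (i := Fin.castAdd k i) (j := Fin.natAdd N t) hl
      (by simpa using hl')
    refine (Finset.card_le_card h2).trans_lt ?_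
    rw [Finset.card_erase_of_mem (by simp)]
    have h3 := Finset.card_le_card h1
    rw [Finset.card_map, Finset.card_univ, Fintype.card_fin] at h3
    have := t.2
    omega

/-! ### Pairs of operators compatible with the tail -/

/-- Invertible operators that preserve a subspace, together with their inverses. -/
def unitStab {M : Type*} [AddCommGroup M] [Module ℂ M] (W : Submodule ℂ M) :
    Subgroup (Module.End ℂ M)ˣ where
  carrier := {A | (∀ f ∈ W, (A : Module.End ℂ M) f ∈ W) ∧
    ∀ f ∈ W, ((A⁻¹ : (Module.End ℂ M)ˣ) : Module.End ℂ M) f ∈ W}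
  one_mem' := ⟨fun f hf => hf, fun f hf => by simpa using hf⟩
  mul_mem' := fun hA hB => ⟨fun f hf => hA.1 _ (hB.1 f hf), fun f hf => by
    rw [mul_inv_rev]; exact hB.2 _ (hA.2 f hf)⟩
  inv_mem' := fun hA => ⟨hA.2, fun f hf => by rw [inv_inv]; exact hA.1 f hf⟩

theorem scalarUnit_apply {M : Type*} [AddCommGroup M] [Module ℂ M] (c : ℂˣ) (f : M) :
    (scalarUnit (Module.End ℂ M) c : Module.End ℂ M) f = (c : ℂ) • f := by
  rw [scalarUnit_val, Module.algebraMap_end_apply]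

theorem scalarUnit_mem_unitStab {M : Type*} [AddCommGroup M] [Module ℂ M] (W : Submodule ℂ M)
    (c : ℂˣ) : scalarUnit (Module.End ℂ M) c ∈ unitStab W :=
  ⟨fun f hf => by rw [scalarUnit_apply]; exact W.smul_mem _ hf, fun f hf => by
    rw [← map_inv, scalarUnit_apply]; exact W.smul_mem _ hf⟩

/-! ### Stability of spans of monomials under the Hecke operators and shifts -/

section Stab

variable (q p : ℂˣ) {N : ℕ} {P : (Fin N → ℤ) → Prop} (hP : Squeezable P)

include hP

theorem gUnit_mem_unitStab (i j : Fin N) : gUnit q i j ∈ unitStab (monoSpan P) := by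
  refine ⟨fun f hf => gOp_mem hP q i j hf, fun f hf => ?_⟩
  have : ((gUnit q i j)⁻¹ : (Module.End ℂ (Laurent N))ˣ).val f =
      gOp q i j f - ((q : ℂ) - (q : ℂ)⁻¹) • f := rfl
  rw [this]
  exact Submodule.sub_mem _ (gOp_mem hP q i j hf) (Submodule.smul_mem _ _ hf)

theorem permUnit_mem_unitStab (i j : Fin N) : permUnit i j ∈ unitStab (monoSpan P) :=
  ⟨fun _ hf => permVar_mem hP i j hf, fun _ hf => permVar_mem hP i j hf⟩

theorem xiUnit_mem_unitStab (i j : Fin N) : xiUnit q i j ∈ unitStab (monoSpan P) :=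
  mul_mem (permUnit_mem_unitStab hP i j) (gUnit_mem_unitStab q hP i j)

omit hP in
theorem shiftUnit_mem_unitStab (i : Fin N) : shiftUnit p i ∈ unitStab (monoSpan P) :=
  ⟨fun _ hf => shiftOp_mem p i hf, fun _ hf => shiftOp_mem p⁻¹ i hf⟩

end Stab

/-- Pairs `(B, A)` of operators such that `A` acts on a polynomial with a tail as `B` acts on the
polynomial without it, up to monomials that contain the tail value too few times. -/
def tailGroup (N k : ℕ) (ν : ℤ) :
    Subgroup ((Module.End ℂ (Laurent N))ˣ × (Module.End ℂ (Laurent (N + k)))ˣ) where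
  carrier := {C | C.1 ∈ unitStab (monoSpan (Low ν)) ∧ C.2 ∈ unitStab (monoSpan (Few k ν)) ∧
    ∀ f ∈ monoSpan (Low ν), C.2.val (appMono k ν f) - appMono k ν (C.1.val f) ∈
      monoSpan (Few k ν)}
  one_mem' := ⟨one_mem _, one_mem _, fun f _ => by simp⟩
  mul_mem' := fun {C D} hC hD => ⟨mul_mem hC.1 hD.1, mul_mem hC.2.1 hD.2.1, fun f hf => by
    have h1 := hC.2.1.1 _ (hD.2.2 f hf)
    have h2 := hC.2.2 _ (hD.1.1 f hf)
    rw [map_sub] at h1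
    have := Submodule.add_mem _ h1 h2
    rwa [sub_add_sub_cancel] at this⟩
  inv_mem' := fun {C} hC => ⟨inv_mem hC.1, inv_mem hC.2.1, fun f hf => by
    -- The relation for `(B, A)` at `B⁻¹ f`, transported by `A⁻¹`, is the relation for the inverses
    -- up to sign. Inverses make negative powers of `y` available.
    have h1 := hC.2.1.2 _ (hC.2.2 _ (hC.1.2 f hf))
    rw [map_sub, ← Module.End.mul_apply, ← Module.End.mul_apply, Units.inv_mul,
      Module.End.one_apply, Units.mul_inv, Module.End.one_apply, ← neg_mem_iff, neg_sub] at h1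
    exact h1⟩

section TailGroup

variable (q p : ℂˣ) {N k : ℕ} (ν : ℤ)

theorem mem_tailGroup_of_eq {B : (Module.End ℂ (Laurent N))ˣ}
    {A : (Module.End ℂ (Laurent (N + k)))ˣ} (hB : B ∈ unitStab (monoSpan (Low ν)))
    (hA : A ∈ unitStab (monoSpan (Few k ν)))
    (h : ∀ f, A.val (appMono k ν f) = appMono k ν (B.val f)) : (B, A) ∈ tailGroup N k ν :=
  ⟨hB, hA, fun f _ => by rw [h, sub_self]; exact Submodule.zero_mem _⟩

theorem xiUnit_cast_cast_mem (i j : Fin N) :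
    (xiUnit q i j, xiUnit q (Fin.castAdd k i) (Fin.castAdd k j)) ∈ tailGroup N k ν := by
  refine mem_tailGroup_of_eq ν (xiUnit_mem_unitStab q (squeezable_low N ν) i j)
    (xiUnit_mem_unitStab q (squeezable_few _ k ν) _ _) fun f => ?_
  change permVar _ _ (gOp q _ _ _) = appMono k ν (permVar i j (gOp q i j f))
  rw [appMono_permVar, appMono_gOp]

theorem shiftUnit_cast_mem (i : Fin N) :
    (shiftUnit p i, shiftUnit p (Fin.castAdd k i)) ∈ tailGroup N k ν :=
  mem_tailGroup_of_eq ν (shiftUnit_mem_unitStab p i) (shiftUnit_mem_unitStab p _)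
    fun f => (appMono_shiftOp ν p i f).symm

theorem scalarUnit_mem (c : ℂˣ) : (scalarUnit (Module.End ℂ (Laurent N)) c,
    scalarUnit (Module.End ℂ (Laurent (N + k))) c) ∈ tailGroup N k ν :=
  mem_tailGroup_of_eq ν (scalarUnit_mem_unitStab _ c) (scalarUnit_mem_unitStab _ c)
    fun f => by rw [scalarUnit_apply, scalarUnit_apply, map_smul]

theorem shiftUnit_nat_mem (t : Fin k) : (scalarUnit (Module.End ℂ (Laurent N)) (p ^ ν),
    shiftUnit p (Fin.natAdd N t)) ∈ tailGroup N k ν :=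
  mem_tailGroup_of_eq ν (scalarUnit_mem_unitStab _ _) (shiftUnit_mem_unitStab p _)
    fun f => by rw [scalarUnit_apply, map_smul]; exact shiftOp_appMono ν p t f

/-- Tail exponents are equal, so `g` acts by `q` and the permutation trivially. -/
theorem xiUnit_nat_nat_mem (t u : Fin k) : (scalarUnit (Module.End ℂ (Laurent N)) q,
    xiUnit q (Fin.natAdd N t) (Fin.natAdd N u)) ∈ tailGroup N k ν := by
  refine mem_tailGroup_of_eq ν (scalarUnit_mem_unitStab _ _)
    (xiUnit_mem_unitStab q (squeezable_few _ k ν) _ _) fun f => ?_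
  rw [scalarUnit_apply, map_smul]
  have : (xiUnit q (Fin.natAdd N t) (Fin.natAdd N u)).val ∘ₗ appMono k ν =
      (q : ℂ) • appMono k ν := end_ext' fun m => by
    rw [LinearMap.comp_apply, LinearMap.smul_apply, appMono_mono]
    change permVar _ _ (gOp q _ _ _) = _
    rw [gOp_mono_of_eq q _ (by simp), map_smul, permVar_mono, append_const_comp_swap]
  exact LinearMap.congr_fun this f

/-- The exponents form an ascent: `g` gives `q⁻¹` times the swapped monomial, which `K` swaps back,
plus squeezes that spoil the tail. -/
theorem xiUnit_cast_nat_mem (i : Fin N) (t : Fin k) :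
    (scalarUnit (Module.End ℂ (Laurent N)) q⁻¹,
      xiUnit q (Fin.castAdd k i) (Fin.natAdd N t)) ∈ tailGroup N k ν := by
  refine ⟨scalarUnit_mem_unitStab _ _, xiUnit_mem_unitStab q (squeezable_few _ k ν) _ _, ?_⟩
  intro f hf
  refine monoSpan_le (K := (monoSpan (Few k ν)).comap
    ((xiUnit q (Fin.castAdd k i) (Fin.natAdd N t)).val ∘ₗ appMono k ν -
      appMono k ν ∘ₗ (scalarUnit (Module.End ℂ (Laurent N)) q⁻¹).val)) (fun m hm => ?_) hf
  rw [Submodule.mem_comap, LinearMap.sub_apply, LinearMap.comp_apply, LinearMap.comp_apply,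
    scalarUnit_apply, map_smul, appMono_mono]
  change permVar _ _ (gOp q _ _ _) - _ ∈ _
  rw [gOp_mono_of_lt q _ (by simpa using hm i), map_add, map_smul, permVar_mono]
  have hs : ∀ (m : Fin (N + k) → ℤ) (x y : Fin (N + k)),
      (m ∘ Equiv.swap x y) ∘ Equiv.swap x y = m := fun m x y => by funext z; simp
  rw [hs, Units.val_inv_eq_inv_val, add_sub_cancel_left]
  refine permVar_mem (squeezable_few _ k ν) _ _ (Submodule.smul_mem _ _
    (Submodule.sum_mem _ fun l hl => mono_mem (few_squeeze_append hm i t (by omega) ?_)))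
  simp only [Finset.mem_range, Fin.append_left, Fin.append_right] at hl
  omega

theorem list_prod_mem_tailGroup {ι κ : Type*} (g : ι → κ) (l : List ι)
    (B : ι → (Module.End ℂ (Laurent N))ˣ) (A : κ → (Module.End ℂ (Laurent (N + k)))ˣ)
    (h : ∀ x ∈ l, (B x, A (g x)) ∈ tailGroup N k ν) :
    ((l.map B).prod, ((l.map g).map A).prod) ∈ tailGroup N k ν := by
  induction l with
  | nil => exact one_mem _
  | cons x l ih =>
    exact mul_mem (h x (by simp)) (ih fun y hy => h y (by simp [hy]))

theorem mem_append_map {l : List (Fin N)} {l' : List (Fin k)} :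
    (∀ x, Fin.castAdd k x ∈ l.map (Fin.castAdd k) ++ l'.map (Fin.natAdd N) ↔ x ∈ l) ∧
    ∀ x, Fin.natAdd N x ∈ l.map (Fin.castAdd k) ++ l'.map (Fin.natAdd N) ↔ x ∈ l' := by
  have h1 : ∀ (x : Fin N) (y : Fin k), Fin.natAdd N y ≠ Fin.castAdd k x := fun x y h => by
    have := congrArg Fin.val h
    simp only [Fin.val_natAdd, Fin.val_castAdd] at this
    omega
  constructor <;> intro x <;> rw [List.mem_append]
  · rw [List.mem_map_of_injective (Fin.castAdd_injective N k), or_iff_left]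
    simp only [List.mem_map, not_exists, not_and]
    exact fun y _ => h1 x y
  · rw [List.mem_map_of_injective (Fin.natAdd_injective k N), or_iff_right]
    simp only [List.mem_map, not_exists, not_and]
    exact fun y _ => (h1 y x).symm

theorem pairwise_append_map {l : List (Fin N)} {l' : List (Fin k)} (h : l.Pairwise (· < ·))
    (h' : l'.Pairwise (· < ·)) :
    (l.map (Fin.castAdd k) ++ l'.map (Fin.natAdd N)).Pairwise (· < ·) := by
  rw [List.pairwise_append, List.pairwise_map, List.pairwise_map]
  refine ⟨h.imp fun h => h, h'.imp fun h => ?_, ?_⟩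
  · rw [Fin.lt_def, Fin.val_natAdd, Fin.val_natAdd]
    rw [Fin.lt_def] at h
    omega
  · simp only [List.mem_map]
    rintro _ ⟨x, -, rfl⟩ _ ⟨y, -, rfl⟩
    rw [Fin.lt_def, Fin.val_natAdd, Fin.val_castAdd]
    omega

theorem eq_append_map {l : List (Fin (N + k))} {l₁ : List (Fin N)} {l₂ : List (Fin k)}
    (h : l.Pairwise (· < ·)) (h₁ : l₁.Pairwise (· < ·)) (h₂ : l₂.Pairwise (· < ·))
    (hc : ∀ x, Fin.castAdd k x ∈ l ↔ x ∈ l₁) (hn : ∀ x, Fin.natAdd N x ∈ l ↔ x ∈ l₂) :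
    l = l₁.map (Fin.castAdd k) ++ l₂.map (Fin.natAdd N) :=
  list_eq_of_pairwise_lt h (pairwise_append_map h₁ h₂) fun x => by
    induction x using Fin.addCases with
    | left x => rw [hc, mem_append_map.1]
    | right x => rw [hn, mem_append_map.2]

theorem mem_above {N : ℕ} {i x : Fin N} : x ∈ above i ↔ (i : ℕ) < x := by
  simp [above]

theorem mem_below {N : ℕ} {i x : Fin N} : x ∈ below i ↔ (x : ℕ) < i := by
  simp [below]

theorem above_castAdd (i : Fin N) : above (Fin.castAdd k i) =
    (above i).map (Fin.castAdd k) ++ (List.finRange k).map (Fin.natAdd N) := by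
  refine eq_append_map (pairwise_filter_finRange _) (pairwise_filter_finRange _)
    (List.pairwise_lt_finRange k) (fun x => ?_) (fun x => ?_)
  · rw [mem_above, mem_above]; rfl
  · rw [mem_above, Fin.val_natAdd, Fin.val_castAdd]
    simp only [List.mem_finRange, iff_true]
    omega

theorem below_castAdd (i : Fin N) : below (Fin.castAdd k i) = (below i).map (Fin.castAdd k) := by
  have := eq_append_map (l := below (Fin.castAdd k i)) (l₁ := below i) (l₂ := [])
    (pairwise_filter_finRange _) (pairwise_filter_finRange _) List.Pairwise.nil
    (fun x => by rw [mem_below, mem_below]; rfl)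
    (fun x => by
      rw [mem_below, Fin.val_natAdd, Fin.val_castAdd]
      simp only [List.not_mem_nil, iff_false]
      omega)
  simpa only [List.map_nil, List.append_nil] using this

theorem above_natAdd (t : Fin k) : above (Fin.natAdd N t) = (above t).map (Fin.natAdd N) := by
  have := eq_append_map (l := above (Fin.natAdd N t)) (l₁ := []) (l₂ := above t)
    (pairwise_filter_finRange _) List.Pairwise.nil (pairwise_filter_finRange _)
    (fun x => by
      rw [mem_above, Fin.val_natAdd, Fin.val_castAdd]
      simp only [List.not_mem_nil, iff_false]
      omega)
    (fun x => by rw [mem_above, mem_above, Fin.val_natAdd, Fin.val_natAdd]; omega)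
  simpa only [List.map_nil, List.nil_append] using this

theorem below_natAdd (t : Fin k) : below (Fin.natAdd N t) =
    (List.finRange N).map (Fin.castAdd k) ++ (below t).map (Fin.natAdd N) := by
  refine eq_append_map (pairwise_filter_finRange _) (List.pairwise_lt_finRange N)
    (pairwise_filter_finRange _) (fun x => ?_) (fun x => ?_)
  · rw [mem_below, Fin.val_natAdd, Fin.val_castAdd]
    simp only [List.mem_finRange, iff_true]
    omega
  · rw [mem_below, mem_below, Fin.val_natAdd, Fin.val_natAdd]; omega

theorem length_below {N : ℕ} (t : Fin N) : (below t).length = t := by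
  have h : below t = (List.finRange t).map (Fin.castLE t.2.le) := by
    apply list_eq_of_pairwise_lt (pairwise_filter_finRange _)
    · rw [List.pairwise_map]
      exact (List.pairwise_lt_finRange _).imp fun h => h
    · intro x
      rw [mem_below, List.mem_map]
      exact ⟨fun h => ⟨⟨x, h⟩, List.mem_finRange _, rfl⟩, fun ⟨y, _, hy⟩ => hy ▸ y.2⟩
  rw [h, List.length_map, List.length_finRange]

theorem length_above {N : ℕ} (t : Fin N) : (above t).length = N - 1 - t := by
  have h : List.finRange N = below t ++ t :: above t := by
    apply list_eq_of_pairwise_lt (List.pairwise_lt_finRange N)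
    · rw [List.pairwise_append, List.pairwise_cons]
      simp only [List.mem_cons, mem_below, mem_above, Fin.lt_def]
      refine ⟨pairwise_filter_finRange _, ⟨fun _ h => h, pairwise_filter_finRange _⟩, ?_⟩
      rintro a ha b (rfl | hb) <;> omega
    · intro x
      simp only [List.mem_finRange, List.mem_append, List.mem_cons, mem_below, mem_above,
        Fin.ext_iff, true_iff]
      omega
  have h1 := congrArg List.length h
  rw [List.length_append, List.length_cons, length_below, List.length_finRange] at h1
  omega

theorem list_prod_scalar_mem {ι κ : Type*} (g : ι → κ) (l : List ι) (c : ℂˣ)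
    (A : κ → (Module.End ℂ (Laurent (N + k)))ˣ)
    (h : ∀ x, (scalarUnit (Module.End ℂ (Laurent N)) c, A (g x)) ∈ tailGroup N k ν) :
    (scalarUnit (Module.End ℂ (Laurent N)) (c ^ l.length), ((l.map g).map A).prod) ∈
      tailGroup N k ν := by
  have := list_prod_mem_tailGroup ν g l (fun _ => scalarUnit (Module.End ℂ (Laurent N)) c) A
    fun x _ => h x
  rwa [List.map_const', List.prod_replicate, ← map_pow] at this

/-- Each of the `k` additional factors `ξ⁻¹` joining `i` to the tail contributes `q`, which turns
the normalization `q^{1-N-k}` into `q^{1-N}`. -/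
theorem yUnit_cast_mem (i : Fin N) :
    (yUnit q p i, yUnit q p (Fin.castAdd k i)) ∈ tailGroup N k ν := by
  have h1 := list_prod_mem_tailGroup (k := k) ν (Fin.castAdd k) (above i)
    (fun j => (xiUnit q i j)⁻¹) (fun j => (xiUnit q (Fin.castAdd k i) j)⁻¹)
    fun x _ => inv_mem (xiUnit_cast_cast_mem q ν i x)
  have h2 := list_prod_scalar_mem (N := N) ν (Fin.natAdd N) (List.finRange k) q
    (fun j => (xiUnit q (Fin.castAdd k i) j)⁻¹) fun x => by
      have := inv_mem (xiUnit_cast_nat_mem q ν i x)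
      rwa [Prod.inv_mk, ← map_inv, inv_inv] at this
  have h3 := list_prod_mem_tailGroup (k := k) ν (Fin.castAdd k) (below i)
    (fun j => xiUnit q j i) (fun j => xiUnit q j (Fin.castAdd k i))
    fun x _ => xiUnit_cast_cast_mem q ν x i
  have h := mul_mem (scalarUnit_mem ν (q ^ (1 - ((N + k : ℕ) : ℤ))))
    (mul_mem (mul_mem (mul_mem h1 h2) (shiftUnit_cast_mem p ν i)) h3)
  simp only [Prod.mk_mul_mk] at h
  rw [← List.prod_append, ← List.map_append, ← above_castAdd, ← below_castAdd, ← YUnit_eq,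
    ← yUnit_eq] at h
  convert h using 2
  rw [yUnit_eq, YUnit_eq, List.length_finRange, (scalarUnit_comm _ _).symm.eq]
  simp only [← mul_assoc]
  rw [← map_mul, ← zpow_natCast q k, ← zpow_add]
  congr 5
  push_cast
  ring

/-- The power of `q` collects `1 - N - k` from the normalization, `-(k - 1 - t)` from the later tail
sites, `-N` from the old sites and `t` from the earlier tail sites; the shift gives `p^ν`. -/
theorem yUnit_nat_mem (t : Fin k) :
    (scalarUnit (Module.End ℂ (Laurent N)) (p ^ ν * q ^ (2 * (1 + (t : ℤ) - N - k))),
      yUnit q p (Fin.natAdd N t)) ∈ tailGroup N k ν := by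
  have h1 := list_prod_scalar_mem (N := N) ν (Fin.natAdd N) (above t) q⁻¹
    (fun j => (xiUnit q (Fin.natAdd N t) j)⁻¹) fun x => by
      have := inv_mem (xiUnit_nat_nat_mem (N := N) q ν t x)
      rwa [Prod.inv_mk, ← map_inv] at this
  have h2 := list_prod_scalar_mem (k := k) ν (Fin.castAdd k) (List.finRange N) q⁻¹
    (fun j => xiUnit q j (Fin.natAdd N t)) fun x => xiUnit_cast_nat_mem q ν x t
  have h3 := list_prod_scalar_mem (N := N) ν (Fin.natAdd N) (below t) q
    (fun j => xiUnit q j (Fin.natAdd N t)) fun x => xiUnit_nat_nat_mem q ν x t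
  have h := mul_mem (scalarUnit_mem ν (q ^ (1 - ((N + k : ℕ) : ℤ))))
    (mul_mem (mul_mem h1 (shiftUnit_nat_mem p ν t)) (mul_mem h2 h3))
  simp only [Prod.mk_mul_mk] at h
  rw [← List.prod_append, ← List.map_append, ← above_natAdd, ← below_natAdd, ← YUnit_eq,
    ← yUnit_eq] at h
  convert h using 2
  simp only [← map_mul]
  congr 1
  have ht := t.2
  rw [length_above, length_below, List.length_finRange, inv_pow, inv_pow, ← zpow_natCast q,
    ← zpow_natCast q, ← zpow_natCast q, ← zpow_neg, ← zpow_neg]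
  have e : ∀ a b c d e : ℤ, e = a + b + c + d → p ^ ν * q ^ e =
      q ^ a * (q ^ b * p ^ ν * (q ^ c * q ^ d)) := by
    rintro a b c d _ rfl
    rw [zpow_add, zpow_add, zpow_add]
    ac_rfl
  apply e
  push_cast [Nat.sub_sub, Nat.cast_sub (show 1 + (t : ℕ) ≤ k by omega)]
  ring

end TailGroup

/-! ### Spin operators and a complete tail -/

section SpinTail

variable (q : ℂˣ) {n : ℕ} (hn : 2 ≤ n) (c : Fin n) {N : ℕ}

theorem chi_append {k : ℕ} (t : ℤ) (P : Fin (N + k) → Prop) [DecidablePred P] (e : Fin N → Fin n)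
    (f : Fin k → Fin n) : chi q c t P (Fin.append e f) =
      chi q c t (fun j => P (Fin.castAdd k j)) e *
        ∏ u, if P (Fin.natAdd N u) then kap q c t (f u) else 1 := by
  rw [chi, chi, Fin.prod_univ_add]
  simp only [Fin.append_left, Fin.append_right]

include hn

/-- A complete tail contains `v_ε` and `v_{ε+1}` once each, with inverse eigenvalues. So the `K`
factors of `E_ε` to the right of an old site do not see the tail. -/
theorem prod_kap_rev (t : ℤ) : ∏ u : Fin n, kap q c t (Fin.rev u) = 1 := by
  have h : ∏ u : Fin n, kap q c t (Fin.rev u) = ∏ u : Fin n, kap q c t u :=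
    Equiv.prod_comp Fin.revPerm (kap q c t)
  have hne := pos_ne hn c
  rw [h, Finset.prod_eq_mul (pos c) c hne]
  · simp [kap, hne, hne.symm, mul_inv_cancel₀ (zpow_ne_zero t q.ne_zero)]
  · intro a _ ha
    simp [kap, ha.1, ha.2]
  · simp
  · simp

omit hn in
-- A complete tail already contains every basis vector, so changing one of them creates a
-- repetition. This makes `E` and `F` at tail sites vanish in the wedge product.
theorem not_injective_update_rev (u : Fin n) {a : Fin n} (ha : a ≠ Fin.rev u) :
    ¬ Function.Injective (Function.update (Fin.rev : Fin n → Fin n) u a) := by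
  intro h
  have h1 : Fin.rev a ≠ u := fun h' => ha (by rw [← h', Fin.rev_rev])
  have := h (a₁ := Fin.rev a) (a₂ := u) (by simp [h1])
  exact h1 this

theorem diagOp_appVec (t : ℤ) (v : Spin n N) :
    diagOp q c t (fun _ => True) (appVec (Fin.rev : Fin n → Fin n) v) =
      appVec Fin.rev (diagOp q c t (fun _ => True) v) := by
  have : diagOp q c t (fun _ => True) ∘ₗ appVec (N := N) (Fin.rev : Fin n → Fin n) =
      appVec Fin.rev ∘ₗ diagOp q c t (fun _ => True) := by
    refine (vecBasis n N).ext fun e => ?_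
    simp only [vecBasis_apply, LinearMap.comp_apply, diagOp_vec, map_smul, appVec_vec, chi_append,
      if_true, prod_kap_rev q hn c, mul_one]
  exact LinearMap.congr_fun this v

theorem spinE_cast (i : Fin N) (v : Spin n N) :
    spinE q c (Fin.castAdd n i) (appVec (Fin.rev : Fin n → Fin n) v) =
      appVec Fin.rev (spinE q c i v) := by
  have : spinE q c (Fin.castAdd n i) ∘ₗ appVec (N := N) (Fin.rev : Fin n → Fin n) =
      appVec Fin.rev ∘ₗ spinE q c i := by
    refine (vecBasis n N).ext fun e => ?_
    have h1 : ∀ u : Fin n, Fin.castAdd n i < Fin.natAdd N u := fun u => by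
      rw [Fin.lt_def, Fin.val_castAdd, Fin.val_natAdd]; omega
    have h2 : chi q c 1 (fun j => Fin.castAdd n i < Fin.castAdd n j) e =
      chi q c 1 (fun j => i < j) e := rfl
    rw [vecBasis_apply, LinearMap.comp_apply, LinearMap.comp_apply, appVec_vec, spinE_vec,
      spinE_vec, map_smul, chi_append, Fin.append_left, append_update_left, h2]
    simp only [h1, if_true, prod_kap_rev q hn c, mul_one]
    split_ifs <;> simp [appVec_vec]
  exact LinearMap.congr_fun this v

omit hn in
theorem spinF_cast (i : Fin N) (v : Spin n N) :
    spinF q c (Fin.castAdd n i) (appVec (Fin.rev : Fin n → Fin n) v) =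
      appVec Fin.rev (spinF q c i v) := by
  have : spinF q c (Fin.castAdd n i) ∘ₗ appVec (N := N) (Fin.rev : Fin n → Fin n) =
      appVec Fin.rev ∘ₗ spinF q c i := by
    refine (vecBasis n N).ext fun e => ?_
    have h1 : ∀ u : Fin n, ¬ Fin.natAdd N u < Fin.castAdd n i := fun u => by
      rw [Fin.lt_def, Fin.val_castAdd, Fin.val_natAdd]; omega
    have h2 : chi q c (-1) (fun j => Fin.castAdd n j < Fin.castAdd n i) e =
      chi q c (-1) (fun j => j < i) e := rfl
    rw [vecBasis_apply, LinearMap.comp_apply, LinearMap.comp_apply, appVec_vec, spinF_vec,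
      spinF_vec, map_smul, chi_append, Fin.append_left, append_update_left, h2]
    simp only [h1, if_false, Finset.prod_const_one, mul_one]
    split_ifs <;> simp [appVec_vec]
  exact LinearMap.congr_fun this v

variable (hq : (q : ℂ) + (q : ℂ)⁻¹ ≠ 0) (ν : ℤ)

include hq

theorem cls_spinE_nat (u : Fin n) (g : Laurent N) (v : Spin n N) :
    cls n q (N + n) (appMono n ν g ⊗ₜ
      spinE q c (Fin.natAdd N u) (appVec (Fin.rev : Fin n → Fin n) v)) = 0 := by
  refine mem_of_vec (K := LinearMap.ker (cls n q (N + n) ∘ₗ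
    TensorProduct.mk ℂ (Laurent (N + n)) (Spin n (N + n)) (appMono n ν g) ∘ₗ
      spinE q c (Fin.natAdd N u) ∘ₗ appVec (Fin.rev : Fin n → Fin n))) (fun e => ?_) v
  simp only [LinearMap.mem_ker, LinearMap.comp_apply, TensorProduct.mk_apply]
  rw [appVec_vec, spinE_vec, Fin.append_right]
  split_ifs with h
  · rw [append_update_right, ← appVec_vec, TensorProduct.tmul_smul, map_smul,
      cls_appMono_eq_zero hq ν (not_injective_update_rev u (h ▸ pos_ne hn c)), smul_zero]
  · rw [smul_zero, TensorProduct.tmul_zero, map_zero]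

theorem cls_spinF_nat (u : Fin n) (g : Laurent N) (v : Spin n N) :
    cls n q (N + n) (appMono n ν g ⊗ₜ
      spinF q c (Fin.natAdd N u) (appVec (Fin.rev : Fin n → Fin n) v)) = 0 := by
  refine mem_of_vec (K := LinearMap.ker (cls n q (N + n) ∘ₗ
    TensorProduct.mk ℂ (Laurent (N + n)) (Spin n (N + n)) (appMono n ν g) ∘ₗ
      spinF q c (Fin.natAdd N u) ∘ₗ appVec (Fin.rev : Fin n → Fin n))) (fun e => ?_) v
  simp only [LinearMap.mem_ker, LinearMap.comp_apply, TensorProduct.mk_apply]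
  rw [appVec_vec, spinF_vec, Fin.append_right]
  split_ifs with h
  · rw [append_update_right, ← appVec_vec, TensorProduct.tmul_smul, map_smul,
      cls_appMono_eq_zero hq ν (not_injective_update_rev u (h ▸ (pos_ne hn c).symm)), smul_zero]
  · rw [smul_zero, TensorProduct.tmul_zero, map_zero]

end SpinTail

/-! ### Operators on the wedge products compatible with the tail -/

theorem onWedge_cls {n : ℕ} {q : ℂˣ} {N : ℕ} {A : Module.End ℂ (Tens n N)} (hA : Descends q A)
    (x : Tens n N) : onWedge q A (cls n q N x) = cls n q N (A x) := by
  rw [onWedge, dif_pos hA]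
  rfl

theorem onWedge_ext {n : ℕ} {q : ℂˣ} {N : ℕ} {A : Module.End ℂ (Tens n N)} (hA : Descends q A)
    {B : Module.End ℂ (Wedge n q N)} (h : ∀ x, B (cls n q N x) = cls n q N (A x)) :
    onWedge q A = B := by
  refine LinearMap.ext fun w => ?_
  obtain ⟨x, rfl⟩ := (Omega n q N).mkQ_surjective w
  rw [h, onWedge_cls hA]

section WedgeAlgebra

variable {n : ℕ} {q : ℂˣ} (hq : (q : ℂ) + (q : ℂ)⁻¹ ≠ 0) (N : ℕ) (ν : ℤ)

/-- Appending the complete tail `z^ν v_n ∧ ⋯ ∧ z^ν v_1`. -/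
abbrev appTail : Wedge n q N →ₗ[ℂ] Wedge n q (N + n) :=
  appWedge hq N ν (Fin.rev : Fin n → Fin n)

/-- Pairs `(B, A)` of operators on the wedge products such that `A` acts on a wedge with a complete
tail as `B` acts on the wedge without it, up to wedges without a complete tail. -/
def tailAlgebra : Subalgebra ℂ (Module.End ℂ (Wedge n q N) × Module.End ℂ (Wedge n q (N + n))) where
  carrier := {C | (∀ w ∈ wedgeSpan n q (Low ν), C.1 w ∈ wedgeSpan n q (Low ν)) ∧
    (∀ w ∈ wedgeSpan n q (Few n ν), C.2 w ∈ wedgeSpan n q (Few n ν)) ∧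
    ∀ w ∈ wedgeSpan n q (Low ν), C.2 (appTail hq N ν w) - appTail hq N ν (C.1 w) ∈
      wedgeSpan n q (Few n ν)}
  mul_mem' := fun {C D} hC hD => ⟨fun w hw => hC.1 _ (hD.1 w hw),
    fun w hw => hC.2.1 _ (hD.2.1 w hw), fun w hw => by
      have h1 := hC.2.1 _ (hD.2.2 w hw)
      have h2 := hC.2.2 _ (hD.1 w hw)
      rw [map_sub] at h1
      have := Submodule.add_mem _ h1 h2
      rwa [sub_add_sub_cancel] at this⟩
  add_mem' := fun {C D} hC hD => ⟨fun w hw => Submodule.add_mem _ (hC.1 w hw) (hD.1 w hw),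
    fun w hw => Submodule.add_mem _ (hC.2.1 w hw) (hD.2.1 w hw), fun w hw => by
      have := Submodule.add_mem _ (hC.2.2 w hw) (hD.2.2 w hw)
      rw [Prod.fst_add, Prod.snd_add, LinearMap.add_apply, LinearMap.add_apply, map_add]
      rwa [← add_sub_add_comm] at this⟩
  algebraMap_mem' := fun c => ⟨fun w hw => Submodule.smul_mem _ c hw,
    fun w hw => Submodule.smul_mem _ c hw, fun w _ => by
      rw [Prod.algebraMap_apply, Module.algebraMap_end_apply, Module.algebraMap_end_apply,
        map_smul, sub_self]
      exact Submodule.zero_mem _⟩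

variable {N}

theorem mem_tailAlgebra_of_cls {B : Module.End ℂ (Wedge n q N)} {A : Module.End ℂ (Wedge n q (N + n))}
    (h1 : ∀ f ∈ monoSpan (Low ν), ∀ v, B (cls n q N (f ⊗ₜ v)) ∈ wedgeSpan n q (Low ν))
    (h2 : ∀ f ∈ monoSpan (Few n ν), ∀ v, A (cls n q (N + n) (f ⊗ₜ v)) ∈ wedgeSpan n q (Few n ν))
    (h3 : ∀ f ∈ monoSpan (Low ν), ∀ v, A (appTail hq N ν (cls n q N (f ⊗ₜ v))) -
      appTail hq N ν (B (cls n q N (f ⊗ₜ v))) ∈ wedgeSpan n q (Few n ν)) :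
    (B, A) ∈ tailAlgebra hq N ν :=
  ⟨fun _ hw => wedgeSpan_le (W := (wedgeSpan n q (Low ν)).comap B)
      (fun _ _ _ hm => h1 _ (mono_mem hm) _) hw,
    fun _ hw => wedgeSpan_le (W := (wedgeSpan n q (Few n ν)).comap A)
      (fun _ _ _ hm => h2 _ (mono_mem hm) _) hw,
    fun _ hw => wedgeSpan_le (W := (wedgeSpan n q (Few n ν)).comap
      (A ∘ₗ appTail hq N ν - appTail hq N ν ∘ₗ B)) (fun _ _ _ hm => h3 _ (mono_mem hm) _) hw⟩

theorem onWedge_lTensor_mem {B : Module.End ℂ (Spin n N)} {A : Module.End ℂ (Spin n (N + n))}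
    (hB : Descends q (B.lTensor (Laurent N))) (hA : Descends q (A.lTensor (Laurent (N + n))))
    (h : ∀ v, A (appVec Fin.rev v) = appVec Fin.rev (B v)) :
    (onWedge q (B.lTensor (Laurent N)), onWedge q (A.lTensor (Laurent (N + n)))) ∈
      tailAlgebra hq N ν := by
  refine mem_tailAlgebra_of_cls hq ν (fun f hf v => ?_) (fun f hf v => ?_) (fun f hf v => ?_)
  · rw [onWedge_cls hB, LinearMap.lTensor_tmul]
    exact cls_tmul_mem hq (squeezable_low N ν) hf _
  · rw [onWedge_cls hA, LinearMap.lTensor_tmul]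
    exact cls_tmul_mem hq (squeezable_few _ n ν) hf _
  · rw [onWedge_cls hB, appWedge_cls, onWedge_cls hA, LinearMap.lTensor_tmul,
      LinearMap.lTensor_tmul, appWedge_cls, h, sub_self]
    exact Submodule.zero_mem _

/-- Old sites reproduce the `N`-site operator, and tail sites act by the scalars `b c_u`. Root
vectors take `b = 0` and the Hamiltonians `b = 1`. -/
theorem onWedge_sum_mem {Y : Fin N → (Module.End ℂ (Laurent N))ˣ}
    {Y' : Fin (N + n) → (Module.End ℂ (Laurent (N + n)))ˣ} {B : Fin N → Module.End ℂ (Spin n N)}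
    {B' : Fin (N + n) → Module.End ℂ (Spin n (N + n))} {c : Fin n → ℂˣ} {b : ℂ}
    (hd : Descends q (∑ i, TensorProduct.map (Y i).val (B i)))
    (hd' : Descends q (∑ i, TensorProduct.map (Y' i).val (B' i)))
    (hY : ∀ i, (Y i, Y' (Fin.castAdd n i)) ∈ tailGroup N n ν)
    (hY' : ∀ u, (scalarUnit (Module.End ℂ (Laurent N)) (c u), Y' (Fin.natAdd N u)) ∈
      tailGroup N n ν)
    (hB : ∀ i v, B' (Fin.castAdd n i) (appVec Fin.rev v) = appVec Fin.rev (B i v))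
    (hB' : ∀ u (g : Laurent N) (v : Spin n N), cls n q (N + n) (appMono n ν g ⊗ₜ
      B' (Fin.natAdd N u) (appVec (Fin.rev : Fin n → Fin n) v)) =
      b • cls n q (N + n) (appMono n ν g ⊗ₜ appVec (Fin.rev : Fin n → Fin n) v)) :
    (onWedge q (∑ i, TensorProduct.map (Y i).val (B i)) +
        algebraMap ℂ _ (b * ∑ u, ((c u : ℂˣ) : ℂ)),
      onWedge q (∑ i, TensorProduct.map (Y' i).val (B' i))) ∈ tailAlgebra hq N ν := by
  have hfew : ∀ x, ∀ f ∈ monoSpan (Few n ν), (Y' x).val f ∈ monoSpan (Few n ν) := fun x => by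
    induction x using Fin.addCases with
    | left i => exact (hY i).2.1.1
    | right u => exact (hY' u).2.1.1
  refine mem_tailAlgebra_of_cls hq ν (fun f hf v => ?_) (fun f hf v => ?_) (fun f hf v => ?_)
  · rw [LinearMap.add_apply, onWedge_cls hd, LinearMap.sum_apply, map_sum,
      Module.algebraMap_end_apply]
    refine Submodule.add_mem _ (Submodule.sum_mem _ fun i _ => ?_)
      (Submodule.smul_mem _ _ (cls_tmul_mem hq (squeezable_low N ν) hf _))
    rw [TensorProduct.map_tmul]
    exact cls_tmul_mem hq (squeezable_low N ν) ((hY i).1.1 f hf) _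
  · rw [onWedge_cls hd', LinearMap.sum_apply, map_sum]
    refine Submodule.sum_mem _ fun i _ => ?_
    rw [TensorProduct.map_tmul]
    exact cls_tmul_mem hq (squeezable_few _ n ν) (hfew i f hf) _
  · rw [LinearMap.add_apply, onWedge_cls hd, LinearMap.sum_apply, map_sum,
      Module.algebraMap_end_apply, appWedge_cls, onWedge_cls hd', LinearMap.sum_apply, map_sum,
      Fin.sum_univ_add, map_add, map_sum, map_smul, appWedge_cls, add_sub_add_comm,
      ← Finset.sum_sub_distrib, mul_comm b, mul_smul, Finset.sum_smul, ← Finset.sum_sub_distrib]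
    refine Submodule.add_mem _ (Submodule.sum_mem _ fun i _ => ?_)
      (Submodule.sum_mem _ fun u _ => ?_)
    · rw [TensorProduct.map_tmul, TensorProduct.map_tmul, appWedge_cls, hB, ← map_sub,
        ← TensorProduct.sub_tmul]
      exact cls_tmul_mem hq (squeezable_few _ n ν) ((hY i).2.2 f hf) _
    · have h1 := (hY' u).2.2 f hf
      rw [scalarUnit_apply, map_smul] at h1
      rw [TensorProduct.map_tmul, ← hB' u f v, ← map_smul, TensorProduct.smul_tmul', ← map_sub,
        ← TensorProduct.sub_tmul]
      exact cls_tmul_mem hq (squeezable_few _ n ν) h1 _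

variable (p : ℂˣ)

theorem onWedge_genOp_mem (hn : 2 ≤ n) (x : Gen n) :
    (onWedge q (genOp n q p N x), onWedge q (genOp n q p (N + n) x)) ∈ tailAlgebra hq N ν := by
  have hd := descends_genOp (N := N) q p hn hq x
  have hd' := descends_genOp (N := N + n) q p hn hq x
  have hY : ∀ (l : ℤ) (i : Fin N), (yUnit q p i ^ l, yUnit q p (Fin.castAdd n i) ^ l) ∈
      tailGroup N n ν := fun l i => zpow_mem (yUnit_cast_mem q p ν i) l
  have hY' : ∀ (l : ℤ) (u : Fin n), (scalarUnit (Module.End ℂ (Laurent N))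
      ((p ^ ν * q ^ (2 * (1 + (u : ℤ) - N - n))) ^ l), yUnit q p (Fin.natAdd N u) ^ l) ∈
      tailGroup N n ν := fun l u => by
    rw [map_zpow]
    exact zpow_mem (yUnit_nat_mem q p ν u) l
  cases x with
  | E c =>
    have := onWedge_sum_mem hq ν (b := 0) (B := spinE q c) (B' := spinE q c) hd hd' (hY _) (hY' _)
      (spinE_cast q hn c) (fun u g v => by rw [zero_smul]; exact cls_spinE_nat q hn c hq ν u g v)
    rwa [zero_mul, map_zero, add_zero] at this
  | F c =>
    have := onWedge_sum_mem hq ν (b := 0) (B := spinF q c) (B' := spinF q c) hd hd' (hY _) (hY' _)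
      (spinF_cast q c) (fun u g v => by rw [zero_smul]; exact cls_spinF_nat q hn c hq ν u g v)
    rwa [zero_mul, map_zero, add_zero] at this
  | K c => exact onWedge_lTensor_mem hq ν hd hd' (diagOp_appVec q hn c 1)
  | Kinv c => exact onWedge_lTensor_mem hq ν hd hd' (diagOp_appVec q hn c (-1))

theorem onWedge_U0_mem (hn : 2 ≤ n) (x : FreeAlgebra ℂ (Gen n)) :
    (onWedge q (U0 n q p N x), onWedge q (U0 n q p (N + n) x)) ∈ tailAlgebra hq N ν := by
  have hd : ∀ (N : ℕ) x, Descends q (U0 n q p N x) := fun N x => descends_U0 q p hn hq x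
  induction x using FreeAlgebra.induction with
  | grade0 r =>
    have : ∀ N, onWedge q (U0 n q p N (algebraMap ℂ _ r)) = algebraMap ℂ _ r := fun N =>
      onWedge_ext (hd N _) fun x => by
        rw [AlgHom.commutes, Module.algebraMap_end_apply, Module.algebraMap_end_apply, map_smul]
    rw [this, this]
    exact Subalgebra.algebraMap_mem (tailAlgebra hq N ν) r
  | grade1 x =>
    rw [U0, U0, FreeAlgebra.lift_ι_apply, FreeAlgebra.lift_ι_apply]
    exact onWedge_genOp_mem hq ν p hn x
  | mul a b ha hb =>
    have : ∀ N, onWedge q (U0 n q p N (a * b)) =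
        onWedge q (U0 n q p N a) * onWedge q (U0 n q p N b) := fun N =>
      onWedge_ext (hd N _) fun x => by
        rw [Module.End.mul_apply, onWedge_cls (hd N b), onWedge_cls (hd N a), map_mul,
          Module.End.mul_apply]
    rw [this, this]
    exact mul_mem ha hb
  | add a b ha hb =>
    have : ∀ N, onWedge q (U0 n q p N (a + b)) =
        onWedge q (U0 n q p N a) + onWedge q (U0 n q p N b) := fun N =>
      onWedge_ext (hd N _) fun x => by
        rw [LinearMap.add_apply, onWedge_cls (hd N b), onWedge_cls (hd N a), map_add (U0 n q p N),
          LinearMap.add_apply, map_add]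
    rw [this, this]
    exact add_mem ha hb

theorem onWedge_hOp_mem (l : ℤ) :
    (onWedge q (hOp n q p N l) + algebraMap ℂ _
        (∑ u : Fin n, (((p ^ ν * q ^ (2 * (1 + (u : ℤ) - N - n))) ^ l : ℂˣ) : ℂ)),
      onWedge q (hOp n q p (N + n) l)) ∈ tailAlgebra hq N ν := by
  have e : ∀ N, hOp n q p N l = ∑ i, TensorProduct.map (yUnit q p i ^ l).val LinearMap.id :=
    fun N => map_sum (LinearMap.rTensorHom (Spin n N)) _ _
  have hd := descends_hOp (N := N) q p n hq l
  have hd' := descends_hOp (N := N + n) q p n hq l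
  rw [e] at hd hd'
  have := onWedge_sum_mem hq ν (b := 1) (B := fun _ => LinearMap.id) (B' := fun _ => LinearMap.id)
    hd hd' (fun i => zpow_mem (yUnit_cast_mem q p ν i) l)
    (c := fun u => (p ^ ν * q ^ (2 * (1 + (u : ℤ) - N - n))) ^ l) (fun u => by
      rw [map_zpow]
      exact zpow_mem (yUnit_nat_mem q p ν u) l)
    (fun _ _ => rfl) (fun _ _ _ => by rw [one_smul]; rfl)
  rw [one_mul] at this
  rwa [e, e]

end WedgeAlgebra

/-! ### The spaces `V_M^N` and the truncation map -/

section Truncation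

variable {n : ℕ} (M : ℤ) (s r : ℕ)

/-- The value of the last `n` entries of the vacuum sequence of length `s + n r + n`. -/
def tailValue (n : ℕ) (M : ℤ) (s r : ℕ) : ℤ := ((s : ℤ) - M) / (n : ℤ) + r + 1

theorem vac_tail (u : Fin n) : vac n M s (s + n * r + u) = tailValue n M s r := by
  have hn : 0 < n := u.pos
  have h : (s + n * r + u - s) / n = r := by
    rw [show s + n * r + u - s = u + n * r by omega, Nat.add_mul_div_left _ _ hn,
      Nat.div_eq_of_lt u.2, zero_add]
  rw [vac, if_neg (by omega), h, tailValue]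
  push_cast
  ring

theorem vac_last {j : ℕ} (hn : 0 < n) (hj : j + 1 = s + n * r) :
    vac n M s j = tailValue n M s r - 1 := by
  cases r with
  | zero =>
    rw [vac, if_pos (by omega), tailValue]
    push_cast
    ring
  | succ r =>
    have h := vac_tail (n := n) M s r ⟨n - 1, by omega⟩
    have e : s + n * r + (⟨n - 1, by omega⟩ : Fin n) = j := by
      rw [mul_add] at hj
      simp only
      omega
    rw [e] at h
    rw [h, tailValue, tailValue]
    push_cast
    ring

/-- By monotonicity a bound on the last exponent bounds all of them. For `N = 0` both conditions on
the exponents are vacuous. -/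
theorem admissible_iff {N : ℕ} {ν : ℤ} (h : ∀ j, j + 1 = N → vac n M s j = ν - 1)
    {m : Fin N → ℤ} {e : Fin N → Fin n} : Admissible M s m e ↔ NormallyOrdered m e ∧ Low ν m := by
  refine and_congr_right fun hm => ⟨fun h1 i => ?_, fun h1 i hi => ?_⟩
  · have h2 := h1 ⟨N - 1, by have := i.2; omega⟩ (by have := i.2; simp only; omega)
    rw [h _ (by have := i.2; simp only; omega)] at h2
    have h3 : m i ≤ m ⟨N - 1, by have := i.2; omega⟩ :=
      hm.1 (by rw [Fin.le_def]; have := i.2; simp only; omega)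
    omega
  · have := h1 i
    rw [h _ hi]
    omega

theorem VM_eq_wedgeSpan {q : ℂˣ} {N : ℕ} {ν : ℤ} (h : ∀ j, j + 1 = N → vac n M s j = ν - 1) :
    VM n q M s N = wedgeSpan n q (Low ν) := by
  rw [VM, wedgeSpan]
  simp only [admissible_iff M s h, and_assoc]

end Truncation

/-- `Fin n` has only one order automorphism. Hence the spins of a sorted block of `n` equal
exponents are forced. -/
theorem rev_of_strictAnti {n : ℕ} {f : Fin n → Fin n} (h : ∀ i j, i < j → f j < f i) :
    f = Fin.rev := by
  have hm : StrictMono (Fin.rev ∘ f) := fun i j hij => Fin.rev_lt_rev.mpr (h i j hij)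
  have h1 : Fin.rev ∘ f = id := by
    have := Subsingleton.elim (hm.orderIsoOfSurjective _
      (Finite.surjective_of_injective hm.injective)) (OrderIso.refl _)
    funext i
    exact congrArg (fun φ : Fin n ≃o Fin n => φ i) this
  funext i
  have := congrFun h1 i
  simp only [Function.comp_apply, id_eq] at this
  rw [← Fin.rev_rev (f i), this]

/-! ### Recognizing a complete tail -/

section Split

variable {n N : ℕ} {ν : ℤ} {m : Fin (N + n) → ℤ} {e : Fin (N + n) → Fin n}

theorem append_of_tail (hs : Sorted m e) (ht : ∀ u : Fin n, m (Fin.natAdd N u) = ν) :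
    m = Fin.append (fun i => m (Fin.castAdd n i)) (fun _ => ν) ∧
      e = Fin.append (fun i => e (Fin.castAdd n i)) Fin.rev := by
  constructor
  · funext x
    induction x using Fin.addCases with
    | left x => rw [Fin.append_left]
    | right x => rw [Fin.append_right, ht]
  · have h : (fun u => e (Fin.natAdd N u)) = (Fin.rev : Fin n → Fin n) := by
      refine rev_of_strictAnti fun i j hij => ?_
      have := hs (Fin.natAdd N i) (Fin.natAdd N j) (by
        rw [Fin.lt_def, Fin.val_natAdd, Fin.val_natAdd]; rw [Fin.lt_def] at hij; omega)
      rw [ht, ht] at this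
      exact (this.resolve_left (lt_irrefl _)).2
    funext x
    induction x using Fin.addCases with
    | left x => rw [Fin.append_left]
    | right x => rw [Fin.append_right]; exact congrFun h x

/-- The tail uses every spin. An earlier site with exponent `ν` would share its spin with a tail
site of the same exponent, against strict sorting. -/
theorem low_of_tail (hs : Sorted m e) (ht : ∀ u : Fin n, m (Fin.natAdd N u) = ν) :
    Low ν fun i => m (Fin.castAdd n i) := by
  intro i
  have hn : 0 < n := (e (Fin.castAdd n i)).pos
  have hlt : ∀ u, Fin.castAdd n i < Fin.natAdd N u := fun u => by
    rw [Fin.lt_def, Fin.val_castAdd, Fin.val_natAdd]; omega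
  set c := e (Fin.castAdd n i)
  have h1 := hs (Fin.castAdd n i) (Fin.natAdd N (Fin.rev c)) (hlt _)
  rw [ht] at h1
  refine h1.resolve_right fun h2 => ?_
  have h3 := congrFun (append_of_tail hs ht).2 (Fin.natAdd N (Fin.rev c))
  rw [Fin.append_right, Fin.rev_rev] at h3
  exact absurd h3 h2.2.ne

/-- If the tail exponent at `u` is below `ν`, monotonicity confines the exponents `ν` to later tail
sites. -/
theorem few_of_not_tail (hm : Monotone m) (hν : ∀ x, m x ≤ ν)
    (ht : ¬ ∀ u : Fin n, m (Fin.natAdd N u) = ν) : Few n ν m := by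
  refine ⟨hν, ?_⟩
  push Not at ht
  obtain ⟨u, hu⟩ := ht
  have h1 : (Finset.univ.filter fun x => m x = ν) ⊆
      ((Finset.univ : Finset (Fin n)).erase u).map (Fin.natAddEmb N) := by
    intro x hx
    rw [Finset.mem_filter] at hx
    have h2 : Fin.natAdd N u < x := by
      by_contra h
      have h3 := hm (not_lt.mp h)
      have h4 := hν (Fin.natAdd N u)
      exact hu (le_antisymm h4 (hx.2 ▸ h3))
    induction x using Fin.addCases with
    | left x =>
      rw [Fin.lt_def, Fin.val_castAdd, Fin.val_natAdd] at h2
      omega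
    | right x =>
      rw [Finset.mem_map]
      refine ⟨x, ?_, rfl⟩
      rw [Finset.mem_erase]
      exact ⟨by rintro rfl; exact lt_irrefl _ h2, Finset.mem_univ _⟩
  refine (Finset.card_le_card h1).trans_lt ?_
  rw [Finset.card_map, Finset.card_erase_of_mem (Finset.mem_univ _), Finset.card_univ,
    Fintype.card_fin]
  have := u.pos
  omega

theorem not_tail_of_few (h : Few n ν m) : ¬ ∀ u : Fin n, m (Fin.natAdd N u) = ν := by
  intro ht
  have h1 : (Finset.univ : Finset (Fin n)).map (Fin.natAddEmb N) ⊆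
      (Finset.univ.filter fun x => m x = ν) := by
    intro x hx
    rw [Finset.mem_map] at hx
    obtain ⟨u, -, rfl⟩ := hx
    rw [Finset.mem_filter]
    exact ⟨Finset.mem_univ _, ht u⟩
  have h2 := Finset.card_le_card h1
  rw [Finset.card_map, Finset.card_univ, Fintype.card_fin] at h2
  exact absurd h.2 (by omega)

theorem sorted_append {m : Fin N → ℤ} {e : Fin N → Fin n} (hs : Sorted m e) (hm : Low ν m) :
    Sorted (Fin.append m fun _ : Fin n => ν) (Fin.append e Fin.rev) := by
  intro x y hxy
  induction x using Fin.addCases with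
  | left x =>
    induction y using Fin.addCases with
    | left y => simpa only [Fin.append_left] using hs x y hxy
    | right y => simpa only [Fin.append_left, Fin.append_right] using Or.inl (hm x)
  | right x =>
    induction y using Fin.addCases with
    | left y => rw [Fin.lt_def, Fin.val_castAdd, Fin.val_natAdd] at hxy; omega
    | right y =>
      rw [Fin.lt_def, Fin.val_natAdd, Fin.val_natAdd] at hxy
      simp only [Fin.append_right, true_and, lt_irrefl, false_or]
      rw [Fin.rev_lt_rev, Fin.lt_def]
      omega

end Split

/-! ### Removing a complete tail -/

section Rho

variable {n : ℕ} {q : ℂˣ} (hq : (q : ℂ) + (q : ℂ)⁻¹ ≠ 0) (N : ℕ) (ν : ℤ)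

open Classical in
/-- The removal of a complete tail of wedges. -/
def dropTail : Wedge n q (N + n) →ₗ[ℂ] Wedge n q N :=
  (wedgeBasis hq (N + n)).constr ℂ fun b =>
    if ∀ u : Fin n, b.1.1 (Fin.natAdd N u) = ν then
      wedge n q (fun i => b.1.1 (Fin.castAdd n i)) (fun i => b.1.2 (Fin.castAdd n i)) else 0

open Classical in
theorem dropTail_wedge {m : Fin (N + n) → ℤ} {e : Fin (N + n) → Fin n} (hs : Sorted m e) :
    dropTail hq N ν (wedge n q m e) =
      if ∀ u : Fin n, m (Fin.natAdd N u) = ν then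
        wedge n q (fun i => m (Fin.castAdd n i)) (fun i => e (Fin.castAdd n i)) else 0 := by
  have h := wedgeBasis_apply hq (⟨(m, e), hs⟩ : Label n (N + n))
  simp only at h
  rw [← h, dropTail, Module.Basis.constr_basis]

variable {N ν}

theorem dropTail_appTail {w : Wedge n q N} (hw : w ∈ wedgeSpan n q (Low ν)) :
    dropTail hq N ν (appTail hq N ν w) = w := by
  refine wedgeSpan_le (W := LinearMap.eqLocus (dropTail hq N ν ∘ₗ appTail hq N ν) LinearMap.id)
    (fun m e hs hm => ?_) hw
  rw [LinearMap.mem_eqLocus, LinearMap.comp_apply, appWedge_wedge,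
    dropTail_wedge hq N ν (sorted_append hs hm), if_pos (fun u => Fin.append_right _ _ u)]
  simp only [Fin.append_left, LinearMap.id_apply]

theorem dropTail_few {w : Wedge n q (N + n)} (hw : w ∈ wedgeSpan n q (Few n ν)) :
    dropTail hq N ν w = 0 := by
  refine wedgeSpan_le (W := LinearMap.ker (dropTail hq N ν)) (fun m e hs hm => ?_) hw
  rw [LinearMap.mem_ker, dropTail_wedge hq N ν hs, if_neg (not_tail_of_few hm)]

theorem appTail_mem {w : Wedge n q N} (hw : w ∈ wedgeSpan n q (Low ν)) :
    appTail hq N ν w ∈ wedgeSpan n q (Low (N := N + n) (ν + 1)) := by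
  refine wedgeSpan_le (W := (wedgeSpan n q (Low (N := N + n) (ν + 1))).comap (appTail hq N ν))
    (fun m e hs hm => ?_) hw
  rw [Submodule.mem_comap, appWedge_wedge]
  refine Submodule.subset_span ⟨_, _, normallyOrdered_iff.mpr (sorted_append hs hm), fun x => ?_,
    rfl⟩
  induction x using Fin.addCases with
  | left x => rw [Fin.append_left]; exact (hm x).trans (lt_add_one ν)
  | right x => rw [Fin.append_right]; exact lt_add_one ν

theorem few_le_low {N : ℕ} : wedgeSpan n q (Few (N := N) n ν) ≤ wedgeSpan n q (Low (ν + 1)) :=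
  wedgeSpan_le fun m e hs hm => Submodule.subset_span
    ⟨m, e, normallyOrdered_iff.mpr hs, fun i => Int.lt_add_one_of_le (hm.1 i), rfl⟩

/-- Every normally ordered wedge with exponents at most `ν` either is an appended wedge or has too
few exponents `ν`. Checking an operator on these two kinds is enough. -/
theorem low_le_sup : wedgeSpan n q (Low (N := N + n) (ν + 1)) ≤
    (wedgeSpan n q (Low (N := N) ν)).map (appTail hq N ν) ⊔ wedgeSpan n q (Few n ν) := by
  refine wedgeSpan_le fun m e hs hm => ?_
  by_cases ht : ∀ u : Fin n, m (Fin.natAdd N u) = ν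
  · refine Submodule.mem_sup_left ⟨_, Submodule.subset_span
      ⟨fun i => m (Fin.castAdd n i), fun i => e (Fin.castAdd n i), normallyOrdered_iff.mpr ?_,
        low_of_tail hs ht, rfl⟩, ?_⟩
    · exact fun i j hij => hs (Fin.castAdd n i) (Fin.castAdd n j) hij
    · rw [appWedge_wedge, ← (append_of_tail hs ht).1, ← (append_of_tail hs ht).2]
  · refine Submodule.mem_sup_right (Submodule.subset_span
      ⟨m, e, normallyOrdered_iff.mpr hs, ?_, rfl⟩)
    exact few_of_not_tail (normallyOrdered_iff.mpr hs).1 (fun x => Int.lt_add_one_iff.mp (hm x)) ht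

theorem dropTail_mem {w : Wedge n q (N + n)} (hw : w ∈ wedgeSpan n q (Low (N := N + n) (ν + 1))) :
    dropTail hq N ν w ∈ wedgeSpan n q (Low ν) := by
  obtain ⟨_, ⟨x, hx, rfl⟩, u, hu, rfl⟩ := Submodule.mem_sup.mp (low_le_sup hq hw)
  rw [map_add, dropTail_few hq hu, add_zero, dropTail_appTail hq hx]
  exact hx

/-- A pair of operators compatible with the tail preserves the spaces of bounded wedges and
commutes with the removal of the tail. -/
theorem tailAlgebra_intertwines {B : Module.End ℂ (Wedge n q N)}
    {A : Module.End ℂ (Wedge n q (N + n))} (h : (B, A) ∈ tailAlgebra hq N ν)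
    {w : Wedge n q (N + n)} (hw : w ∈ wedgeSpan n q (Low (N := N + n) (ν + 1))) :
    A w ∈ wedgeSpan n q (Low (N := N + n) (ν + 1)) ∧
      dropTail hq N ν (A w) = B (dropTail hq N ν w) := by
  obtain ⟨_, ⟨x, hx, rfl⟩, u, hu, rfl⟩ := Submodule.mem_sup.mp (low_le_sup hq hw)
  -- The error of `A` on the tail and the image of `u` both lie in the span that `dropTail` kills.
  have e : A (appTail hq N ν x + u) = appTail hq N ν (B x) +
      (A (appTail hq N ν x) - appTail hq N ν (B x) + A u) := by
    rw [map_add]; abel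
  have h1 : A (appTail hq N ν x) - appTail hq N ν (B x) + A u ∈ wedgeSpan n q (Few n ν) :=
    Submodule.add_mem _ (h.2.2 x hx) (h.2.1 u hu)
  rw [e]
  refine ⟨Submodule.add_mem _ (appTail_mem hq (h.1 x hx)) (few_le_low h1), ?_⟩
  rw [map_add, dropTail_few hq h1, add_zero, dropTail_appTail hq (h.1 x hx), map_add,
    dropTail_few hq hu, add_zero, dropTail_appTail hq hx]

end Rho

/-! ### The truncation map and the intertwining relations -/

section Main

variable {n : ℕ} {q : ℂˣ} (hq : (q : ℂ) + (q : ℂ)⁻¹ ≠ 0) (hn : 0 < n) (M : ℤ) (s r : ℕ)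

include hn

theorem VM_eq : VM n q M s (s + n * r) = wedgeSpan n q (Low (tailValue n M s r)) :=
  VM_eq_wedgeSpan M s fun _ hj => vac_last M s r hn hj

theorem VM_add_eq : VM n q M s (s + n * r + n) =
    wedgeSpan n q (Low (N := s + n * r + n) (tailValue n M s r + 1)) :=
  VM_eq_wedgeSpan M s fun j hj => by
    rw [vac_last M s (r + 1) hn (by rw [hj]; ring), tailValue, tailValue]
    push_cast
    ring

theorem dropTail_mem_VM (w : Wedge n q (s + n * r + n)) (hw : w ∈ VM n q M s (s + n * r + n)) :
    dropTail hq (s + n * r) (tailValue n M s r) w ∈ VM n q M s (s + n * r) := by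
  rw [VM_eq hn]
  rw [VM_add_eq hn] at hw
  exact dropTail_mem hq hw

/-- The truncation map. -/
def truncation : VM n q M s (s + n * r + n) →ₗ[ℂ] VM n q M s (s + n * r) :=
  (dropTail hq (s + n * r) (tailValue n M s r)).restrict (dropTail_mem_VM hq hn M s r)

omit hn in
theorem isTruncation_unique {N : ℕ} {ρ ρ' : VM n q M s (N + n) →ₗ[ℂ] VM n q M s N}
    (h : IsTruncation ρ) (h' : IsTruncation ρ') : ρ' = ρ := by
  refine LinearMap.ext fun ⟨w, hw⟩ => ?_
  refine Submodule.span_induction (p := fun w hw => ρ' ⟨w, hw⟩ = ρ ⟨w, hw⟩) ?_ ?_ ?_ ?_ hw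
  · rintro _ ⟨m, e, hme, rfl⟩
    by_cases ht : ∀ i : Fin n, m (Fin.natAdd N i) = vac n M s (N + i)
    · exact Subtype.ext (((h' m e hme).1 ht).trans ((h m e hme).1 ht).symm)
    · exact ((h' m e hme).2 ht).trans ((h m e hme).2 ht).symm
  · exact (map_zero ρ').trans (map_zero ρ).symm
  · intro x y hx hy h1 h2
    have h3 := congrArg₂ (· + ·) h1 h2
    simp only [← map_add] at h3
    exact h3
  · intro c x hx h1
    have h3 := congrArg (c • ·) h1
    simp only [← map_smul] at h3
    exact h3

theorem isTruncation_truncation : IsTruncation (truncation hq hn M s r) := by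
  intro m e hme
  have hs := normallyOrdered_iff.mp hme.1
  have hv : (∀ i : Fin n, m (Fin.natAdd (s + n * r) i) = vac n M s (s + n * r + i)) ↔
      ∀ i : Fin n, m (Fin.natAdd (s + n * r) i) = tailValue n M s r := by
    simp only [vac_tail]
  rw [hv]
  constructor
  · intro ht
    change dropTail hq (s + n * r) (tailValue n M s r) (wedge n q m e) = _
    rw [dropTail_wedge hq _ _ hs, if_pos ht]
  · intro ht
    apply Subtype.ext
    change dropTail hq (s + n * r) (tailValue n M s r) (wedge n q m e) = _
    rw [dropTail_wedge hq _ _ hs, if_neg ht]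
    rfl

theorem intertwines_of_mem {B : Module.End ℂ (Wedge n q (s + n * r))}
    {A : Module.End ℂ (Wedge n q (s + n * r + n))}
    (h : (B, A) ∈ tailAlgebra hq (s + n * r) (tailValue n M s r)) :
    Intertwines (truncation hq hn M s r) A B := by
  refine ⟨fun v hv => ?_, fun v hv => ?_, LinearMap.ext fun ⟨w, hw⟩ => Subtype.ext ?_⟩
  · rw [VM_add_eq hn] at hv ⊢
    exact (tailAlgebra_intertwines hq h hv).1
  · rw [VM_eq hn] at hv ⊢
    exact h.1 v hv
  · rw [VM_add_eq hn] at hw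
    exact (tailAlgebra_intertwines hq h hw).2

omit hn in
theorem hVac_add (p : ℂˣ) (l : ℤ) : hVac n q p M s (s + n * r + n) l =
    hVac n q p M s (s + n * r) l + ∑ u : Fin n, (((p ^ tailValue n M s r *
      q ^ (2 * (1 + (u : ℤ) - (s + n * r : ℕ) - n))) ^ l : ℂˣ) : ℂ) := by
  rw [hVac, Fin.sum_univ_add, hVac]
  congr 1
  -- The tail scalars run opposite to the vacuum terms: `q^{2(1+u-N-n)}` belongs to tail position `n
  -- - 1 - u`, both counted from `0`.
  rw [← Equiv.sum_comp Fin.revPerm]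
  refine Finset.sum_congr rfl fun u _ => ?_
  rw [Fin.val_natAdd, vac_tail, mul_zpow, ← zpow_mul, ← zpow_mul, Fin.revPerm_apply, mul_comm l]
  congr 3
  have := u.2
  rw [Fin.val_rev]
  push_cast [Nat.cast_sub (show (u : ℕ) + 1 ≤ n by omega)]
  ring

omit hn in
-- Subtract the vacuum eigenvalue for `N + n` sites from both members of the pair for `h_l`: the
-- scalar contributed by the tail cancels, and the eigenvalue for `N` sites remains in the first
-- member.
theorem gHam_mem (p : ℂˣ) (l : ℤ) :
    (gHam n q p M s (s + n * r) l, gHam n q p M s (s + n * r + n) l) ∈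
      tailAlgebra hq (s + n * r) (tailValue n M s r) := by
  have h := sub_mem (onWedge_hOp_mem (n := n) hq (N := s + n * r) (tailValue n M s r) p l)
    (Subalgebra.algebraMap_mem (tailAlgebra hq (s + n * r) (tailValue n M s r))
      (hVac n q p M s (s + n * r + n) l))
  convert h using 1
  rw [Prod.algebraMap_apply, Prod.mk_sub_mk, gHam, gHam, Algebra.algebraMap_eq_smul_one,
    Algebra.algebraMap_eq_smul_one, Algebra.algebraMap_eq_smul_one]
  congr 1
  rw [hVac_add, add_smul, add_sub_add_right_eq_sub]

end Main

end QWedge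

end
theorem propositionp (n : ℕ) (hn : 2 ≤ n) (q p : ℂˣ)
    (hq : ∀ k : ℕ, 0 < k → q ^ k = 1 → q = 1)
    (M : ℤ) (s : ℕ) (hs : s < n) (hM : M ≡ (s : ℤ) [ZMOD (n : ℤ)]) (r : ℕ) :
    (∀ (N : ℕ) (x : FreeAlgebra ℂ (QWedge.Gen n)), QWedge.Descends q (QWedge.U0 n q p N x)) ∧
    (∀ (N : ℕ) (l : ℤ), l ≠ 0 → QWedge.Descends q (QWedge.hOp n q p N l)) ∧
    ∃ ρ : QWedge.VM n q M s (s + n * r + n) →ₗ[ℂ] QWedge.VM n q M s (s + n * r),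
      QWedge.IsTruncation ρ ∧
      (∀ ρ' : QWedge.VM n q M s (s + n * r + n) →ₗ[ℂ] QWedge.VM n q M s (s + n * r),
        QWedge.IsTruncation ρ' → ρ' = ρ) ∧
      (∀ x : FreeAlgebra ℂ (QWedge.Gen n),
        QWedge.Intertwines ρ
          (QWedge.onWedge q (QWedge.U0 n q p (s + n * r + n) x))
          (QWedge.onWedge q (QWedge.U0 n q p (s + n * r) x))) ∧
      (∀ l : ℤ, l ≠ 0 →
        QWedge.Intertwines ρ
          (QWedge.gHam n q p M s (s + n * r + n) l)
          (QWedge.gHam n q p M s (s + n * r) l)) := by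
  have hq' := QWedge.add_inv_ne_zero q hq
  have hn' : 0 < n := by omega
  refine ⟨fun N x => QWedge.descends_U0 q p hn hq' x, fun N l _ => QWedge.descends_hOp q p n hq' l,
    QWedge.truncation hq' hn' M s r, QWedge.isTruncation_truncation hq' hn' M s r,
    fun ρ' h' => QWedge.isTruncation_unique M s
      (QWedge.isTruncation_truncation hq' hn' M s r) h',
    fun x => QWedge.intertwines_of_mem hq' hn' M s r (QWedge.onWedge_U0_mem hq' _ p hn x),
    fun l _ => QWedge.intertwines_of_mem hq' hn' M s r (QWedge.gHam_mem hq' M s r p l)⟩
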